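/- Let $M$ be a compact smooth manifold without boundary of dimension $n$, equipped with a smooth positive density $\nu$ (for example a Riemannian volume). Let $\Gamma\subset\mathbb R^p$ be a connected cone with nonempty interior, i.e. $\Gamma$ is an open subset of $\mathbb R^p\setminus\{0\}$ invariant under multiplication by positive reals, or the closure in $\mathbb R^p$ of such a set. For compact $L\subset\Gamma$ put $L^c=\{t\xi : \xi\in L,\ t\ge 1\}$. A function on $\Gamma$ (or on $\Gamma\times M\times M$) is called smooth if it is the restriction of a smooth function defined on an open neighbourhood $U$ of $\Gamma$ (respectively on $U\times M\times M$). Let $S^{-\infty}(\Gamma)$ be the space of smooth functions $f:\Gamma\to\mathbb C$ such that for every compact $L\subset\Gamma$, every multi-index $\alpha$ and every $N$ the function $(1+|\xi|)^N|\partial^\alpha f(\xi)|$ is bounded on $L^c$. Let $L^{-\infty}(M,\Gamma)$ be the space of families $A=(A(\mu))_{\mu\in\Gamma}$ of integral operators on $L^2(M,\nu)$, $$(A(\mu)u)(x)=\int_M k(\mu,x,y)\,u(y)\,d\nu(y),$$ whose kernel $k:\Gamma\times M\times M\to\mathbb C$ is smooth and such that, in local coordinates on $M\times M$, each derivative of $k$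 in $(\mu,x,y)$ multiplied by $(1+|\mu|)^N$ is bounded for $\mu\in L^c$ and $(x,y)$ in a compact subset of the coordinate domain, for all compact $L\subset\Gamma$ and all $N$. Let $\tau:L^{-\infty}(M,\Gamma)\to S^{-\infty}(\Gamma)$ be a $\mathbb C$-linear map such that for all $A,B\in L^{-\infty}(M,\Gamma)$ and $j=1,\dots,p$ 1. $\tau(AB)=\tau(BA)$, where $(AB)(\mu)=A(\mu)B(\mu)$, 2. $\tau(\partial_jA)=\partial_j\tau(A)$, where $\partial_j=\partial/\partial\mu_j$, 3. $\tau(\mu_jA)=\mu_j\,\tau(A)$, where $\mu_j$ is multiplication by the $j$-th coordinate function. Then there is a constant $c\in\mathbb C$ such that for every $A\in L^{-\infty}(M,\Gamma)$ and every $\mu\in\Gamma$ the operator $A(\mu)$ is of trace class on $L^2(M,\nu)$ and $$\tau(A)(\mu)=c\,\operatorname{tr}_{L^2}(A(\mu)).$$ -/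

import Mathlib

open MeasureTheory
open scoped Manifold ContDiff

noncomputable section

namespace ParametricTrace

/-! ### Cones and rapidly decreasing symbols -/

/-- A cone in `ℝ^p`: an open subset of `ℝ^p ∖ {0}` that is invariant under multiplication by
positive reals, or the closure of such a set, with nonempty interior. -/
def IsCone {p : ℕ} (Γ : Set (EuclideanSpace ℝ (Fin p))) : Prop :=
  (∃ C : Set (EuclideanSpace ℝ (Fin p)), IsOpen C ∧ (0 : EuclideanSpace ℝ (Fin p)) ∉ C ∧
      (∀ t : ℝ, 0 < t → ∀ ξ ∈ C, t • ξ ∈ C) ∧ (Γ = C ∨ Γ = closure C)) ∧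
    (interior Γ).Nonempty

/-- The set `L^c = {t ξ | ξ ∈ L, t ≥ 1}`. -/
def outwardHull {p : ℕ} (L : Set (EuclideanSpace ℝ (Fin p))) :
    Set (EuclideanSpace ℝ (Fin p)) :=
  {ξ | ∃ t : ℝ, 1 ≤ t ∧ ∃ η ∈ L, ξ = t • η}

/-- `f` belongs to `S^{-∞}(Γ)`: it is the restriction to `Γ` of a smooth function `F` defined on an
open set containing `Γ`, and each derivative decays faster than every power of `|ξ|`, uniformly on
`L^c` for every compact `L ⊆ Γ`. (If `Γ` is a cone, then `L^c ⊆ Γ`, and the derivatives of `F` at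
the points of `Γ` are determined by `f`, since the interior of `Γ` is dense in `Γ`.) -/
def IsRapidSymbol {p : ℕ} (Γ : Set (EuclideanSpace ℝ (Fin p))) (f : Γ → ℂ) : Prop :=
  ∃ (U : Set (EuclideanSpace ℝ (Fin p))) (F : EuclideanSpace ℝ (Fin p) → ℂ),
    IsOpen U ∧ Γ ⊆ U ∧ ContDiffOn ℝ ∞ F U ∧ (∀ μ : Γ, F μ = f μ) ∧
    ∀ L : Set (EuclideanSpace ℝ (Fin p)), L ⊆ Γ → IsCompact L →
      ∀ l N : ℕ, ∃ c : ℝ, ∀ ξ ∈ Γ ∩ outwardHull L,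
        (1 + ‖ξ‖) ^ N * ‖iteratedFDeriv ℝ l F ξ‖ ≤ c

/-- The space `S^{-∞}(Γ)`. -/
def rapidSymbols {p : ℕ} (Γ : Set (EuclideanSpace ℝ (Fin p))) : Submodule ℂ (Γ → ℂ) where
  carrier := {f | IsRapidSymbol Γ f}
  zero_mem' := by
    refine ⟨Set.univ, fun _ => 0, isOpen_univ, Set.subset_univ _, contDiffOn_const,
      fun _ => rfl, fun L _ _ l N => ⟨0, fun ξ _ => ?_⟩⟩
    have h : iteratedFDeriv ℝ l (fun _ : EuclideanSpace ℝ (Fin p) => (0 : ℂ)) ξ = 0 := by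
      simp
    simp [h]
  add_mem' := by
    rintro f g ⟨U, F, hU, hΓU, hF, hFf, hFb⟩ ⟨W, G, hW, hΓW, hG, hGg, hGb⟩
    refine ⟨U ∩ W, F + G, hU.inter hW, Set.subset_inter hΓU hΓW,
      (hF.mono Set.inter_subset_left).add (hG.mono Set.inter_subset_right),
      fun μ => by simp [hFf, hGg], fun L hL hLc l N => ?_⟩
    obtain ⟨c, hc⟩ := hFb L hL hLc l N
    obtain ⟨d, hd⟩ := hGb L hL hLc l N
    refine ⟨c + d, fun ξ hξ => ?_⟩
    have h1 : ContDiffAt ℝ l F ξ :=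
      (hF.contDiffAt (hU.mem_nhds (hΓU hξ.1))).of_le (mod_cast le_top)
    have h2 : ContDiffAt ℝ l G ξ :=
      (hG.contDiffAt (hW.mem_nhds (hΓW hξ.1))).of_le (mod_cast le_top)
    rw [iteratedFDeriv_add_apply h1 h2]
    calc (1 + ‖ξ‖) ^ N * ‖iteratedFDeriv ℝ l F ξ + iteratedFDeriv ℝ l G ξ‖
        ≤ (1 + ‖ξ‖) ^ N * (‖iteratedFDeriv ℝ l F ξ‖ + ‖iteratedFDeriv ℝ l G ξ‖) := by
          gcongr
          exact norm_add_le _ _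
      _ ≤ c + d := by
          rw [mul_add]
          exact add_le_add (hc ξ hξ) (hd ξ hξ)
  smul_mem' := by
    rintro a f ⟨U, F, hU, hΓU, hF, hFf, hFb⟩
    refine ⟨U, a • F, hU, hΓU, contDiffOn_const.smul hF, fun μ => by simp [hFf],
      fun L hL hLc l N => ?_⟩
    obtain ⟨c, hc⟩ := hFb L hL hLc l N
    refine ⟨‖a‖ * c, fun ξ hξ => ?_⟩
    have h1 : ContDiffAt ℝ l F ξ :=
      (hF.contDiffAt (hU.mem_nhds (hΓU hξ.1))).of_le (mod_cast le_top)
    rw [iteratedFDeriv_const_smul_apply h1, norm_smul]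
    calc (1 + ‖ξ‖) ^ N * (‖a‖ * ‖iteratedFDeriv ℝ l F ξ‖)
        = ‖a‖ * ((1 + ‖ξ‖) ^ N * ‖iteratedFDeriv ℝ l F ξ‖) := by ring
      _ ≤ ‖a‖ * c := by
          gcongr
          exact hc ξ hξ

/-- `g = ∂_j f` for families parametrized by `Γ`: at every interior point of `Γ`, the family `f`
has the derivative `g` in the `j`-th coordinate direction, in the norm of the target. (On a cone the
interior is dense, so a continuous `g` is determined by this.) -/
def IsPartialDeriv {p : ℕ} {Γ : Set (EuclideanSpace ℝ (Fin p))} {X : Type*}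
    [NormedAddCommGroup X] [NormedSpace ℝ X] (j : Fin p) (f g : Γ → X) : Prop :=
  ∀ μ : Γ, (μ : EuclideanSpace ℝ (Fin p)) ∈ interior Γ →
    HasLineDerivAt ℝ (Function.extend Subtype.val f 0) (g μ) (μ : EuclideanSpace ℝ (Fin p))
      (EuclideanSpace.single j 1)

/-! ### Smooth densities, smoothing kernels and parametric smoothing operators -/

/-- `ν` is given by a smooth positive density: in every chart it has a smooth positive density with
respect to Lebesgue measure. The Riemannian measures are of this kind. -/
def IsSmoothDensity {n : ℕ} {M : Type*} [TopologicalSpace M]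
    [ChartedSpace (EuclideanSpace ℝ (Fin n)) M] [MeasurableSpace M] (ν : Measure M) : Prop :=
  ∀ φ ∈ atlas (EuclideanSpace ℝ (Fin n)) M, ∃ r : EuclideanSpace ℝ (Fin n) → ℝ,
    ContDiffOn ℝ ∞ r φ.target ∧ (∀ a ∈ φ.target, 0 < r a) ∧
    ∀ s : Set M, MeasurableSet s → s ⊆ φ.source →
      ν s = ∫⁻ a in φ '' s, ENNReal.ofReal (r a)

/-- `k` belongs to `𝓢(Γ, C^∞(M × M))`: it is the restriction to `Γ × M × M` of a smooth function `K`
on `U × M × M` with `U` an open set containing `Γ`, and, in local coordinates on `M × M`, each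
derivative of `K` decays faster than every power of `|ξ|`, uniformly on `L^c × Q` for every compact
`L ⊆ Γ` and every compact subset `Q` of the coordinate domain. -/
def IsSmoothingKernel {p n : ℕ} (Γ : Set (EuclideanSpace ℝ (Fin p))) {M : Type*}
    [TopologicalSpace M] [ChartedSpace (EuclideanSpace ℝ (Fin n)) M]
    (k : Γ → M → M → ℂ) : Prop :=
  ∃ (U : Set (EuclideanSpace ℝ (Fin p))) (K : EuclideanSpace ℝ (Fin p) × M × M → ℂ),
    IsOpen U ∧ Γ ⊆ U ∧
    ContMDiffOn (𝓘(ℝ, EuclideanSpace ℝ (Fin p)).prod ((𝓡 n).prod (𝓡 n))) 𝓘(ℝ, ℂ) ∞ K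
      (U ×ˢ Set.univ) ∧
    (∀ (μ : Γ) (x y : M), K (μ, x, y) = k μ x y) ∧
    ∀ φ ∈ atlas (EuclideanSpace ℝ (Fin n)) M, ∀ ψ ∈ atlas (EuclideanSpace ℝ (Fin n)) M,
      ∀ Q : Set (EuclideanSpace ℝ (Fin n) × EuclideanSpace ℝ (Fin n)),
        Q ⊆ φ.target ×ˢ ψ.target → IsCompact Q →
      ∀ L : Set (EuclideanSpace ℝ (Fin p)), L ⊆ Γ → IsCompact L →
        ∀ l N : ℕ, ∃ c : ℝ, ∀ ξ ∈ Γ ∩ outwardHull L, ∀ q ∈ Q,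
          (1 + ‖ξ‖) ^ N *
            ‖iteratedFDeriv ℝ l
              (fun z : EuclideanSpace ℝ (Fin p) ×
                  EuclideanSpace ℝ (Fin n) × EuclideanSpace ℝ (Fin n) =>
                K (z.1, φ.symm z.2.1, ψ.symm z.2.2)) (ξ, q)‖ ≤ c

/-- The complex Hilbert space `L²(M, ν)`. -/
abbrev L2 {M : Type*} [MeasurableSpace M] (ν : Measure M) : Type _ := Lp ℂ 2 ν

/-- The operator `T` on `L²(M, ν)` is the integral operator with kernel `k`. -/
def HasKernel {M : Type*} [MeasurableSpace M] {ν : Measure M} (T : L2 ν →L[ℂ] L2 ν)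
    (k : M → M → ℂ) : Prop :=
  ∀ u : L2 ν, (T u : M → ℂ) =ᵐ[ν] fun x => ∫ y, k x y * (u : M → ℂ) y ∂ν

theorem contDiffAt_local {p n : ℕ} {M : Type*} [TopologicalSpace M]
    [ChartedSpace (EuclideanSpace ℝ (Fin n)) M] [IsManifold (𝓡 n) ∞ M]
    {U : Set (EuclideanSpace ℝ (Fin p))} {K : EuclideanSpace ℝ (Fin p) × M × M → ℂ}
    (hU : IsOpen U)
    (hK : ContMDiffOn (𝓘(ℝ, EuclideanSpace ℝ (Fin p)).prod ((𝓡 n).prod (𝓡 n))) 𝓘(ℝ, ℂ) ∞ K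
      (U ×ˢ Set.univ))
    {φ ψ : OpenPartialHomeomorph M (EuclideanSpace ℝ (Fin n))}
    (hφ : φ ∈ atlas (EuclideanSpace ℝ (Fin n)) M) (hψ : ψ ∈ atlas (EuclideanSpace ℝ (Fin n)) M)
    {ξ : EuclideanSpace ℝ (Fin p)} (hξ : ξ ∈ U)
    {q : EuclideanSpace ℝ (Fin n) × EuclideanSpace ℝ (Fin n)} (hq : q ∈ φ.target ×ˢ ψ.target)
    (l : ℕ) :
    ContDiffAt ℝ l (fun z : EuclideanSpace ℝ (Fin p) ×
      EuclideanSpace ℝ (Fin n) × EuclideanSpace ℝ (Fin n) =>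
        K (z.1, φ.symm z.2.1, ψ.symm z.2.2)) (ξ, q) := by
  have hφ' := contMDiffOn_symm_of_mem_maximalAtlas
    (IsManifold.subset_maximalAtlas (I := 𝓡 n) (n := ∞) hφ)
  have hψ' := contMDiffOn_symm_of_mem_maximalAtlas
    (IsManifold.subset_maximalAtlas (I := 𝓡 n) (n := ∞) hψ)
  have h1 : ContMDiffAt (𝓡 n) (𝓡 n) ∞ φ.symm q.1 :=
    hφ'.contMDiffAt (φ.open_target.mem_nhds hq.1)
  have h2 : ContMDiffAt (𝓡 n) (𝓡 n) ∞ ψ.symm q.2 :=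
    hψ'.contMDiffAt (ψ.open_target.mem_nhds hq.2)
  have hK' : ContMDiffAt (𝓘(ℝ, EuclideanSpace ℝ (Fin p)).prod ((𝓡 n).prod (𝓡 n))) 𝓘(ℝ, ℂ) ∞ K
      (ξ, φ.symm q.1, ψ.symm q.2) :=
    hK.contMDiffAt ((hU.prod isOpen_univ).mem_nhds ⟨hξ, trivial⟩)
  have e1 : ContMDiffAt 𝓘(ℝ, EuclideanSpace ℝ (Fin p) ×
      EuclideanSpace ℝ (Fin n) × EuclideanSpace ℝ (Fin n)) 𝓘(ℝ, EuclideanSpace ℝ (Fin p)) ∞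
      (fun z : EuclideanSpace ℝ (Fin p) ×
      EuclideanSpace ℝ (Fin n) × EuclideanSpace ℝ (Fin n) => z.1) (ξ, q) :=
    contDiff_fst.contMDiff.contMDiffAt
  have e2 : ContMDiffAt 𝓘(ℝ, EuclideanSpace ℝ (Fin p) ×
      EuclideanSpace ℝ (Fin n) × EuclideanSpace ℝ (Fin n)) (𝓡 n) ∞
      (fun z : EuclideanSpace ℝ (Fin p) ×
      EuclideanSpace ℝ (Fin n) × EuclideanSpace ℝ (Fin n) => z.2.1) (ξ, q) :=
    (contDiff_fst.comp contDiff_snd).contMDiff.contMDiffAt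
  have e3 : ContMDiffAt 𝓘(ℝ, EuclideanSpace ℝ (Fin p) ×
      EuclideanSpace ℝ (Fin n) × EuclideanSpace ℝ (Fin n)) (𝓡 n) ∞
      (fun z : EuclideanSpace ℝ (Fin p) ×
      EuclideanSpace ℝ (Fin n) × EuclideanSpace ℝ (Fin n) => z.2.2) (ξ, q) :=
    (contDiff_snd.comp contDiff_snd).contMDiff.contMDiffAt
  have h1' := ContMDiffAt.comp (x := (ξ, q)) (g := φ.symm) h1 e2
  have h2' := ContMDiffAt.comp (x := (ξ, q)) (g := ψ.symm) h2 e3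
  have h3 := ContMDiffAt.comp (x := (ξ, q)) (g := K) hK' (e1.prodMk (h1'.prodMk h2'))
  exact (contMDiffAt_iff_contDiffAt.1 h3).of_le (mod_cast le_top)

/-- The space `L^{-∞}(M, Γ)` of parametric smoothing operators: families of operators on
`L²(M, ν)`, parametrized by `Γ`, whose kernels (with respect to `ν`) belong to
`𝓢(Γ, C^∞(M × M))`. -/
def smoothingFamilies {p : ℕ} (n : ℕ) (Γ : Set (EuclideanSpace ℝ (Fin p))) {M : Type*}
    [TopologicalSpace M] [CompactSpace M] [ChartedSpace (EuclideanSpace ℝ (Fin n)) M]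
    [IsManifold (𝓡 n) ∞ M] [MeasurableSpace M] [BorelSpace M]
    (ν : Measure M) [IsFiniteMeasure ν] :
    Submodule ℂ (Γ → (L2 ν →L[ℂ] L2 ν)) where
  carrier := {A | ∃ k : Γ → M → M → ℂ, IsSmoothingKernel (n := n) Γ k ∧ ∀ μ, HasKernel (A μ) (k μ)}
  zero_mem' := by
    refine ⟨fun _ _ _ => 0, ⟨Set.univ, fun _ => 0, isOpen_univ, Set.subset_univ _,
      contMDiffOn_const, fun _ _ _ => rfl,
      fun φ _ ψ _ Q _ _ L _ _ l N => ⟨0, fun ξ _ q _ => ?_⟩⟩, fun μ u => ?_⟩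
    · have h : iteratedFDeriv ℝ l (fun _ : EuclideanSpace ℝ (Fin p) ×
          EuclideanSpace ℝ (Fin n) × EuclideanSpace ℝ (Fin n) => (0 : ℂ)) (ξ, q) = 0 := by
        simp
      simp [h]
    · filter_upwards [Lp.coeFn_zero ℂ 2 ν] with x hx
      simpa using hx
  add_mem' := by
    rintro A B ⟨k, ⟨U, K, hU, hΓU, hK, hKk, hKb⟩, hA⟩ ⟨k', ⟨W, K', hW, hΓW, hK', hKk', hKb'⟩, hB⟩
    have key : ∀ (U : Set (EuclideanSpace ℝ (Fin p))) (K : EuclideanSpace ℝ (Fin p) × M × M → ℂ)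
        (k : Γ → M → M → ℂ), Γ ⊆ U →
        ContMDiffOn (𝓘(ℝ, EuclideanSpace ℝ (Fin p)).prod ((𝓡 n).prod (𝓡 n))) 𝓘(ℝ, ℂ) ∞ K
          (U ×ˢ Set.univ) → (∀ (μ : Γ) (x y : M), K (μ, x, y) = k μ x y) →
        ∀ (μ : Γ) (x : M) (u : L2 ν), Integrable (fun y => k μ x y * (u : M → ℂ) y) ν := by
      intro U K k hΓU hK hKk μ x u
      have hc : Continuous (k μ x) := by
        have h := hK.continuousOn.comp_continuous
          (f := fun y : M => ((μ : EuclideanSpace ℝ (Fin p)), x, y)) (by fun_prop)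
          (fun y => ⟨hΓU μ.2, trivial⟩)
        exact h.congr fun y => hKk μ x y
      obtain ⟨c, hc'⟩ := (isCompact_range hc).isBounded.exists_norm_le
      exact ((Lp.memLp u).integrable (by norm_num)).bdd_mul hc.measurable.aestronglyMeasurable
        (Filter.Eventually.of_forall fun y => hc' _ (Set.mem_range_self y))
    refine ⟨fun μ x y => k μ x y + k' μ x y, ⟨U ∩ W, fun z => K z + K' z, hU.inter hW,
      Set.subset_inter hΓU hΓW, ?_, fun μ x y => by simp [hKk, hKk'],
      fun φ hφ ψ hψ Q hQ hQc L hL hLc l N => ?_⟩, fun μ u => ?_⟩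
    · exact (hK.mono (Set.prod_mono Set.inter_subset_left le_rfl)).add
        (hK'.mono (Set.prod_mono Set.inter_subset_right le_rfl))
    · obtain ⟨c, hc⟩ := hKb φ hφ ψ hψ Q hQ hQc L hL hLc l N
      obtain ⟨d, hd⟩ := hKb' φ hφ ψ hψ Q hQ hQc L hL hLc l N
      refine ⟨c + d, fun ξ hξ q hq => ?_⟩
      have h := iteratedFDeriv_add_apply (contDiffAt_local hU hK hφ hψ (hΓU hξ.1) (hQ hq) l)
        (contDiffAt_local hW hK' hφ hψ (hΓW hξ.1) (hQ hq) l)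
      have h' := congrArg norm h
      refine le_trans (le_of_eq (congrArg ((1 + ‖ξ‖) ^ N * ·) h')) ?_
      refine le_trans (mul_le_mul_of_nonneg_left (norm_add_le _ _) (by positivity)) ?_
      rw [mul_add]
      exact add_le_add (hc ξ hξ q hq) (hd ξ hξ q hq)
    · filter_upwards [hA μ u, hB μ u, Lp.coeFn_add (A μ u) (B μ u)] with x h1 h2 h3
      change ((A μ u + B μ u : L2 ν) : M → ℂ) x = _
      rw [h3, Pi.add_apply, h1, h2, ← integral_add (key U K k hΓU hK hKk μ x u)
        (key W K' k' hΓW hK' hKk' μ x u)]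
      simp only [add_mul]
  smul_mem' := by
    rintro a A ⟨k, ⟨U, K, hU, hΓU, hK, hKk, hKb⟩, hA⟩
    refine ⟨fun μ x y => a * k μ x y, ⟨U, fun z => a • K z, hU, hΓU,
      (contDiff_const_smul a).contMDiff.comp_contMDiffOn hK, fun μ x y => by simp [hKk],
      fun φ hφ ψ hψ Q hQ hQc L hL hLc l N => ?_⟩, fun μ u => ?_⟩
    · obtain ⟨c, hc⟩ := hKb φ hφ ψ hψ Q hQ hQc L hL hLc l N
      refine ⟨‖a‖ * c, fun ξ hξ q hq => ?_⟩
      have h := iteratedFDeriv_const_smul_apply' (a := a)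
        (contDiffAt_local hU hK hφ hψ (hΓU hξ.1) (hQ hq) l)
      have h' := (congrArg norm h).trans (norm_smul _ _)
      refine le_trans (le_of_eq (congrArg ((1 + ‖ξ‖) ^ N * ·) h')) ?_
      refine le_trans (le_of_eq (mul_left_comm _ _ _)) ?_
      exact mul_le_mul_of_nonneg_left (hc ξ hξ q hq) (norm_nonneg _)
    · filter_upwards [hA μ u, Lp.coeFn_smul a (A μ u)] with x h1 h3
      change ((a • A μ u : L2 ν) : M → ℂ) x = _
      rw [h3, Pi.smul_apply, h1, smul_eq_mul, ← integral_const_mul]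
      simp only [mul_assoc]

/-- `T` is a trace class operator on the complex Hilbert space `H` with trace `t`: for every Hilbert
basis `b` the series `∑ ⟨b i, T (b i)⟩` converges (absolutely) to `t`. -/
def HasTrace {H : Type*} [NormedAddCommGroup H] [InnerProductSpace ℂ H] (T : H →L[ℂ] H) (t : ℂ) :
    Prop :=
  ∀ (s : Set H) (b : HilbertBasis s ℂ H), HasSum (fun i => inner ℂ (b i) (T (b i))) t

end ParametricTrace

end

/-! The axioms on `τ` separate the behaviour at a fixed parameter from the dependence on the
parameter.

Locality. A smoothing family that vanishes at `a` has the form `∑ (μ_j - a_j) B_j` with smoothing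
families `B_j`: near `a` this is Hadamard's lemma for the kernel, away from `a` one divides by `|μ -
a|²` (`exists_eq_sum_smul`). As `τ` commutes with each `μ_j`, such a family has `τ(A)(a) = 0`, so
`τ(A)(a)` depends on the operator `A(a)` alone. Constant families do not decay, so a single operator
`T` is represented by the family `G T` with `G(μ) = exp(-|μ|²)`. Since `G S T = (√G S)(√G T)`, the
functional `T ↦ τ(G T)(a)` vanishes on commutators.

Uniqueness of the trace on smoothing operators (`exists_trace`). No continuity of the functional is
available, so the argument is algebraic, with finitely many commutators. In charts, Fourier series
turn smoothing operators into rapidly decreasing matrices over `ℤ^n`. A matrix with zero diagonal is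
a sum of `n` commutators with the coordinate multiplications `a ↦ a_j`. A matrix `u ⊗ v` differs by
one commutator from `∑ u_a v_a` times a matrix unit. Hence a trace on matrices is a multiple of the
sum of the diagonal. To make operator composition equal to matrix multiplication, one needs
localized exponentials with a biorthogonal dual system (`exists_biorthogonal`); pieces belonging to
other charts are moved to this system by a further commutator (`map_op_eq`). The result is a fixed
operator `E` with `t(T) = t(E) tr T` for every tracial `t`.

Dependence on the parameter. From `∂_j (G E) = -2 μ_j G E` and the two axioms on `∂_j` and `μ_j`,
the function `τ(G E)` satisfies the differential equation of `G`. So `τ(G E) / G` is locally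
constant on the interior, and constant on `Γ` by connectedness or by continuity at the apex
(`IsCone.exists_eq_const`). This constant is `c`. -/

noncomputable section

namespace ParametricTrace

/-! ### Nuclear operators given by summable coefficient matrices -/

section Nuclear

open InnerProductSpace

variable {H J : Type*} [NormedAddCommGroup H] [InnerProductSpace ℂ H]

/-- The operator `∑ c a b ⟨y b, ·⟩ x a`. -/
def nuc (x y : J → H) (c : J → J → ℂ) : H →L[ℂ] H :=
  ∑' p : J × J, c p.1 p.2 • rankOne ℂ (x p.1) (y p.2)

variable {x y x' y' : J → H} {c c' : J → J → ℂ} {K : ℝ}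

theorem norm_nuc_term_le (hx : ∀ a, ‖x a‖ ≤ K) (hy : ∀ a, ‖y a‖ ≤ K) (p : J × J) :
    ‖c p.1 p.2 • rankOne ℂ (x p.1) (y p.2)‖ ≤ ‖c p.1 p.2‖ * (K * K) := by
  rw [norm_smul, norm_rankOne]
  gcongr
  · exact (norm_nonneg _).trans (hx p.1)
  · exact hx _
  · exact hy _

theorem summable_norm_nuc (hx : ∀ a, ‖x a‖ ≤ K) (hy : ∀ a, ‖y a‖ ≤ K)
    (hc : Summable fun p : J × J => ‖c p.1 p.2‖) :
    Summable fun p : J × J => ‖c p.1 p.2 • rankOne ℂ (x p.1) (y p.2)‖ :=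
  Summable.of_nonneg_of_le (fun _ => norm_nonneg _) (norm_nuc_term_le hx hy) (hc.mul_right _)

theorem hasSum_nuc [CompleteSpace H] (hx : ∀ a, ‖x a‖ ≤ K) (hy : ∀ a, ‖y a‖ ≤ K)
    (hc : Summable fun p : J × J => ‖c p.1 p.2‖) :
    HasSum (fun p : J × J => c p.1 p.2 • rankOne ℂ (x p.1) (y p.2)) (nuc x y c) :=
  (summable_norm_nuc hx hy hc).of_norm.hasSum

theorem nuc_add [CompleteSpace H] (hx : ∀ a, ‖x a‖ ≤ K) (hy : ∀ a, ‖y a‖ ≤ K)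
    (hc : Summable fun p : J × J => ‖c p.1 p.2‖) (hc' : Summable fun p : J × J => ‖c' p.1 p.2‖) :
    nuc x y (c + c') = nuc x y c + nuc x y c' := by
  refine HasSum.tsum_eq ?_
  simpa only [Pi.add_apply, add_smul] using (hasSum_nuc hx hy hc).add (hasSum_nuc hx hy hc')

theorem nuc_smul [CompleteSpace H] (hx : ∀ a, ‖x a‖ ≤ K) (hy : ∀ a, ‖y a‖ ≤ K)
    (hc : Summable fun p : J × J => ‖c p.1 p.2‖) (r : ℂ) :
    nuc x y (r • c) = r • nuc x y c := by
  refine HasSum.tsum_eq ?_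
  simpa only [Pi.smul_apply, smul_eq_mul, mul_smul] using (hasSum_nuc hx hy hc).const_smul r

/-- Absolute convergence allows the four indices to be regrouped: the outer pair survives in a
product of two matrix-like series, the inner pair is summed. -/
theorem tsum_mul_tsum_reindex {R : Type*} [NormedRing R] [CompleteSpace R] {u v : J × J → R}
    (hu : Summable fun p => ‖u p‖) (hv : Summable fun p => ‖v p‖) :
    (∑' p, u p) * ∑' p, v p = ∑' p : J × J, ∑' q : J × J, u (p.1, q.1) * v (q.2, p.2) := by
  let e : (J × J) × (J × J) ≃ (J × J) × (J × J) :=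
    ⟨fun z => ((z.1.1, z.2.1), (z.2.2, z.1.2)), fun z => ((z.1.1, z.2.2), (z.1.2, z.2.1)),
      fun _ => rfl, fun _ => rfl⟩
  have hs := e.summable_iff.2 (summable_mul_of_summable_norm hu hv)
  rw [tsum_mul_tsum_of_summable_norm hu hv, ← e.tsum_eq]
  exact hs.tsum_prod

/-- Rank one operators compose by a scalar product, so the Gram matrix of the two inner systems
appears between the coefficient matrices. -/
theorem nuc_comp_nuc [CompleteSpace H] (hx : ∀ a, ‖x a‖ ≤ K) (hy : ∀ a, ‖y a‖ ≤ K)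
    (hx' : ∀ a, ‖x' a‖ ≤ K) (hy' : ∀ a, ‖y' a‖ ≤ K)
    (hc : Summable fun p : J × J => ‖c p.1 p.2‖) (hc' : Summable fun p : J × J => ‖c' p.1 p.2‖) :
    (nuc x y c).comp (nuc x' y' c') =
      nuc x y' fun a b => ∑' q : J × J, c a q.1 * inner ℂ (y q.1) (x' q.2) * c' q.2 b := by
  have hs := summable_norm_nuc hx hy hc
  have hs' := summable_norm_nuc hx' hy' hc'
  change (nuc x y c) * (nuc x' y' c') = _
  rw [nuc, nuc, tsum_mul_tsum_reindex hs hs', nuc]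
  congr 1
  ext1 ⟨a, b⟩
  have hscal : Summable fun q : J × J => c a q.1 * inner ℂ (y q.1) (x' q.2) * c' q.2 b := by
    have h2 : Summable fun q : J × J => ‖c a q.1‖ * ‖c' q.2 b‖ := by
      refine Summable.mul_of_nonneg (f := fun i => ‖c a i‖) (g := fun i => ‖c' i b‖)
        ?_ ?_ (fun _ => norm_nonneg _) (fun _ => norm_nonneg _)
      · exact hc.comp_injective (i := fun i => (a, i)) fun i j h => (Prod.ext_iff.1 h).2
      · exact hc'.comp_injective (i := fun i => (i, b)) fun i j h => (Prod.ext_iff.1 h).1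
    refine Summable.of_norm_bounded (h2.mul_left (K * K)) fun q => ?_
    have h3 : ‖inner ℂ (y q.1) (x' q.2)‖ ≤ K * K :=
      (norm_inner_le_norm _ _).trans
        (mul_le_mul (hy _) (hx' _) (norm_nonneg _) ((norm_nonneg _).trans (hy q.1)))
    calc ‖c a q.1 * inner ℂ (y q.1) (x' q.2) * c' q.2 b‖
        = ‖inner ℂ (y q.1) (x' q.2)‖ * (‖c a q.1‖ * ‖c' q.2 b‖) := by
          rw [norm_mul, norm_mul]; ring
      _ ≤ _ := by gcongr
  rw [← hscal.tsum_smul_const]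
  congr 1
  ext1 q
  ext z
  simp only [mul_apply_eq_comp, _root_.smul_apply, rankOne_apply,
    map_smul, smul_smul]
  congr 1
  ring

/-- Parseval for `u` and `v` together with `|zw| ≤ |z|² + |w|²`. The bound on the sum does not
depend on the basis, which makes Fubini possible in `hasTrace_nuc`. -/
theorem summable_norm_inner_mul_inner {ι : Type*} (b : HilbertBasis ι ℂ H) (u v : H) :
    (Summable fun i => ‖inner ℂ (b i) u * inner ℂ v (b i)‖) ∧
      ∑' i, ‖inner ℂ (b i) u * inner ℂ v (b i)‖ ≤ ‖u‖ ^ 2 + ‖v‖ ^ 2 := by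
  have hu : HasSum (fun i => ‖inner ℂ (b i) u‖ ^ 2) (‖u‖ ^ 2) := by
    have h := (b.hasSum_inner_mul_inner u u).mapL Complex.reCLM
    rw [Complex.reCLM_apply, inner_self_eq_norm_sq_to_K] at h
    convert h using 1
    · ext i
      rw [Complex.reCLM_apply, ← inner_conj_symm u (b i), RCLike.conj_mul]
      norm_cast
    · norm_cast
  have hv : HasSum (fun i => ‖inner ℂ v (b i)‖ ^ 2) (‖v‖ ^ 2) := by
    have h := (b.hasSum_inner_mul_inner v v).mapL Complex.reCLM
    rw [Complex.reCLM_apply, inner_self_eq_norm_sq_to_K] at h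
    convert h using 1
    · ext i
      rw [Complex.reCLM_apply, ← inner_conj_symm (b i) v, RCLike.mul_conj]
      norm_cast
    · norm_cast
  have hle : ∀ i, ‖inner ℂ (b i) u * inner ℂ v (b i)‖ ≤
      ‖inner ℂ (b i) u‖ ^ 2 + ‖inner ℂ v (b i)‖ ^ 2 := fun i => by
    rw [norm_mul]
    nlinarith [sq_nonneg (‖inner ℂ (b i) u‖ - ‖inner ℂ v (b i)‖),
      sq_nonneg ‖inner ℂ (b i) u‖, sq_nonneg ‖inner ℂ v (b i)‖]
  have hs := Summable.of_nonneg_of_le (fun _ => norm_nonneg _) hle (hu.add hv).summable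
  exact ⟨hs, hasSum_le hle hs.hasSum (hu.add hv)⟩

/-- Fubini for the sum over rank one terms and basis vectors: summing over the basis first gives the
scalar products by Parseval, summing over the terms first gives the diagonal entries. -/
theorem hasTrace_nuc [CompleteSpace H] (hx : ∀ a, ‖x a‖ ≤ K) (hy : ∀ a, ‖y a‖ ≤ K)
    (hc : Summable fun p : J × J => ‖c p.1 p.2‖) :
    HasTrace (nuc x y c) (∑' p : J × J, c p.1 p.2 * inner ℂ (y p.2) (x p.1)) := by
  intro s b
  have hK : ∀ p : J × J, ‖x p.1‖ ^ 2 + ‖y p.2‖ ^ 2 ≤ 2 * K ^ 2 := fun p => by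
    have h1 := pow_le_pow_left₀ (norm_nonneg _) (hx p.1) 2
    have h2 := pow_le_pow_left₀ (norm_nonneg _) (hy p.2) 2
    linarith
  let F : (J × J) × s → ℂ := fun z =>
    c z.1.1 z.1.2 * (inner ℂ (b z.2) (x z.1.1) * inner ℂ (y z.1.2) (b z.2))
  have hF : Summable F := by
    refine Summable.of_norm ((summable_prod_of_nonneg fun _ => norm_nonneg _).2 ⟨fun p => ?_, ?_⟩)
    · simp only [F, norm_mul (c p.1 p.2)]
      exact (summable_norm_inner_mul_inner b (x p.1) (y p.2)).1.mul_left _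
    · simp only [F, norm_mul (c _ _)]
      refine Summable.of_nonneg_of_le (fun p => tsum_nonneg fun _ => by positivity) (fun p => ?_)
        (hc.mul_right (2 * K ^ 2))
      rw [tsum_mul_left]
      gcongr
      exact (summable_norm_inner_mul_inner b (x p.1) (y p.2)).2.trans (hK p)
  have h1 : HasSum (fun p : J × J => c p.1 p.2 * inner ℂ (y p.2) (x p.1)) (∑' z, F z) :=
    hF.hasSum.prod_fiberwise fun p => by
      have h := (b.hasSum_inner_mul_inner (y p.2) (x p.1)).mul_left (c p.1 p.2)
      simpa only [F, mul_comm (inner ℂ (y p.2) _)] using h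
  rw [h1.tsum_eq]
  have h2 := (Equiv.prodComm s (J × J)).hasSum_iff.2 hF.hasSum
  refine h2.prod_fiberwise fun i => ?_
  have h3 := ((hasSum_nuc hx hy hc).mapL
    ((innerSL ℂ (b i)).comp (ContinuousLinearMap.apply ℂ H (b i))))
  refine h3.congr_fun fun p => ?_
  simp only [Function.comp_apply, Equiv.prodComm_apply, Prod.swap, F,
    ContinuousLinearMap.comp_apply, ContinuousLinearMap.apply_apply,
    _root_.smul_apply, rankOne_apply, innerSL_apply_apply, inner_smul_right]
  ring

end Nuclear

end ParametricTrace
end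

noncomputable section

namespace ParametricTrace

/-! ### Rapidly decreasing matrices indexed by `ℤ^n` -/

section Rapid

variable {n : ℕ}

/-- Rapidly decreasing families indexed by `ℤ^n`. -/
def IsRapidVec (l : (Fin n → ℤ) → ℂ) : Prop :=
  ∀ N : ℕ, ∃ C : ℝ, ∀ a, (1 + ‖a‖) ^ N * ‖l a‖ ≤ C

/-- Rapidly decreasing matrices indexed by `ℤ^n`. -/
def IsRapidMat (c : (Fin n → ℤ) → (Fin n → ℤ) → ℂ) : Prop :=
  ∀ N : ℕ, ∃ C : ℝ, ∀ a b, (1 + ‖a‖) ^ N * (1 + ‖b‖) ^ N * ‖c a b‖ ≤ C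

/-- The space of rapidly decreasing matrices. -/
def rapidMatrices (n : ℕ) : Submodule ℂ ((Fin n → ℤ) → (Fin n → ℤ) → ℂ) where
  carrier := {c | IsRapidMat c}
  zero_mem' := fun N => ⟨0, fun a b => by simp⟩
  add_mem' := by
    intro c d hc hd N
    obtain ⟨C, hC⟩ := hc N
    obtain ⟨D, hD⟩ := hd N
    refine ⟨C + D, fun a b => ?_⟩
    calc (1 + ‖a‖) ^ N * (1 + ‖b‖) ^ N * ‖c a b + d a b‖
        ≤ (1 + ‖a‖) ^ N * (1 + ‖b‖) ^ N * (‖c a b‖ + ‖d a b‖) := by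
          gcongr
          exact norm_add_le _ _
      _ ≤ C + D := by
          rw [mul_add]
          exact add_le_add (hC a b) (hD a b)
  smul_mem' := by
    intro r c hc N
    obtain ⟨C, hC⟩ := hc N
    refine ⟨‖r‖ * C, fun a b => ?_⟩
    calc (1 + ‖a‖) ^ N * (1 + ‖b‖) ^ N * ‖r * c a b‖
        = ‖r‖ * ((1 + ‖a‖) ^ N * (1 + ‖b‖) ^ N * ‖c a b‖) := by rw [norm_mul]; ring
      _ ≤ _ := by
          gcongr
          exact hC a b

theorem summable_one_add_norm_pow_card_inv (ι : Type*) [Fintype ι] :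
    Summable fun a : ι → ℤ => ((1 + ‖a‖) ^ (Fintype.card ι + 1))⁻¹ := by
  let L := Submodule.span ℤ (Set.range (Pi.basisFun ℝ ι))
  let φ : (ι → ℤ) → L := fun a => ⟨fun i => (a i : ℝ), by
    rw [(Pi.basisFun ℝ ι).mem_span_iff_repr_mem ℤ]
    intro i
    exact ⟨a i, by simp⟩⟩
  have hφ : Function.Injective φ := fun a b h => by
    funext i
    have h' : (a i : ℝ) = b i := congrFun (congrArg Subtype.val h) i
    exact_mod_cast h'
  have hn : ∀ a, ‖φ a‖ = ‖a‖ := fun a => by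
    have h' : ∀ i, ‖((a i : ℤ) : ℝ)‖₊ = ‖a i‖₊ := fun i => by ext; simp [Int.norm_eq_abs]
    simp [φ, Pi.norm_def, h']
  have hfin : Module.finrank ℤ L = Fintype.card ι := by
    rw [ZLattice.rank ℝ L]; simp
  have h := (ZLattice.summable_norm_pow_inv L (Fintype.card ι + 1) (by omega)).comp_injective hφ
  refine Summable.of_norm_bounded_eventually h ?_
  -- The comparison with `‖a‖⁻¹ ^ k` can fail only at `a = 0`, where the inverse is zero by
  -- convention.
  refine (Set.finite_singleton (0 : ι → ℤ)).subset fun a ha => ?_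
  by_contra h0
  apply ha
  have h1 : 0 < ‖a‖ := norm_pos_iff.2 h0
  change ‖((1 + ‖a‖) ^ (Fintype.card ι + 1))⁻¹‖ ≤ ‖φ a‖⁻¹ ^ (Fintype.card ι + 1)
  rw [hn, norm_inv, Real.norm_of_nonneg (by positivity), inv_pow]
  gcongr
  linarith

theorem summable_one_add_norm_pow_inv (n : ℕ) :
    Summable fun a : Fin n → ℤ => ((1 + ‖a‖) ^ (n + 1))⁻¹ := by
  simpa using summable_one_add_norm_pow_card_inv (Fin n)

theorem summable_weight_prod (n : ℕ) : Summable fun p : (Fin n → ℤ) × (Fin n → ℤ) =>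
    ((1 + ‖p.1‖) ^ (n + 1) * (1 + ‖p.2‖) ^ (n + 1))⁻¹ := by
  simp only [mul_inv]
  exact (summable_one_add_norm_pow_inv n).mul_of_nonneg (summable_one_add_norm_pow_inv n)
    (fun _ => by positivity) (fun _ => by positivity)

theorem IsRapidMat.summable_norm {c : (Fin n → ℤ) → (Fin n → ℤ) → ℂ} (hc : IsRapidMat c) :
    Summable fun p : (Fin n → ℤ) × (Fin n → ℤ) => ‖c p.1 p.2‖ := by
  obtain ⟨C, hC⟩ := hc (n + 1)
  refine Summable.of_nonneg_of_le (fun _ => norm_nonneg _) (fun p => ?_)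
    ((summable_weight_prod n).mul_left C)
  rw [← div_eq_mul_inv, le_div_iff₀ (by positivity), mul_comm]
  exact hC p.1 p.2

theorem IsRapidVec.bounded {l : (Fin n → ℤ) → ℂ} (hl : IsRapidVec l) :
    ∃ C : ℝ, 0 ≤ C ∧ ∀ a, ‖l a‖ ≤ C := by
  obtain ⟨C, hC⟩ := hl 0
  exact ⟨C, (by simpa using (norm_nonneg _).trans (by simpa using hC 0)), by simpa using hC⟩

theorem IsRapidMat.of_le_mul {c d : (Fin n → ℤ) → (Fin n → ℤ) → ℂ} (hc : IsRapidMat c) (k : ℕ)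
    (K : ℝ) (h : ∀ a b, ‖d a b‖ ≤ K * ((1 + ‖a‖) ^ k * (1 + ‖b‖) ^ k * ‖c a b‖)) :
    IsRapidMat d := by
  intro N
  obtain ⟨C, hC⟩ := hc (N + k)
  refine ⟨|K| * C, fun a b => ?_⟩
  calc (1 + ‖a‖) ^ N * (1 + ‖b‖) ^ N * ‖d a b‖
      ≤ (1 + ‖a‖) ^ N * (1 + ‖b‖) ^ N * (|K| * ((1 + ‖a‖) ^ k * (1 + ‖b‖) ^ k * ‖c a b‖)) := by
        gcongr
        refine (h a b).trans ?_
        gcongr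
        exact le_abs_self K
    _ = |K| * ((1 + ‖a‖) ^ (N + k) * (1 + ‖b‖) ^ (N + k) * ‖c a b‖) := by ring
    _ ≤ _ := by
        gcongr
        exact hC a b

theorem IsRapidVec.mul_coord {l : (Fin n → ℤ) → ℂ} (hl : IsRapidVec l) (j : Fin n) :
    IsRapidVec fun a => (a j : ℂ) * l a := by
  intro N
  obtain ⟨C, hC⟩ := hl (N + 1)
  refine ⟨C, fun a => le_trans ?_ (hC a)⟩
  have h : ‖(a j : ℂ)‖ ≤ 1 + ‖a‖ := by
    have := norm_le_pi_norm a j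
    rw [Complex.norm_intCast]
    rw [Int.norm_eq_abs] at this
    linarith
  rw [norm_mul, pow_succ, mul_assoc]
  gcongr

theorem norm_coord_le (a : Fin n → ℤ) (j : Fin n) : ‖(a j : ℂ)‖ ≤ 1 + ‖a‖ := by
  have := norm_le_pi_norm a j
  rw [Complex.norm_intCast]
  rw [Int.norm_eq_abs] at this
  linarith

theorem IsRapidVec.mul {l m : (Fin n → ℤ) → ℂ} (hl : IsRapidVec l) (hm : IsRapidVec m) :
    IsRapidMat fun a b => l a * m b := by
  intro N
  obtain ⟨C, hC⟩ := hl N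
  obtain ⟨D, hD⟩ := hm N
  refine ⟨C * D, fun a b => ?_⟩
  calc (1 + ‖a‖) ^ N * (1 + ‖b‖) ^ N * ‖l a * m b‖
      = ((1 + ‖a‖) ^ N * ‖l a‖) * ((1 + ‖b‖) ^ N * ‖m b‖) := by rw [norm_mul]; ring
    _ ≤ C * D := mul_le_mul (hC a) (hD b) (by positivity) (le_trans (by positivity) (hC a))

theorem IsRapidMat.diag {c : (Fin n → ℤ) → (Fin n → ℤ) → ℂ} (hc : IsRapidMat c) :
    IsRapidVec fun a => c a a := by
  intro N
  obtain ⟨C, hC⟩ := hc N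
  refine ⟨C, fun a => le_trans ?_ (hC a a)⟩
  gcongr
  exact le_mul_of_one_le_right (by positivity)
    (one_le_pow₀ (by linarith [norm_nonneg a]))

/-- The diagonal matrix with a rapidly decreasing diagonal. -/
theorem IsRapidVec.diagonal {l : (Fin n → ℤ) → ℂ} (hl : IsRapidVec l) :
    IsRapidMat fun a b => if a = b then l a else 0 := by
  intro N
  obtain ⟨C, hC⟩ := hl (N + N)
  refine ⟨C, fun a b => ?_⟩
  rcases eq_or_ne a b with h | h
  · subst h
    simpa [pow_add] using hC a
  · simpa [h] using le_trans (by positivity) (hC a)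

/-- A rapidly decreasing family is a product of two such families. -/
theorem IsRapidVec.exists_mul {l : (Fin n → ℤ) → ℂ} (hl : IsRapidVec l) :
    ∃ u v : (Fin n → ℤ) → ℂ, IsRapidVec u ∧ IsRapidVec v ∧ ∀ a, l a = u a * v a := by
  have key : ∀ w : (Fin n → ℤ) → ℂ, (∀ a, ‖w a‖ ≤ √‖l a‖) → IsRapidVec w := fun w hw N => by
    obtain ⟨C, hC⟩ := hl (2 * N)
    refine ⟨√C, fun a => ?_⟩
    calc (1 + ‖a‖) ^ N * ‖w a‖ ≤ (1 + ‖a‖) ^ N * √‖l a‖ := by gcongr; exact hw a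
      _ = √((1 + ‖a‖) ^ (2 * N) * ‖l a‖) := by
        rw [Real.sqrt_mul (by positivity), mul_comm 2 N, pow_mul, Real.sqrt_sq (by positivity)]
      _ ≤ √C := Real.sqrt_le_sqrt (hC a)
  -- Both factors have modulus `√‖l a‖`, and a square root only halves the available exponent of
  -- decay.
  refine ⟨fun a => (√‖l a‖ : ℝ), fun a => l a / (√‖l a‖ : ℝ), key _ fun a => ?_, key _ fun a => ?_,
    fun a => ?_⟩
  · simp [abs_of_nonneg (Real.sqrt_nonneg _)]
  · rw [norm_div, Complex.norm_real, Real.norm_of_nonneg (Real.sqrt_nonneg _), Real.div_sqrt]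
  · rcases eq_or_ne (l a) 0 with h | h
    · simp [h]
    · have : ((√‖l a‖ : ℝ) : ℂ) ≠ 0 := by
        simpa [Real.sqrt_eq_zero'] using h
      field_simp

/-- A rapidly decreasing matrix is the product of a diagonal one and another one. -/
theorem IsRapidMat.exists_diag_mul {c : (Fin n → ℤ) → (Fin n → ℤ) → ℂ} (hc : IsRapidMat c) :
    ∃ (l : (Fin n → ℤ) → ℂ) (d : (Fin n → ℤ) → (Fin n → ℤ) → ℂ), IsRapidVec l ∧ IsRapidMat d ∧
      ∀ a b, c a b = l a * d a b := by
  have hbdd : ∀ a, BddAbove (Set.range fun b => ‖c a b‖) := fun a => by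
    obtain ⟨C, hC⟩ := hc 0
    exact ⟨C, by rintro _ ⟨b, rfl⟩; simpa using hC a b⟩
  -- The square root of the row supremum decays rapidly in `a`, and it is large enough for `c a b /
  -- m a` to be bounded by `√‖c a b‖`, which decays in both indices.
  let m : (Fin n → ℤ) → ℝ := fun a => √(⨆ b, ‖c a b‖)
  have hm : ∀ a b, √‖c a b‖ ≤ m a := fun a b => Real.sqrt_le_sqrt (le_ciSup (hbdd a) b)
  have hm0 : ∀ a, 0 ≤ m a := fun a => Real.sqrt_nonneg _
  refine ⟨fun a => m a, fun a b => c a b / m a, fun N => ?_, fun N => ?_, fun a b => ?_⟩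
  · obtain ⟨C, hC⟩ := hc (2 * N)
    refine ⟨√C, fun a => ?_⟩
    rw [Complex.norm_real, Real.norm_of_nonneg (hm0 a)]
    calc (1 + ‖a‖) ^ N * m a = √((1 + ‖a‖) ^ (2 * N) * ⨆ b, ‖c a b‖) := by
          rw [Real.sqrt_mul (by positivity), mul_comm 2 N, pow_mul, Real.sqrt_sq (by positivity)]
      _ ≤ √C := by
          apply Real.sqrt_le_sqrt
          rw [Real.mul_iSup_of_nonneg (by positivity)]
          refine ciSup_le fun b => le_trans ?_ (hC a b)
          gcongr
          exact le_mul_of_one_le_right (by positivity)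
            (one_le_pow₀ (by linarith [norm_nonneg b]))
  · obtain ⟨C, hC⟩ := hc (2 * N)
    refine ⟨√C, fun a b => ?_⟩
    have h1 : ‖c a b / (m a : ℂ)‖ ≤ √‖c a b‖ := by
      rw [norm_div, Complex.norm_real, Real.norm_of_nonneg (hm0 a)]
      refine div_le_of_le_mul₀ (hm0 a) (Real.sqrt_nonneg _) ?_
      nth_rewrite 1 [← Real.mul_self_sqrt (norm_nonneg (c a b))]
      gcongr
      exact hm a b
    calc (1 + ‖a‖) ^ N * (1 + ‖b‖) ^ N * ‖c a b / (m a : ℂ)‖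
        ≤ (1 + ‖a‖) ^ N * (1 + ‖b‖) ^ N * √‖c a b‖ := by gcongr
      _ = √((1 + ‖a‖) ^ (2 * N) * (1 + ‖b‖) ^ (2 * N) * ‖c a b‖) := by
          rw [Real.sqrt_mul (by positivity), Real.sqrt_mul (by positivity), mul_comm 2 N, pow_mul,
            pow_mul, Real.sqrt_sq (by positivity), Real.sqrt_sq (by positivity)]
      _ ≤ √C := Real.sqrt_le_sqrt (hC a b)
  · rcases eq_or_ne (m a) 0 with h | h
    · have := hm a b
      rw [h] at this
      have h2 : ‖c a b‖ ≤ 0 := Real.sqrt_eq_zero'.1 (le_antisymm this (Real.sqrt_nonneg _))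
      simp [h, norm_le_zero_iff.1 h2]
    · have : (m a : ℂ) ≠ 0 := by exact_mod_cast h
      field_simp

variable (t : rapidMatrices n →ₗ[ℂ] ℂ)

/-- A linear functional on rapidly decreasing matrices that is invariant under commutation with
diagonal matrices vanishes on commutators with the multiplication by a coordinate. -/
theorem map_coord_commutator
    (h1 : ∀ (l : (Fin n → ℤ) → ℂ) (c : (Fin n → ℤ) → (Fin n → ℤ) → ℂ), IsRapidVec l →
      IsRapidMat c → ∀ d d' : rapidMatrices n, (∀ a b, d.1 a b = l a * c a b) →
        (∀ a b, d'.1 a b = c a b * l b) → t d = t d')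
    (j : Fin n) (c : (Fin n → ℤ) → (Fin n → ℤ) → ℂ) (hc : IsRapidMat c) (d : rapidMatrices n)
    (hd : ∀ a b, d.1 a b = ((a j : ℂ) - b j) * c a b) : t d = 0 := by
  -- Multiplication by `a_j` is unbounded, so it is not itself an admissible diagonal matrix. With
  -- `c = l e` it is absorbed into `l` on one side and into `e` on the other.
  obtain ⟨l, e, hl, he, hle⟩ := hc.exists_diag_mul
  have hjl := hl.mul_coord j
  have hej : IsRapidMat fun a b => e a b * (b j : ℂ) := by
    refine he.of_le_mul 1 1 fun a b => ?_
    rw [norm_mul, one_mul, mul_comm]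
    gcongr
    rw [pow_one, pow_one]
    exact (norm_coord_le b j).trans
      (le_mul_of_one_le_left (by positivity) (by linarith [norm_nonneg a]))
  have r1 : IsRapidMat fun a b => ((a j : ℂ) * l a) * e a b := by
    refine hc.of_le_mul 1 1 fun a b => ?_
    rw [mul_assoc, ← hle, norm_mul, one_mul]
    gcongr
    rw [pow_one, pow_one]
    exact (norm_coord_le a j).trans
      (le_mul_of_one_le_right (by positivity) (by linarith [norm_nonneg b]))
  have r2 : IsRapidMat fun a b => l a * (e a b * (b j : ℂ)) := by
    refine hc.of_le_mul 1 1 fun a b => ?_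
    rw [← mul_assoc, ← hle, norm_mul, one_mul, mul_comm]
    gcongr
    rw [pow_one, pow_one]
    exact (norm_coord_le b j).trans
      (le_mul_of_one_le_left (by positivity) (by linarith [norm_nonneg a]))
  obtain ⟨L, hL0, hL⟩ := hl.bounded
  have r3 : IsRapidMat fun a b => e a b * ((b j : ℂ) * l b) := by
    refine hej.of_le_mul 0 L fun a b => ?_
    rw [← mul_assoc, norm_mul, mul_comm]
    simp only [pow_zero, one_mul]
    gcongr
    exact hL b
  -- `(a_j l) e` and `l (e b_j)` are both moved to the same matrix `e b_j l`: the first by commuting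
  -- `a_j l`, the second by commuting `l`.
  have e1 := h1 _ e hjl he ⟨_, r1⟩ ⟨_, r3⟩ (fun _ _ => rfl) (fun _ _ => rfl)
  have e2 := h1 l _ hl hej ⟨_, r2⟩ ⟨_, r3⟩ (fun _ _ => rfl) (fun a b => by ring)
  have e3 : d = ⟨_, r1⟩ - ⟨_, r2⟩ := by
    ext a b
    change d.1 a b = (a j : ℂ) * l a * e a b - l a * (e a b * (b j : ℂ))
    rw [hd, hle]
    ring
  rw [e3, map_sub, e1, e2, sub_self]

/-- Off the diagonal, `1 = ∑_j (a_j - b_j)² / |a - b|²`. This writes the matrix as a sum of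
coordinate commutators, to which `map_coord_commutator` applies. -/
theorem map_eq_zero_of_diag_eq_zero
    (h1 : ∀ (l : (Fin n → ℤ) → ℂ) (c : (Fin n → ℤ) → (Fin n → ℤ) → ℂ), IsRapidVec l →
      IsRapidMat c → ∀ d d' : rapidMatrices n, (∀ a b, d.1 a b = l a * c a b) →
        (∀ a b, d'.1 a b = c a b * l b) → t d = t d')
    (d : rapidMatrices n) (hd : ∀ a, d.1 a a = 0) : t d = 0 := by
  let q : (Fin n → ℤ) → (Fin n → ℤ) → ℤ := fun a b => ∑ k, (a k - b k) ^ 2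
  -- Integers satisfy `|m| ≤ m²`; this bounds the quotients below by one.
  have hq : ∀ a b j, |a j - b j| ≤ q a b := fun a b j => by
    calc |a j - b j| ≤ (a j - b j) ^ 2 := by
          rw [← sq_abs]
          exact Int.le_self_sq _
      _ ≤ q a b := Finset.single_le_sum (f := fun k => (a k - b k) ^ 2)
          (fun k _ => sq_nonneg _) (Finset.mem_univ j)
  let e : Fin n → (Fin n → ℤ) → (Fin n → ℤ) → ℂ := fun j a b =>
    (((a j - b j : ℤ) : ℂ) / q a b) * d.1 a b
  have he : ∀ j, IsRapidMat (e j) := fun j => by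
    refine IsRapidMat.of_le_mul d.2 0 1 fun a b => ?_
    simp only [e, norm_mul, norm_div, Complex.norm_intCast, pow_zero, one_mul]
    refine mul_le_of_le_one_left (norm_nonneg _) (div_le_one_of_le₀ ?_ (abs_nonneg _))
    exact_mod_cast (hq a b j).trans (le_abs_self _)
  have hf : ∀ j, IsRapidMat fun a b => ((a j : ℂ) - b j) * e j a b := fun j => by
    refine (he j).of_le_mul 1 2 fun a b => ?_
    rw [norm_mul, ← mul_assoc]
    gcongr
    rw [pow_one, pow_one]
    have h3 := norm_sub_le (a j : ℂ) (b j)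
    have := norm_coord_le a j
    have := norm_coord_le b j
    nlinarith [norm_nonneg a, norm_nonneg b, mul_nonneg (norm_nonneg a) (norm_nonneg b)]
  have hsum : d = ∑ j, (⟨_, hf j⟩ : rapidMatrices n) := by
    ext a b
    rw [AddSubmonoidClass.coe_finsetSum, Finset.sum_apply, Finset.sum_apply]
    rcases eq_or_ne a b with rfl | hab
    · simp [hd]
    · have hq0 : (q a b : ℂ) ≠ 0 := by
        obtain ⟨j, hj⟩ := Function.ne_iff.1 hab
        have := (abs_pos.2 (sub_ne_zero.2 hj)).trans_le (hq a b j)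
        exact_mod_cast this.ne'
      have : ∀ j, ((a j : ℂ) - b j) * e j a b = ((a j : ℂ) - b j) ^ 2 * (d.1 a b / q a b) :=
        fun j => by
          simp only [e]
          push_cast
          ring
      simp only [this]
      rw [← Finset.sum_mul]
      have h4 : ∑ j, ((a j : ℂ) - b j) ^ 2 = q a b := by simp [q]
      rw [h4]
      field_simp
  rw [hsum, map_sum]
  exact Finset.sum_eq_zero fun j _ => map_coord_commutator t h1 j (e j) (he j) _ fun _ _ => rfl

/-- Uniqueness of the trace on rapidly decreasing matrices. -/
theorem map_eq_tsum_diag_mul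
    (h1 : ∀ (l : (Fin n → ℤ) → ℂ) (c : (Fin n → ℤ) → (Fin n → ℤ) → ℂ), IsRapidVec l →
      IsRapidMat c → ∀ d d' : rapidMatrices n, (∀ a b, d.1 a b = l a * c a b) →
        (∀ a b, d'.1 a b = c a b * l b) → t d = t d')
    (κ : ℂ) (h2 : ∀ u v : (Fin n → ℤ) → ℂ, IsRapidVec u → IsRapidVec v → ∀ d : rapidMatrices n,
      (∀ a b, d.1 a b = u a * v b) → t d = κ * ∑' a, u a * v a)
    (d : rapidMatrices n) : t d = κ * ∑' a, d.1 a a := by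
  obtain ⟨u, v, hu, hv, huv⟩ := (IsRapidMat.diag d.2).exists_mul
  -- The rank one matrix `u ⊗ v` has the same diagonal as `d`, so only its value, prescribed by
  -- `h2`, matters.
  have h3 := map_eq_zero_of_diag_eq_zero t h1 (d - ⟨_, hu.mul hv⟩)
    fun a => sub_eq_zero.2 (huv a)
  rw [map_sub, sub_eq_zero] at h3
  rw [h3, h2 u v hu hv _ fun _ _ => rfl]
  simp only [huv]

end Rapid

end ParametricTrace
end

noncomputable section

namespace ParametricTrace

/-! ### Fourier series -/

section Fourier

open Complex

/-- The exponential `x ↦ exp (2 π i a · x)`. -/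
def expo {ι : Type*} [Fintype ι] (a : ι → ℤ) (x : EuclideanSpace ℝ ι) : ℂ :=
  cexp ((2 * Real.pi * ∑ j, (a j : ℝ) * x j : ℝ) * I)

section

variable {ι : Type*} [Fintype ι]

theorem norm_expo (a : ι → ℤ) (x : EuclideanSpace ℝ ι) : ‖expo a x‖ = 1 :=
  norm_exp_ofReal_mul_I _

theorem expo_add (a b : ι → ℤ) (x : EuclideanSpace ℝ ι) :
    expo (a + b) x = expo a x * expo b x := by
  rw [expo, expo, expo, ← Complex.exp_add, ← add_mul, ← ofReal_add, ← mul_add,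
    ← Finset.sum_add_distrib]
  simp [add_mul]

@[simp] theorem expo_zero (x : EuclideanSpace ℝ ι) : expo 0 x = 1 := by simp [expo]

theorem expo_add_right (a : ι → ℤ) (x y : EuclideanSpace ℝ ι) :
    expo a (x + y) = expo a x * expo a y := by
  rw [expo, expo, expo, ← Complex.exp_add, ← add_mul, ← ofReal_add, ← mul_add,
    ← Finset.sum_add_distrib]
  simp [mul_add]

end

theorem norm_iteratedFDeriv_exp_mul_I (k : ℕ) (t : ℝ) :
    ‖iteratedFDeriv ℝ k (fun t : ℝ => cexp (t * I)) t‖ = 1 := by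
  have h : ∀ k : ℕ, iteratedDeriv k (fun t : ℝ => cexp (t * I)) =
      fun t : ℝ => I ^ k * cexp (t * I) := by
    intro k
    induction k with
    | zero => simp
    | succ k ih =>
      rw [iteratedDeriv_succ, ih]
      ext t
      have h1 : HasDerivAt (fun t : ℝ => (t : ℂ) * I) (1 * I) t :=
        (HasDerivAt.ofReal_comp (hasDerivAt_id t)).mul_const I
      rw [(h1.cexp.const_mul (I ^ k)).deriv]
      ring
  rw [norm_iteratedFDeriv_eq_norm_iteratedDeriv, h]
  simp [norm_exp_ofReal_mul_I]

/-- The Faà di Bruno bound applies with all derivatives of `exp (it)` of norm one, and a linear `θ`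
has no derivatives beyond the first. -/
theorem norm_iteratedFDeriv_exp_linear_le {E : Type*} [NormedAddCommGroup E] [NormedSpace ℝ E]
    (θ : E →L[ℝ] ℝ) (k : ℕ) (x : E) :
    ‖iteratedFDeriv ℝ k (fun z => cexp ((θ z : ℝ) * I)) x‖ ≤ k.factorial * 1 * ‖θ‖ ^ k := by
  have hg : ContDiff ℝ ∞ fun t : ℝ => cexp (t * I) :=
    (Complex.ofRealCLM.contDiff.mul contDiff_const).cexp
  refine norm_iteratedFDeriv_comp_le (g := fun t : ℝ => cexp (t * I)) (f := θ) (N := ∞)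
    hg θ.contDiff (mod_cast le_top) x
    (fun i _ => (norm_iteratedFDeriv_exp_mul_I i (θ x)).le) fun i hi _ => ?_
  obtain ⟨j, rfl⟩ : ∃ j, i = j + 1 := ⟨i - 1, by omega⟩
  have hθ : fderiv ℝ θ = fun _ => θ := by
    ext1 y
    exact θ.fderiv
  rw [← norm_iteratedFDeriv_fderiv, hθ]
  rcases eq_or_ne j 0 with rfl | h1
  · simp
  · rw [iteratedFDeriv_const_of_ne h1]
    simp only [Pi.zero_apply, norm_zero]
    positivity

variable {n : ℕ}

/-- The linear functional `(x, y) ↦ 2 π (a · x - b · y)`. -/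
def phase (a b : Fin n → ℤ) :
    EuclideanSpace ℝ (Fin n) × EuclideanSpace ℝ (Fin n) →L[ℝ] ℝ :=
  (2 * Real.pi) • ((∑ j, (a j : ℝ) • EuclideanSpace.proj j).comp (ContinuousLinearMap.fst ℝ _ _) -
    (∑ j, (b j : ℝ) • EuclideanSpace.proj j).comp (ContinuousLinearMap.snd ℝ _ _))

theorem expo_mul_expo_neg (a b : Fin n → ℤ)
    (z : EuclideanSpace ℝ (Fin n) × EuclideanSpace ℝ (Fin n)) :
    expo a z.1 * expo (-b) z.2 = cexp ((phase a b z : ℝ) * I) := by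
  rw [expo, expo, ← Complex.exp_add, ← add_mul, ← ofReal_add]
  congr 3
  simp [phase, Finset.sum_neg_distrib]
  ring

/-- The growth is stated with the product weight of `IsRapidMat`, so that each derivative of a
Fourier term costs one power of that weight. -/
theorem exists_norm_phase_le (n : ℕ) : ∃ C : ℝ, 0 ≤ C ∧ ∀ a b : Fin n → ℤ,
    ‖phase a b‖ ≤ C * ((1 + ‖a‖) * (1 + ‖b‖)) := by
  let P : Fin n → EuclideanSpace ℝ (Fin n) →L[ℝ] ℝ := fun j => EuclideanSpace.proj j
  let S := ∑ j, ‖P j‖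
  have hS : 0 ≤ S := Finset.sum_nonneg fun _ _ => norm_nonneg _
  have key : ∀ a : Fin n → ℤ, ‖∑ j, (a j : ℝ) • P j‖ ≤ S * ‖a‖ := fun a => by
    refine (norm_sum_le _ _).trans ?_
    rw [Finset.sum_mul]
    refine Finset.sum_le_sum fun j _ => ?_
    have := norm_le_pi_norm a j
    rw [Int.norm_eq_abs] at this
    rw [norm_smul, mul_comm, Real.norm_eq_abs]
    exact mul_le_mul_of_nonneg_left this (norm_nonneg (P j))
  let F := ContinuousLinearMap.fst ℝ (EuclideanSpace ℝ (Fin n)) (EuclideanSpace ℝ (Fin n))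
  let G := ContinuousLinearMap.snd ℝ (EuclideanSpace ℝ (Fin n)) (EuclideanSpace ℝ (Fin n))
  refine ⟨2 * Real.pi * (S * ‖F‖ + S * ‖G‖), by positivity, fun a b => ?_⟩
  rw [phase, norm_smul, Real.norm_of_nonneg (by positivity), mul_assoc (2 * Real.pi)]
  refine mul_le_mul_of_nonneg_left ?_ (by positivity)
  refine (norm_sub_le ((∑ j, (a j : ℝ) • P j).comp F) ((∑ j, (b j : ℝ) • P j).comp G)).trans ?_
  have h1 : ‖(∑ j, (a j : ℝ) • P j).comp F‖ ≤ S * ‖a‖ * ‖F‖ :=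
    (ContinuousLinearMap.opNorm_comp_le _ _).trans (by gcongr; exact key a)
  have h2 : ‖(∑ j, (b j : ℝ) • P j).comp G‖ ≤ S * ‖b‖ * ‖G‖ :=
    (ContinuousLinearMap.opNorm_comp_le _ _).trans (by gcongr; exact key b)
  refine (add_le_add h1 h2).trans ?_
  have h3 : ‖a‖ ≤ (1 + ‖a‖) * (1 + ‖b‖) := by
    nlinarith [norm_nonneg a, norm_nonneg b, mul_nonneg (norm_nonneg a) (norm_nonneg b)]
  have h4 : ‖b‖ ≤ (1 + ‖a‖) * (1 + ‖b‖) := by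
    nlinarith [norm_nonneg a, norm_nonneg b, mul_nonneg (norm_nonneg a) (norm_nonneg b)]
  have h5 := mul_le_mul_of_nonneg_left h3 (mul_nonneg hS (norm_nonneg F))
  have h6 := mul_le_mul_of_nonneg_left h4 (mul_nonneg hS (norm_nonneg G))
  nlinarith

/-- The function on `ℝ^n × ℝ^n` with the matrix `c` of Fourier coefficients. -/
def fourierSum (c : (Fin n → ℤ) → (Fin n → ℤ) → ℂ)
    (z : EuclideanSpace ℝ (Fin n) × EuclideanSpace ℝ (Fin n)) : ℂ :=
  ∑' p : (Fin n → ℤ) × (Fin n → ℤ), c p.1 p.2 * (expo p.1 z.1 * expo (-p.2) z.2)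

/-- Termwise differentiation: the `k`-th derivatives are dominated by the coefficients times the
`k`-th power of the weight, which remain summable. -/
theorem IsRapidMat.contDiff_fourierSum {c : (Fin n → ℤ) → (Fin n → ℤ) → ℂ} (hc : IsRapidMat c) :
    ContDiff ℝ ∞ (fourierSum c) := by
  obtain ⟨C, hC0, hC⟩ := exists_norm_phase_le n
  have h := contDiff_tsum (𝕜 := ℝ) (N := ⊤)
    (f := fun (p : (Fin n → ℤ) × (Fin n → ℤ))
      (z : EuclideanSpace ℝ (Fin n) × EuclideanSpace ℝ (Fin n)) =>
        c p.1 p.2 * cexp ((phase p.1 p.2 z : ℝ) * I))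
    (v := fun k p => k.factorial * C ^ k *
      ‖(1 + ‖p.1‖ : ℂ) ^ k * (1 + ‖p.2‖ : ℂ) ^ k * c p.1 p.2‖) (fun p => ?_) (fun k _ => ?_)
    (fun k p z _ => ?_)
  · simp only [← expo_mul_expo_neg] at h
    exact h
  · exact contDiff_const.mul
      ((Complex.ofRealCLM.contDiff.comp (phase p.1 p.2).contDiff).mul contDiff_const).cexp
  · refine Summable.mul_left _ (IsRapidMat.summable_norm
      (c := fun a b => (1 + ‖a‖ : ℂ) ^ k * (1 + ‖b‖ : ℂ) ^ k * c a b) ?_)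
    refine hc.of_le_mul k 1 fun a b => ?_
    rw [norm_mul, norm_mul, norm_pow, norm_pow, one_mul]
    norm_cast
    rw [Real.norm_of_nonneg (by positivity), Real.norm_of_nonneg (by positivity)]
  · have h1 : ContDiff ℝ k fun z : EuclideanSpace ℝ (Fin n) × EuclideanSpace ℝ (Fin n) =>
        cexp ((phase p.1 p.2 z : ℝ) * I) :=
      ((Complex.ofRealCLM.contDiff.comp (phase p.1 p.2).contDiff).mul contDiff_const).cexp
    have h2 := iteratedFDeriv_const_smul_apply' (a := c p.1 p.2) (h1.contDiffAt (x := z))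
    simp only [smul_eq_mul] at h2
    rw [h2, norm_smul]
    calc ‖c p.1 p.2‖ * ‖iteratedFDeriv ℝ k (fun z => cexp ((phase p.1 p.2 z : ℝ) * I)) z‖
        ≤ ‖c p.1 p.2‖ * (k.factorial * 1 * (C * ((1 + ‖p.1‖) * (1 + ‖p.2‖))) ^ k) := by
          gcongr
          refine (norm_iteratedFDeriv_exp_linear_le _ k z).trans ?_
          gcongr
          exact hC _ _
      _ = _ := by
          rw [norm_mul, norm_mul, norm_pow, norm_pow]
          norm_cast
          rw [Real.norm_of_nonneg (by positivity), Real.norm_of_nonneg (by positivity),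
            mul_pow, mul_pow, mul_one]
          ring

end Fourier

end ParametricTrace
end

noncomputable section

namespace ParametricTrace

/-! ### Fourier expansion of smooth functions supported inside the unit cube -/

section FourierExpansion

open Complex Set

variable {ι : Type*}

theorem mFourier_coe [Fintype ι] (m : ι → ℤ) (x : ι → ℝ) :
    UnitAddTorus.mFourier m (fun i => (x i : UnitAddCircle)) = expo m (WithLp.toLp 2 x) := by
  simp only [UnitAddTorus.mFourier, ContinuousMap.coe_mk, fourier_coe_apply]
  rw [← Complex.exp_sum, expo]
  congr 1
  push_cast
  rw [Finset.mul_sum, Finset.sum_mul]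
  refine Finset.sum_congr rfl fun i _ => ?_
  simp
  ring

/-- The function on the torus which agrees with `F` on the unit cube. -/
def periodize (F : EuclideanSpace ℝ ι → ℂ) (y : UnitAddTorus ι) : ℂ :=
  F (WithLp.toLp 2 fun i => (AddCircle.equivIoc (1 : ℝ) 0 (y i) : ℝ))

theorem periodize_coe (F : EuclideanSpace ℝ ι → ℂ) (x : ι → ℝ) (hx : ∀ i, x i ∈ Ioc (0 : ℝ) 1) :
    periodize F (fun i => (x i : UnitAddCircle)) = F (WithLp.toLp 2 x) := by
  rw [periodize]
  congr 2
  ext i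
  rw [AddCircle.equivIoc_coe_eq (by simpa using hx i)]

/-- The representative in `(0, 1]` jumps only at the class of `0`. Near a point with such a
coordinate the function vanishes, because the support stays at distance `δ` from the faces of the
cube. -/
theorem continuous_periodize {F : EuclideanSpace ℝ ι → ℂ} (hF : Continuous F) {δ : ℝ} (hδ : 0 < δ)
    (hδF : ∀ x, F x ≠ 0 → ∀ i, x i ∈ Icc δ (1 - δ)) : Continuous (periodize F) := by
  rw [continuous_iff_continuousAt]
  intro y
  by_cases hy : ∀ i, y i ≠ 0
  · refine hF.continuousAt.comp ?_
    refine (PiLp.continuous_toLp 2 _).continuousAt.comp ?_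
    refine continuousAt_pi.2 fun i => ?_
    have h1 := AddCircle.continuousAt_equivIoc (1 : ℝ) 0 (x := y i) (hy i)
    exact continuous_subtype_val.continuousAt.comp
      (ContinuousAt.comp (f := fun y : UnitAddTorus ι => y i) h1 (continuous_apply i).continuousAt)
  · push Not at hy
    obtain ⟨i, hi⟩ := hy
    let S : Set UnitAddCircle := (fun t : ℝ => (t : UnitAddCircle)) '' Icc δ (1 - δ)
    have hS : IsClosed S :=
      (isCompact_Icc.image (AddCircle.continuous_mk' (1 : ℝ))).isClosed
    have h0 : y i ∉ S := by
      rintro ⟨t, ht, hti⟩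
      have h2 : t ∈ Ioc (0 : ℝ) (0 + 1) := ⟨by linarith [ht.1], by linarith [ht.2]⟩
      have h3 : (1 : ℝ) ∈ Ioc (0 : ℝ) (0 + 1) := ⟨by norm_num, by norm_num⟩
      have h4 : ((1 : ℝ) : UnitAddCircle) = (t : UnitAddCircle) := by
        rw [AddCircle.coe_period, ← hi]; exact hti.symm
      have h5 := (AddCircle.equivIoc_coe_eq (p := (1:ℝ)) h3).symm.trans
        ((congrArg _ h4).trans (AddCircle.equivIoc_coe_eq (p := (1:ℝ)) h2))
      have := congrArg Subtype.val h5
      simp only at this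
      linarith [ht.2]
    have h1 : (fun _ => (0 : ℂ)) =ᶠ[nhds y] periodize F := by
      filter_upwards [(continuous_apply i).continuousAt.preimage_mem_nhds
        (hS.isOpen_compl.mem_nhds h0)] with z hz
      by_contra h
      have h3 := hδF _ (Ne.symm h) i
      exact hz ⟨_, h3, AddCircle.coe_equivIoc⟩
    exact continuousAt_const.congr h1

theorem mFourierCoeff_periodize [Fintype ι] {F : EuclideanSpace ℝ ι → ℂ} {δ : ℝ} (hδ : 0 < δ)
    (hδF : ∀ x, F x ≠ 0 → ∀ i, x i ∈ Icc δ (1 - δ)) (m : ι → ℤ) :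
    UnitAddTorus.mFourierCoeff (periodize F) m =
      ∫ x : EuclideanSpace ℝ ι, expo (-m) x * F x := by
  rw [UnitAddTorus.mFourierCoeff_eq_integral _ _ 0]
  have hmeas : MeasurableSet {x : ι → ℝ | ∀ i, x i ∈ Ioc ((0 : ι → ℝ) i) ((0 : ι → ℝ) i + 1)} :=
    MeasurableSet.univ_pi' fun i => measurableSet_Ioc
  rw [← (PiLp.volume_preserving_toLp ι).integral_comp
    (MeasurableEquiv.toLp 2 (ι → ℝ)).measurableEmbedding]
  rw [← setIntegral_eq_integral_of_forall_compl_eq_zero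
    (s := {x : ι → ℝ | ∀ i, x i ∈ Ioc ((0 : ι → ℝ) i) ((0 : ι → ℝ) i + 1)})
    (f := fun x : ι → ℝ => expo (-m) (WithLp.toLp 2 x) * F (WithLp.toLp 2 x))]
  · refine setIntegral_congr_fun hmeas fun x hx => ?_
    simp only [mFourier_coe, smul_eq_mul]
    rw [periodize_coe F x (by simpa using hx)]
  · intro x hx
    by_contra h
    apply hx
    intro i
    have := hδF _ (right_ne_zero_of_mul h) i
    simp only at this
    simp only [Pi.zero_apply, zero_add]
    exact ⟨by linarith [this.1], by linarith [this.2]⟩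

theorem hasCompactSupport_of_cube {F : EuclideanSpace ℝ ι → ℂ} {δ : ℝ}
    (hδF : ∀ x, F x ≠ 0 → ∀ i, x i ∈ Icc δ (1 - δ)) : HasCompactSupport F := by
  refine HasCompactSupport.intro
    ((isCompact_univ_pi fun _ : ι => isCompact_Icc (a := δ) (b := 1 - δ)).image
      (PiLp.continuous_toLp 2 fun _ => ℝ)) fun x hx => ?_
  by_contra h
  exact hx ⟨x.ofLp, fun i _ => hδF x h i, rfl⟩

/-- These integrals are the values at integer points of the Fourier transform of a Schwartz
function. -/
theorem rapid_integral_expo [Fintype ι] {F : EuclideanSpace ℝ ι → ℂ} (hF : ContDiff ℝ ∞ F)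
    (hc : HasCompactSupport F) (N : ℕ) :
    ∃ C : ℝ, ∀ m : ι → ℤ, (1 + ‖m‖) ^ N * ‖∫ x : EuclideanSpace ℝ ι, expo (-m) x * F x‖ ≤ C := by
  let S := FourierTransform.fourier (hc.toSchwartzMap hF)
  have hS : ∀ m : ι → ℤ, S (WithLp.toLp 2 fun i => (m i : ℝ)) =
      ∫ x : EuclideanSpace ℝ ι, expo (-m) x * F x := fun m => by
    rw [SchwartzMap.fourier_coe, Real.fourier_eq']
    refine integral_congr_ae (Filter.Eventually.of_forall fun x => ?_)
    change _ • F x = _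
    rw [smul_eq_mul]
    change _ = cexp _ * F x
    congr 4
    simp [PiLp.inner_apply, Finset.sum_neg_distrib]
  refine ⟨2 ^ N * (Finset.Iic (N, 0)).sup (fun m => SchwartzMap.seminorm ℂ m.1 m.2) S,
    fun m => ?_⟩
  · have h1 := SchwartzMap.one_add_le_sup_seminorm_apply (𝕜 := ℂ) (m := (N, 0)) (k := N) (n := 0)
      le_rfl le_rfl S (WithLp.toLp 2 fun i => (m i : ℝ))
    rw [norm_iteratedFDeriv_zero, hS] at h1
    refine le_trans ?_ h1
    gcongr
    refine (pi_norm_le_iff_of_nonneg (norm_nonneg _)).2 fun i => ?_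
    refine le_trans (le_of_eq ?_) (PiLp.norm_apply_le _ i)
    simp [Int.norm_eq_abs]

/-- Smooth functions supported in the interior of the unit cube have rapidly decreasing Fourier
coefficients and are given by their Fourier series on the cube. -/
theorem exists_hasSum_expo [Fintype ι] {F : EuclideanSpace ℝ ι → ℂ} (hF : ContDiff ℝ ∞ F)
    {δ : ℝ} (hδ : 0 < δ)
    (hδF : ∀ x, F x ≠ 0 → ∀ i, x i ∈ Icc δ (1 - δ)) :
    ∃ c : (ι → ℤ) → ℂ, (∀ N : ℕ, ∃ C : ℝ, ∀ m, (1 + ‖m‖) ^ N * ‖c m‖ ≤ C) ∧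
      ∀ x : EuclideanSpace ℝ ι, (∀ i, x i ∈ Ioc (0 : ℝ) 1) →
        HasSum (fun m => c m * expo m x) (F x) := by
  let f : C(UnitAddTorus ι, ℂ) := ⟨periodize F, continuous_periodize hF.continuous hδ hδF⟩
  have hco : ∀ m, UnitAddTorus.mFourierCoeff f m = ∫ x : EuclideanSpace ℝ ι, expo (-m) x * F x :=
    mFourierCoeff_periodize hδ hδF
  have hrap := rapid_integral_expo hF (hasCompactSupport_of_cube hδF)
  have hsum : Summable (UnitAddTorus.mFourierCoeff f) := by
    obtain ⟨C, hC⟩ := hrap (Fintype.card ι + 1)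
    refine Summable.of_norm_bounded ((summable_one_add_norm_pow_card_inv ι).mul_left C) fun m => ?_
    rw [← div_eq_mul_inv, le_div_iff₀ (by positivity), mul_comm, hco]
    exact hC m
  refine ⟨UnitAddTorus.mFourierCoeff f, fun N => ?_, fun x hx => ?_⟩
  · simpa only [hco] using hrap N
  · have h := UnitAddTorus.hasSum_mFourier_series_apply_of_summable hsum
      (fun i => (x i : UnitAddCircle))
    have h2 : f (fun i => (x i : UnitAddCircle)) = F x := periodize_coe F x.ofLp hx
    rw [h2] at h
    refine h.congr_fun fun m => ?_
    rw [mFourier_coe, smul_eq_mul]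

variable {n : ℕ}

/-- Fourier expansion in two groups of variables. -/
theorem exists_fourierSum_eq
    {F : EuclideanSpace ℝ (Fin n) × EuclideanSpace ℝ (Fin n) → ℂ} (hF : ContDiff ℝ ∞ F)
    {δ : ℝ} (hδ : 0 < δ)
    (hδF : ∀ z, F z ≠ 0 → (∀ i, z.1 i ∈ Icc δ (1 - δ)) ∧ ∀ i, z.2 i ∈ Icc δ (1 - δ)) :
    ∃ c : (Fin n → ℤ) → (Fin n → ℤ) → ℂ, IsRapidMat c ∧
      ∀ z, (∀ i, z.1 i ∈ Ioc (0 : ℝ) 1) → (∀ i, z.2 i ∈ Ioc (0 : ℝ) 1) → fourierSum c z = F z := by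
  let p : EuclideanSpace ℝ (Fin n ⊕ Fin n) →
      EuclideanSpace ℝ (Fin n) × EuclideanSpace ℝ (Fin n) := fun w =>
    (WithLp.toLp 2 fun i => w (Sum.inl i), WithLp.toLp 2 fun i => w (Sum.inr i))
  have hp : ContDiff ℝ ∞ p := by
    refine ContDiff.prodMk ?_ ?_
    · exact contDiff_piLp' 2 fun i => contDiff_piLp_apply 2
    · exact contDiff_piLp' 2 fun i => contDiff_piLp_apply 2
  obtain ⟨C, hC, hs⟩ := exists_hasSum_expo (F := F ∘ p) (hF.comp hp) hδ fun w hw i => by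
    have := hδF _ hw
    rcases i with i | i
    · exact this.1 i
    · exact this.2 i
  -- The second block of frequencies changes sign, to match the factor `expo (-b)` in `fourierSum`.
  let e : (Fin n → ℤ) × (Fin n → ℤ) ≃ (Fin n ⊕ Fin n → ℤ) :=
    ((Equiv.refl _).prodCongr (Equiv.neg _)).trans (Equiv.sumArrowEquivProdArrow _ _ _).symm
  have he : ∀ a b, e (a, b) = Sum.elim a (-b) := fun a b => rfl
  have hen : ∀ a b, ‖a‖ ≤ ‖e (a, b)‖ ∧ ‖b‖ ≤ ‖e (a, b)‖ := fun a b => by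
    constructor
    · refine (pi_norm_le_iff_of_nonneg (norm_nonneg _)).2 fun i => ?_
      simpa [he] using norm_le_pi_norm (e (a, b)) (Sum.inl i)
    · refine (pi_norm_le_iff_of_nonneg (norm_nonneg _)).2 fun i => ?_
      simpa [he] using norm_le_pi_norm (e (a, b)) (Sum.inr i)
  refine ⟨fun a b => C (e (a, b)), fun N => ?_, fun z h1 h2 => ?_⟩
  · obtain ⟨K, hK⟩ := hC (N + N)
    refine ⟨K, fun a b => le_trans ?_ (hK (e (a, b)))⟩
    rw [pow_add]
    gcongr
    · exact (hen a b).1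
    · exact (hen a b).2
  · let w : EuclideanSpace ℝ (Fin n ⊕ Fin n) := WithLp.toLp 2 (Sum.elim z.1.ofLp z.2.ofLp)
    have hw := hs w (by
      rintro (i | i)
      · exact h1 i
      · exact h2 i)
    have hw2 := (e.hasSum_iff.2 hw)
    have hw3 : (F ∘ p) w = F z := rfl
    rw [hw3] at hw2
    rw [fourierSum, ← hw2.tsum_eq]
    congr 1
    ext ⟨a, b⟩
    simp only [Function.comp_apply]
    congr 1
    rw [expo, expo, expo, ← Complex.exp_add, ← add_mul, ← ofReal_add, ← mul_add, he]
    congr 4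
    simp [w]

end FourierExpansion

end ParametricTrace
end

noncomputable section

namespace ParametricTrace

/-! ### A test function dual to the exponentials -/

section FourierCutoff

open Complex Set
open scoped Convolution

/-- Orthonormality of the exponentials on the torus, read off from the coordinates of the basis
vector with frequency zero. -/
theorem mFourierCoeff_one {ι : Type*} [Fintype ι] [DecidableEq (ι → ℤ)] (m : ι → ℤ) :
    UnitAddTorus.mFourierCoeff (fun _ : UnitAddTorus ι => (1 : ℂ)) m = if m = 0 then 1 else 0 := by
  have h1 := UnitAddTorus.mFourierBasis_repr (d := ι)
    (UnitAddTorus.mFourierBasis (d := ι) 0) m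
  rw [HilbertBasis.repr_self, UnitAddTorus.coe_mFourierBasis, UnitAddTorus.mFourierCoeff_toLp,
    UnitAddTorus.mFourier_zero] at h1
  have h2 : ((1 : C(UnitAddTorus ι, ℂ)) : UnitAddTorus ι → ℂ) = fun _ => 1 := rfl
  rw [h2] at h1
  rw [← h1, lp.single_apply]
  simp [Pi.single_apply]

variable {n : ℕ}

/-- The half-open unit cube. -/
def unitCube (n : ℕ) : Set (EuclideanSpace ℝ (Fin n)) := {x | ∀ i, x i ∈ Ioc (0 : ℝ) 1}

theorem measurableSet_unitCube : MeasurableSet (unitCube n) := by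
  have : unitCube n = ⋂ i, (fun x : EuclideanSpace ℝ (Fin n) => x i) ⁻¹' Ioc (0 : ℝ) 1 := by
    ext x; simp [unitCube]
  rw [this]
  exact MeasurableSet.iInter fun i =>
    (PiLp.continuous_apply 2 _ i).measurable measurableSet_Ioc

theorem setIntegral_unitCube_expo (m : Fin n → ℤ) :
    ∫ x in unitCube n, expo m x = if m = 0 then 1 else 0 := by
  have h1 := UnitAddTorus.mFourierCoeff_eq_integral (fun _ : UnitAddTorus (Fin n) => (1 : ℂ)) (-m) 0
  rw [mFourierCoeff_one] at h1
  simp only [neg_eq_zero, neg_neg, mFourier_coe, smul_eq_mul, mul_one] at h1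
  rw [h1, ← (PiLp.volume_preserving_toLp (Fin n)).setIntegral_preimage_emb
    (MeasurableEquiv.toLp 2 (Fin n → ℝ)).measurableEmbedding]
  congr 2
  ext x
  simp [unitCube]

theorem volume_unitCube_lt_top : volume (unitCube n) < ⊤ := by
  refine (measure_mono ?_).trans_lt
    (((isCompact_univ_pi fun _ : Fin n => isCompact_Icc (a := (0 : ℝ)) (b := 1)).image
      (PiLp.continuous_toLp 2 fun _ => ℝ)).measure_lt_top (μ := volume))
  exact fun x hx => ⟨x.ofLp, fun i _ => ⟨(hx i).1.le, (hx i).2⟩, rfl⟩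

theorem contDiff_expo (m : Fin n → ℤ) : ContDiff ℝ ∞ (expo m) := by
  refine (ContDiff.mul (Complex.ofRealCLM.contDiff.comp (contDiff_const.mul
    (ContDiff.sum fun j _ => contDiff_const.mul (contDiff_piLp_apply 2)))) contDiff_const).cexp

/-- There is a test function whose Fourier transform restricted to `ℤ^n` is the delta function. -/
theorem exists_integral_expo_mul_eq_delta (n : ℕ) :
    ∃ g : EuclideanSpace ℝ (Fin n) → ℂ, ContDiff ℝ ∞ g ∧ HasCompactSupport g ∧
      ∀ m : Fin n → ℤ, ∫ x, expo m x * g x = if m = 0 then 1 else 0 := by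
  let b : ContDiffBump (0 : EuclideanSpace ℝ (Fin n)) := ⟨1, 2, by norm_num, by norm_num⟩
  let η : EuclideanSpace ℝ (Fin n) → ℂ := fun x => (b.normed volume x : ℝ)
  have hη : ContDiff ℝ ∞ η := Complex.ofRealCLM.contDiff.comp b.contDiff_normed
  have hηc : HasCompactSupport η := b.hasCompactSupport_normed.comp_left (g := ((↑) : ℝ → ℂ)) rfl
  let f : EuclideanSpace ℝ (Fin n) → ℂ := (unitCube n).indicator fun _ => 1
  have hf : Integrable f := (integrable_indicator_iff measurableSet_unitCube).2
    (integrableOn_const volume_unitCube_lt_top.ne)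
  -- The indicator of the unit cube has the required integrals but is not smooth. Smoothing it by a
  -- bump of integral one multiplies each integral by `∫ expo m * η`, which is `1` for `m = 0` and
  -- irrelevant for the others.
  let g := f ⋆[ContinuousLinearMap.mul ℝ ℂ, volume] η
  refine ⟨g, hηc.contDiff_convolution_right _ hf.locallyIntegrable hη, ?_, fun m => ?_⟩
  · refine HasCompactSupport.convolution _ ?_ hηc
    refine HasCompactSupport.intro
      ((isCompact_univ_pi fun _ : Fin n => isCompact_Icc (a := (0 : ℝ)) (b := 1)).image
        (PiLp.continuous_toLp 2 fun _ => ℝ)) fun x hx => ?_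
    refine indicator_of_notMem (fun h => hx ?_) _
    exact ⟨x.ofLp, fun i _ => ⟨(h i).1.le, (h i).2⟩, rfl⟩
  · let f' : EuclideanSpace ℝ (Fin n) → ℂ := fun x => expo m x * f x
    let η' : EuclideanSpace ℝ (Fin n) → ℂ := fun x => expo m x * η x
    have hf' : Integrable f' := hf.bdd_mul (c := 1)
      (contDiff_expo m).continuous.aestronglyMeasurable
      (Filter.Eventually.of_forall fun x => (norm_expo m x).le)
    have hη' : Integrable η' := ((contDiff_expo m).continuous.mul
      hη.continuous).integrable_of_hasCompactSupport hηc.mul_left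
    -- The character is multiplicative, so multiplication by it distributes over the convolution.
    have h1 : ∀ x, expo m x * g x = (f' ⋆[ContinuousLinearMap.mul ℝ ℂ, volume] η') x := fun x => by
      rw [convolution_def]
      change expo m x * (∫ t, f t * η (x - t)) = ∫ t, expo m t * f t * (expo m (x - t) * η (x - t))
      rw [← integral_const_mul]
      congr 1
      ext t
      have : expo m x = expo m t * expo m (x - t) := by
        rw [← expo_add_right, add_sub_cancel]
      rw [this]
      ring
    simp only [h1]
    rw [integral_convolution _ hf' hη']
    have h2 : ∫ x, f' x = if m = 0 then 1 else 0 := by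
      rw [← setIntegral_unitCube_expo, ← integral_indicator measurableSet_unitCube]
      congr 1
      ext x
      by_cases hx : x ∈ unitCube n <;> simp [f', f, hx]
    rw [h2, ContinuousLinearMap.mul_apply']
    split_ifs with hm
    · subst hm
      simp only [η', expo_zero, one_mul, η]
      rw [integral_complex_ofReal, b.integral_normed, ofReal_one]
    · rw [zero_mul]

end FourierCutoff

end ParametricTrace
end

noncomputable section

namespace ParametricTrace

/-! ### Integral operators with continuous kernels -/

section IntegralOperators

open InnerProductSpace

theorem HasKernel.unique {M : Type*} [MeasurableSpace M] {ν : Measure M}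
    {T T' : L2 ν →L[ℂ] L2 ν} {k : M → M → ℂ} (h : HasKernel T k)
    (h' : HasKernel T' k) : T = T' := by
  ext1 u
  exact Lp.ext ((h u).trans (h' u).symm)

variable {M : Type*} [TopologicalSpace M] [CompactSpace M] [MeasurableSpace M] [BorelSpace M]
  {ν : Measure M} [IsFiniteMeasure ν]

/-- A continuous function as an element of `L²`. -/
abbrev cToL2 (ν : Measure M) [IsFiniteMeasure ν] : C(M, ℂ) →L[ℂ] L2 ν :=
  ContinuousMap.toLp 2 ν ℂ

theorem inner_cToL2_star (v : C(M, ℂ)) (f : L2 ν) :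
    inner ℂ (cToL2 ν (star v)) f = ∫ y, v y * (f : M → ℂ) y ∂ν := by
  rw [L2.inner_def]
  refine integral_congr_ae ?_
  filter_upwards [ContinuousMap.coeFn_toLp (p := 2) (𝕜 := ℂ) ν (star v)] with y hy
  rw [hy, RCLike.inner_apply]
  simp [mul_comm]

theorem inner_cToL2_star_cToL2 (v w : C(M, ℂ)) :
    inner ℂ (cToL2 ν (star v)) (cToL2 ν w) = ∫ y, v y * w y ∂ν := by
  rw [inner_cToL2_star]
  refine integral_congr_ae ?_
  filter_upwards [ContinuousMap.coeFn_toLp (p := 2) (𝕜 := ℂ) ν w] with y hy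
  rw [hy]

theorem integrable_mul_L2 (v : C(M, ℂ)) (f : L2 ν) :
    Integrable (fun y => v y * (f : M → ℂ) y) ν :=
  ((Lp.memLp f).integrable (by norm_num)).bdd_mul v.continuous.measurable.aestronglyMeasurable
    (Filter.Eventually.of_forall fun y => v.norm_coe_le_norm y)

/-- A continuous kernel defines an integral operator on `L²`. -/
theorem exists_hasKernel {k : M → M → ℂ} (hk : Continuous fun z : M × M => k z.1 z.2) :
    ∃ T : L2 ν →L[ℂ] L2 ν, HasKernel T k := by
  -- As a continuous map into `C(M)`, the kernel makes `x ↦ ∫ k(x, y) f(y) dν(y)` a scalar product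
  -- with a vector of `L²` depending continuously on `x`.
  let κ : C(M, C(M, ℂ)) := ContinuousMap.curry ⟨fun z : M × M => k z.1 z.2, hk⟩
  have hcont : Continuous fun x => cToL2 ν (star (κ x)) :=
    (cToL2 ν).continuous.comp (continuous_star.comp κ.continuous)
  let L : L2 ν →ₗ[ℂ] C(M, ℂ) :=
    { toFun := fun f => ⟨fun x => inner ℂ (cToL2 ν (star (κ x))) f,
        hcont.inner continuous_const⟩
      map_add' := fun f g => by
        ext x
        exact inner_add_right (𝕜 := ℂ) (cToL2 ν (star (κ x))) f g
      map_smul' := fun r f => by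
        ext x
        exact inner_smul_right (𝕜 := ℂ) (cToL2 ν (star (κ x))) f r }
  let Lc : L2 ν →L[ℂ] C(M, ℂ) := L.mkContinuous (‖cToL2 ν‖ * ‖κ‖) fun f => by
    refine (ContinuousMap.norm_le _ (by positivity)).2 fun x => ?_
    refine (norm_inner_le_norm (𝕜 := ℂ) (cToL2 ν (star (κ x))) f).trans ?_
    gcongr
    refine ((cToL2 ν).le_opNorm _).trans ?_
    rw [norm_star]
    gcongr
    exact κ.norm_coe_le_norm x
  refine ⟨(cToL2 ν).comp Lc, fun f => ?_⟩
  filter_upwards [ContinuousMap.coeFn_toLp (p := 2) (𝕜 := ℂ) ν (Lc f)] with x hx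
  rw [ContinuousLinearMap.comp_apply, hx]
  exact inner_cToL2_star (κ x) f

variable {J : Type*} [Countable J]

/-- The series applied to `f` converges in the supremum norm. Its value at a point can therefore be
compared with the integral against the summed kernel, where sum and integral are exchanged by
dominated summability. -/
theorem hasKernel_nuc {u v : J → C(M, ℂ)} {K : ℝ} (hu : ∀ a, ‖u a‖ ≤ K) (hv : ∀ a, ‖v a‖ ≤ K)
    {c : J → J → ℂ} (hc : Summable fun p : J × J => ‖c p.1 p.2‖) :
    HasKernel (nuc (fun a => cToL2 ν (u a)) (fun b => cToL2 ν (star (v b))) c)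
      fun x y => ∑' p : J × J, c p.1 p.2 * (u p.1 x * v p.2 y) := by
  intro f
  have hK : ∀ w : J → C(M, ℂ), (∀ a, ‖w a‖ ≤ K) → ∀ a, ‖cToL2 ν (w a)‖ ≤ ‖cToL2 ν‖ * K :=
    fun w hw a => ((cToL2 ν).le_opNorm _).trans (by gcongr; exact hw a)
  have hu' := hK u hu
  have hv' := hK (fun b => star (v b)) (fun a => by rw [norm_star]; exact hv a)
  let s : J → ℂ := fun b => inner ℂ (cToL2 ν (star (v b))) f
  have hs : ∀ b, ‖s b‖ ≤ ‖cToL2 ν‖ * K * ‖f‖ := fun b =>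
    (norm_inner_le_norm _ _).trans (by gcongr; exact hv' b)
  have hF : Summable fun p : J × J => (c p.1 p.2 * s p.2) • u p.1 := by
    refine Summable.of_norm_bounded (hc.mul_right (‖cToL2 ν‖ * K * ‖f‖ * K)) fun p => ?_
    rw [norm_smul, norm_mul, mul_assoc]
    gcongr
    · exact (norm_nonneg _).trans (hs p.2)
    · exact hs _
    · exact hu _
  obtain ⟨F, hF⟩ := hF
  have h1 : nuc (fun a => cToL2 ν (u a)) (fun b => cToL2 ν (star (v b))) c f = cToL2 ν F := by
    have h2 := (hasSum_nuc hu' hv' hc).mapL (ContinuousLinearMap.apply ℂ (L2 ν) f)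
    refine h2.unique ((hF.mapL (cToL2 ν)).congr_fun fun p => ?_)
    simp only [ContinuousLinearMap.apply_apply, rankOne_apply, map_smul,
      smul_smul, s]
  rw [h1]
  filter_upwards [ContinuousMap.coeFn_toLp (p := 2) (𝕜 := ℂ) ν F] with x hx
  rw [hx]
  have h3 : HasSum (fun p : J × J => (c p.1 p.2 * s p.2) * u p.1 x) (F x) := by
    simpa using hF.mapL (ContinuousMap.evalCLM ℂ x)
  have hf1 : Integrable (f : M → ℂ) ν := (Lp.memLp f).integrable (by norm_num)
  have h4 := hasSum_integral_of_summable_integral_norm (μ := ν)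
    (F := fun (p : J × J) y => c p.1 p.2 * (u p.1 x * v p.2 y) * (f : M → ℂ) y) (fun p => ?_) ?_
  · refine h3.unique ?_
    have h5 : ∀ y, ∑' p : J × J, c p.1 p.2 * (u p.1 x * v p.2 y) * (f : M → ℂ) y =
        (∑' p : J × J, c p.1 p.2 * (u p.1 x * v p.2 y)) * (f : M → ℂ) y := fun y => tsum_mul_right
    simp only [h5] at h4
    refine h4.congr_fun fun p => ?_
    simp only [s]
    rw [inner_cToL2_star, mul_right_comm, ← integral_const_mul]
    congr 1
    ext y
    ring
  · have := (integrable_mul_L2 (v p.2) f).const_mul (c p.1 p.2 * u p.1 x)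
    refine this.congr (Filter.Eventually.of_forall fun y => ?_)
    simp only
    ring
  · refine Summable.of_nonneg_of_le (fun p => integral_nonneg fun y => norm_nonneg _) (fun p => ?_)
      (hc.mul_right (K * K * ∫ y, ‖(f : M → ℂ) y‖ ∂ν))
    rw [← mul_assoc, ← integral_const_mul]
    refine integral_mono_of_nonneg (Filter.Eventually.of_forall fun y => norm_nonneg _)
      (hf1.norm.const_mul _) (Filter.Eventually.of_forall fun y => ?_)
    simp only [norm_mul]
    have e1 := ((u p.1).norm_coe_le_norm x).trans (hu _)
    have e2 := ((v p.2).norm_coe_le_norm y).trans (hv _)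
    have e0 : 0 ≤ K := (norm_nonneg _).trans e1
    gcongr

end IntegralOperators

end ParametricTrace
end

noncomputable section

namespace ParametricTrace

/-! ### Smoothing operators -/

section Products

variable {E H N : Type*} [NormedAddCommGroup E] [NormedSpace ℝ E] [TopologicalSpace H]
  {I : ModelWithCorners ℝ E H} [TopologicalSpace N] [ChartedSpace H N] {f g : N → ℂ}

theorem contMDiffAt_mul_complex {x : N} (hf : ContMDiffAt I 𝓘(ℝ, ℂ) ∞ f x)
    (hg : ContMDiffAt I 𝓘(ℝ, ℂ) ∞ g x) : ContMDiffAt I 𝓘(ℝ, ℂ) ∞ (fun y => f y * g y) x :=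
  ContMDiffAt.comp (I' := 𝓘(ℝ, ℂ × ℂ)) (g := fun p : ℂ × ℂ => p.1 * p.2) x
    (contDiff_fst.mul contDiff_snd).contMDiff.contMDiffAt (hf.prodMk_space hg)

theorem contMDiff_mul_complex (hf : ContMDiff I 𝓘(ℝ, ℂ) ∞ f)
    (hg : ContMDiff I 𝓘(ℝ, ℂ) ∞ g) : ContMDiff I 𝓘(ℝ, ℂ) ∞ fun y => f y * g y :=
  fun x => contMDiffAt_mul_complex (hf x) (hg x)

/-- A function that is smooth on an open set and vanishes outside of a closed subset is smooth. -/
theorem contMDiff_of_closed_support {F : Type*} [NormedAddCommGroup F] [NormedSpace ℝ F]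
    {h : N → F} {U K : Set N} (hU : IsOpen U) (hK : IsClosed K)
    (hKU : K ⊆ U) (hh : ContMDiffOn I 𝓘(ℝ, F) ∞ h U) (h0 : ∀ x ∉ K, h x = 0) :
    ContMDiff I 𝓘(ℝ, F) ∞ h := by
  intro x
  by_cases hx : x ∈ K
  · exact hh.contMDiffAt (hU.mem_nhds (hKU hx))
  · have : h =ᶠ[nhds x] fun _ => 0 := by
      filter_upwards [hK.isOpen_compl.mem_nhds hx] with y hy using h0 y hy
    exact contMDiffAt_const.congr_of_eventuallyEq this

end Products

section SmoothingOperators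

variable (n : ℕ) {M : Type*} [TopologicalSpace M] [ChartedSpace (EuclideanSpace ℝ (Fin n)) M]

/-- Smooth functions on `M × M`. -/
def IsSmoothKernel (k : M → M → ℂ) : Prop :=
  ContMDiff ((𝓡 n).prod (𝓡 n)) 𝓘(ℝ, ℂ) ∞ fun z : M × M => k z.1 z.2

variable [CompactSpace M] [MeasurableSpace M] [BorelSpace M] (ν : Measure M) [IsFiniteMeasure ν]

/-- The integral operators with smooth kernel. -/
def smoothOps : Submodule ℂ (L2 ν →L[ℂ] L2 ν) where
  carrier := {T | ∃ k : M → M → ℂ, IsSmoothKernel n k ∧ HasKernel T k}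
  zero_mem' := ⟨fun _ _ => 0, contMDiff_const, fun u => by
    filter_upwards [Lp.coeFn_zero ℂ 2 ν] with x hx
    simpa using hx⟩
  add_mem' := by
    rintro S T ⟨k, hk, hS⟩ ⟨l, hl, hT⟩
    refine ⟨fun x y => k x y + l x y, hk.add hl, fun u => ?_⟩
    filter_upwards [hS u, hT u, Lp.coeFn_add (S u) (T u)] with x h1 h2 h3
    change ((S u + T u : L2 ν) : M → ℂ) x = _
    have hk' : Continuous (k x) := hk.continuous.comp (Continuous.prodMk_right x)
    have hl' : Continuous (l x) := hl.continuous.comp (Continuous.prodMk_right x)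
    have h4 := integral_add (integrable_mul_L2 ⟨k x, hk'⟩ u) (integrable_mul_L2 ⟨l x, hl'⟩ u)
    simp only [ContinuousMap.coe_mk, ← add_mul] at h4
    rw [h3, Pi.add_apply, h1, h2, h4]
  smul_mem' := by
    rintro a T ⟨k, hk, hT⟩
    refine ⟨fun x y => a * k x y, contMDiff_mul_complex contMDiff_const hk, fun u => ?_⟩
    filter_upwards [hT u, Lp.coeFn_smul a (T u)] with x h1 h3
    change ((a • T u : L2 ν) : M → ℂ) x = _
    rw [h3, Pi.smul_apply, h1, smul_eq_mul, ← integral_const_mul]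
    simp only [mul_assoc]

end SmoothingOperators

/-! ### Localized exponentials and the operators they span -/

section LocalMaps

variable (n : ℕ) (M : Type*) [TopologicalSpace M] [ChartedSpace (EuclideanSpace ℝ (Fin n)) M]

/-- A map to `ℝ^n` together with a cut-off function near whose support the map is smooth. -/
structure LocalMap where
  /-- the cut-off function -/
  cut : M → ℂ
  /-- the map -/
  map : M → EuclideanSpace ℝ (Fin n)
  contMDiff_cut : ContMDiff (𝓡 n) 𝓘(ℝ, ℂ) ∞ cut
  contMDiffAt_map : ∀ x ∈ tsupport cut, ContMDiffAt (𝓡 n) (𝓡 n) ∞ map x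

variable {n M}

namespace LocalMap

/-- The pull-back of a smooth function on `ℝ^n × ℝ^n`, cut off in both variables. -/
theorem contMDiff_pullback (D D' : LocalMap n M)
    {H : EuclideanSpace ℝ (Fin n) × EuclideanSpace ℝ (Fin n) → ℂ} (hH : ContDiff ℝ ∞ H) :
    IsSmoothKernel n fun x y => D.cut x * D'.cut y * H (D.map x, D'.map y) := by
  intro z
  have hcut : ContMDiff ((𝓡 n).prod (𝓡 n)) 𝓘(ℝ, ℂ) ∞ fun z : M × M => D.cut z.1 * D'.cut z.2 :=
    contMDiff_mul_complex (D.contMDiff_cut.comp contMDiff_fst)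
      (D'.contMDiff_cut.comp contMDiff_snd)
  by_cases h : z.1 ∈ tsupport D.cut ∧ z.2 ∈ tsupport D'.cut
  · have h1 := ContMDiffAt.comp (x := z) (I := (𝓡 n).prod (𝓡 n)) (f := Prod.fst)
      (D.contMDiffAt_map z.1 h.1) contMDiffAt_fst
    have h2 := ContMDiffAt.comp (x := z) (I := (𝓡 n).prod (𝓡 n)) (f := Prod.snd)
      (D'.contMDiffAt_map z.2 h.2) contMDiffAt_snd
    have h3 : ContMDiffAt ((𝓡 n).prod (𝓡 n))
        𝓘(ℝ, EuclideanSpace ℝ (Fin n) × EuclideanSpace ℝ (Fin n)) ∞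
        (fun z : M × M => (D.map z.1, D'.map z.2)) z := h1.prodMk_space h2
    exact contMDiffAt_mul_complex hcut.contMDiffAt
      (ContMDiffAt.comp z hH.contMDiff.contMDiffAt h3)
  · have h0 : (fun _ => (0 : ℂ)) =ᶠ[nhds z]
        fun z : M × M => D.cut z.1 * D'.cut z.2 * H (D.map z.1, D'.map z.2) := by
      rcases not_and_or.1 h with h | h
      · filter_upwards [continuous_fst.continuousAt.preimage_mem_nhds
          ((isClosed_tsupport _).isOpen_compl.mem_nhds h)] with w hw
        rw [image_eq_zero_of_notMem_tsupport hw]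
        simp
      · filter_upwards [continuous_snd.continuousAt.preimage_mem_nhds
          ((isClosed_tsupport _).isOpen_compl.mem_nhds h)] with w hw
        rw [image_eq_zero_of_notMem_tsupport hw]
        simp
    exact contMDiffAt_const.congr_of_eventuallyEq h0.symm

theorem continuous_fn (D : LocalMap n M) (a : Fin n → ℤ) :
    Continuous fun x => D.cut x * expo a (D.map x) := by
  rw [continuous_iff_continuousAt]
  intro x
  by_cases h : x ∈ tsupport D.cut
  · exact D.contMDiff_cut.continuous.continuousAt.mul
      ((contDiff_expo a).continuous.continuousAt.comp (D.contMDiffAt_map x h).continuousAt)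
  · have h0 : (fun _ => (0 : ℂ)) =ᶠ[nhds x] fun x => D.cut x * expo a (D.map x) := by
      filter_upwards [(isClosed_tsupport _).isOpen_compl.mem_nhds h] with w hw
      rw [image_eq_zero_of_notMem_tsupport hw, zero_mul]
    exact continuousAt_const.congr h0

/-- The localized exponential functions. -/
def fn (D : LocalMap n M) (a : Fin n → ℤ) : C(M, ℂ) :=
  ⟨fun x => D.cut x * expo a (D.map x), D.continuous_fn a⟩

variable [CompactSpace M]

/-- A bound for the cut-off function. -/
def bound (D : LocalMap n M) : ℝ := ‖(⟨D.cut, D.contMDiff_cut.continuous⟩ : C(M, ℂ))‖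

theorem norm_fn_le (D : LocalMap n M) (a : Fin n → ℤ) : ‖D.fn a‖ ≤ D.bound := by
  refine (ContinuousMap.norm_le _ (norm_nonneg _)).2 fun x => ?_
  change ‖D.cut x * expo a (D.map x)‖ ≤ _
  rw [norm_mul, norm_expo, mul_one]
  exact ContinuousMap.norm_coe_le_norm (⟨D.cut, D.contMDiff_cut.continuous⟩ : C(M, ℂ)) x

variable [MeasurableSpace M] [BorelSpace M] (ν : Measure M) [IsFiniteMeasure ν]

/-- The localized exponentials in `L²`. -/
def vec (D : LocalMap n M) (a : Fin n → ℤ) : L2 ν := cToL2 ν (D.fn a)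

/-- The conjugates of the localized exponentials with the opposite frequency in `L²`. -/
def covec (D : LocalMap n M) (b : Fin n → ℤ) : L2 ν := cToL2 ν (star (D.fn (-b)))

/-- A composition of two operators involves four systems of vectors, and the lemmas on `nuc` ask for
one common bound. -/
theorem exists_norm_le (D D' D₁ D₁' : LocalMap n M) : ∃ K : ℝ, (∀ a, ‖D.vec ν a‖ ≤ K) ∧
    (∀ a, ‖D'.covec ν a‖ ≤ K) ∧ (∀ a, ‖D₁.vec ν a‖ ≤ K) ∧ (∀ a, ‖D₁'.covec ν a‖ ≤ K) := by
  have h1 : ∀ (D : LocalMap n M) a, ‖D.vec ν a‖ ≤ ‖cToL2 ν‖ * D.bound := fun D a =>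
    ((cToL2 ν).le_opNorm _).trans (by gcongr; exact D.norm_fn_le a)
  have h2 : ∀ (D : LocalMap n M) a, ‖D.covec ν a‖ ≤ ‖cToL2 ν‖ * D.bound := fun D a =>
    ((cToL2 ν).le_opNorm _).trans (by rw [norm_star]; gcongr; exact D.norm_fn_le _)
  exact ⟨max (max (‖cToL2 ν‖ * D.bound) (‖cToL2 ν‖ * D'.bound))
    (max (‖cToL2 ν‖ * D₁.bound) (‖cToL2 ν‖ * D₁'.bound)),
    fun a => (h1 D a).trans (le_max_of_le_left (le_max_left _ _)),
    fun a => (h2 D' a).trans (le_max_of_le_left (le_max_right _ _)),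
    fun a => (h1 D₁ a).trans (le_max_of_le_right (le_max_left _ _)),
    fun a => (h2 D₁' a).trans (le_max_of_le_right (le_max_right _ _))⟩

/-- The operator with kernel `∑ c a b u a(x) v b(y)`, where `u`, `v` are localized exponentials. -/
def op (D D' : LocalMap n M) (c : (Fin n → ℤ) → (Fin n → ℤ) → ℂ) : L2 ν →L[ℂ] L2 ν :=
  nuc (D.vec ν) (D'.covec ν) c

theorem hasKernel_op (D D' : LocalMap n M) {c : (Fin n → ℤ) → (Fin n → ℤ) → ℂ}
    (hc : IsRapidMat c) : HasKernel (op ν D D' c)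
      fun x y => D.cut x * D'.cut y * fourierSum c (D.map x, D'.map y) := by
  have h := hasKernel_nuc (ν := ν) (u := D.fn) (v := fun b => D'.fn (-b))
    (K := max D.bound D'.bound)
    (fun a => (D.norm_fn_le a).trans (le_max_left _ _))
    (fun a => (D'.norm_fn_le _).trans (le_max_right _ _)) hc.summable_norm
  intro u
  refine (h u).trans (Filter.Eventually.of_forall fun x => ?_)
  simp only
  congr 1
  ext y
  congr 1
  rw [fourierSum, ← tsum_mul_left]
  congr 1
  ext p
  simp only [fn, ContinuousMap.coe_mk]
  ring

theorem op_mem (D D' : LocalMap n M) {c : (Fin n → ℤ) → (Fin n → ℤ) → ℂ}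
    (hc : IsRapidMat c) : op ν D D' c ∈ smoothOps n ν :=
  ⟨_, D.contMDiff_pullback D' hc.contDiff_fourierSum, hasKernel_op ν D D' hc⟩

theorem inner_covec_vec (D D' : LocalMap n M) (a b : Fin n → ℤ) :
    inner ℂ (D'.covec ν b) (D.vec ν a) = ∫ x, D'.fn (-b) x * D.fn a x ∂ν :=
  inner_cToL2_star_cToL2 _ _

end LocalMap

end LocalMaps

end ParametricTrace
end

noncomputable section

namespace ParametricTrace

/-! ### Tracial functionals on smoothing operators -/

section Tracial

variable {n : ℕ} {M : Type*} [TopologicalSpace M] [ChartedSpace (EuclideanSpace ℝ (Fin n)) M]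
  [CompactSpace M] [MeasurableSpace M] [BorelSpace M] {ν : Measure M} [IsFiniteMeasure ν]

/-- A functional on smoothing operators that vanishes on commutators. -/
def IsTracial (t : smoothOps n ν →ₗ[ℂ] ℂ) : Prop :=
  ∀ A B AB BA : smoothOps n ν, AB.1 = A.1.comp B.1 → BA.1 = B.1.comp A.1 → t AB = t BA

variable (ν) in
/-- The operators given by rapidly decreasing matrices. -/
def opLinear (D D' : LocalMap n M) : rapidMatrices n →ₗ[ℂ] smoothOps n ν where
  toFun c := ⟨D.op ν D' c.1, D.op_mem ν D' c.2⟩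
  map_add' c d := by
    obtain ⟨K, h1, h2, -, -⟩ := LocalMap.exists_norm_le ν D D' D D'
    exact Subtype.ext (nuc_add h1 h2 (IsRapidMat.summable_norm c.2) (IsRapidMat.summable_norm d.2))
  map_smul' r c := by
    obtain ⟨K, h1, h2, -, -⟩ := LocalMap.exists_norm_le ν D D' D D'
    exact Subtype.ext (nuc_smul h1 h2 (IsRapidMat.summable_norm c.2) r)

theorem op_comp_op (D D' D₁ D₁' : LocalMap n M) {c d : (Fin n → ℤ) → (Fin n → ℤ) → ℂ}
    (hc : IsRapidMat c) (hd : IsRapidMat d) :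
    (D.op ν D' c).comp (D₁.op ν D₁' d) = D.op ν D₁' fun a b =>
      ∑' q : (Fin n → ℤ) × (Fin n → ℤ),
        c a q.1 * inner ℂ (D'.covec ν q.1) (D₁.vec ν q.2) * d q.2 b := by
  obtain ⟨K, h1, h2, h3, h4⟩ := LocalMap.exists_norm_le ν D D' D₁ D₁'
  exact nuc_comp_nuc h1 h2 h3 h4 hc.summable_norm hd.summable_norm

/-- When the inner systems are biorthogonal, the middle Gram matrix in `op_comp_op` is the identity
and this reduces the double sum to a matrix product. -/
theorem tsum_prod_kronecker {J : Type*} [DecidableEq J] (f g : J → ℂ) :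
    ∑' q : J × J, f q.1 * (if q.2 = q.1 then 1 else 0) * g q.2 = ∑' a, f a * g a := by
  have hinj : Function.Injective fun a : J => (a, a) := fun a b h => (Prod.ext_iff.1 h).1
  rw [← hinj.tsum_eq]
  · simp
  · rintro ⟨a, b⟩ h
    by_cases hab : b = a
    · exact ⟨a, by simp [hab]⟩
    · exact absurd (by simp [hab]) h

theorem tsum_ite_mul {J : Type*} [DecidableEq J] (a : J) (l f : J → ℂ) :
    ∑' b, (if a = b then l a else 0) * f b = l a * f a := by
  rw [tsum_eq_single a fun b hb => by simp [hb.symm]]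
  simp

theorem tsum_mul_ite {J : Type*} [DecidableEq J] (a : J) (l f : J → ℂ) :
    ∑' b, f b * (if b = a then l b else 0) = f a * l a := by
  rw [tsum_eq_single a fun b hb => by simp [hb]]
  simp

/-- The matrix unit. -/
def unitMatrix (n : ℕ) : (Fin n → ℤ) → (Fin n → ℤ) → ℂ :=
  fun a b => if a = 0 then (if b = 0 then 1 else 0) else 0

theorem isRapidVec_single (l : ℂ) : IsRapidVec fun a : Fin n → ℤ => if a = 0 then l else 0 := by
  intro N
  refine ⟨‖l‖, fun a => ?_⟩
  rcases eq_or_ne a 0 with rfl | h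
  · simp
  · simp [h]

theorem isRapidMat_unitMatrix : IsRapidMat (unitMatrix n) := by
  have h := (isRapidVec_single (n := n) 1).mul (isRapidVec_single (n := n) 1)
  convert h using 3 with a b
  by_cases ha : a = 0 <;> simp [unitMatrix, ha]

variable {W W' : LocalMap n M}

/-- Biorthogonality makes `opLinear ν W W'` multiplicative, so `t` pulls back to a trace on rapidly
decreasing matrices and `map_eq_tsum_diag_mul` applies. The constant is the value on the matrix
unit. -/
theorem map_op_of_biorthogonal
    (hW : ∀ a b, inner ℂ (W'.covec ν b) (W.vec ν a) = if a = b then 1 else 0)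
    {t : smoothOps n ν →ₗ[ℂ] ℂ} (ht : IsTracial t) (d : rapidMatrices n) :
    t (opLinear ν W W' d) = t (opLinear ν W W' ⟨_, isRapidMat_unitMatrix⟩) * ∑' a, d.1 a a := by
  refine map_eq_tsum_diag_mul (t.comp (opLinear ν W W')) ?_ _ ?_ d
  · intro l c hl hc d d' hd hd'
    refine ht (opLinear ν W W' ⟨_, hl.diagonal⟩) (opLinear ν W W' ⟨c, hc⟩) _ _ ?_ ?_
    · change W.op ν W' d.1 = (W.op ν W' _).comp (W.op ν W' c)
      rw [op_comp_op _ _ _ _ hl.diagonal hc]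
      congr 1
      ext a b
      simp only [hW]
      rw [tsum_prod_kronecker (fun q => if a = q then l a else 0) fun q => c q b,
        tsum_ite_mul, hd]
    · change W.op ν W' d'.1 = (W.op ν W' c).comp (W.op ν W' _)
      rw [op_comp_op _ _ _ _ hc hl.diagonal]
      congr 1
      ext a b
      simp only [hW]
      rw [tsum_prod_kronecker (fun q => c a q) fun q => if q = b then l q else 0, tsum_mul_ite, hd']
  · intro u v hu hv d hd
    have r1 : IsRapidMat fun a b : Fin n → ℤ => u a * (if b = 0 then 1 else 0) :=
      hu.mul (isRapidVec_single 1)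
    have r2 : IsRapidMat fun a b : Fin n → ℤ => (if a = 0 then 1 else 0) * v b :=
      (isRapidVec_single 1).mul hv
    -- A column `u ⊗ e₀` times a row `e₀ ⊗ v` is `u ⊗ v`; in the opposite order the product is `∑
    -- u_a v_a` times the matrix unit.
    have h := ht (opLinear ν W W' ⟨_, r1⟩) (opLinear ν W W' ⟨_, r2⟩) (opLinear ν W W' d)
      (opLinear ν W W' ((∑' a, u a * v a) • ⟨_, isRapidMat_unitMatrix⟩)) ?_ ?_
    · rw [map_smul, map_smul, smul_eq_mul, mul_comm] at h
      exact h
    · change W.op ν W' d.1 = (W.op ν W' _).comp (W.op ν W' _)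
      rw [op_comp_op _ _ _ _ r1 r2]
      congr 1
      ext a b
      simp only [hW]
      rw [tsum_prod_kronecker (fun q => u a * (if q = 0 then 1 else 0))
        fun q => (if q = 0 then 1 else 0) * v b, tsum_eq_single 0 fun q hq => by simp [hq]]
      simp [hd]
    · change W.op ν W' _ = (W.op ν W' _).comp (W.op ν W' _)
      rw [op_comp_op _ _ _ _ r2 r1]
      congr 1
      ext a b
      simp only [hW]
      rw [tsum_prod_kronecker (fun q => (if a = 0 then 1 else 0) * v q)
        fun q => u q * (if b = 0 then 1 else 0)]
      change (∑' a, u a * v a) * unitMatrix n a b = _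
      rw [← tsum_mul_right]
      congr 1
      ext q
      by_cases ha : a = 0 <;> by_cases hb : b = 0 <;> simp [unitMatrix, ha, hb, mul_comm]

/-- A Gram matrix between two different systems is only bounded. Decay in the row index comes from
`c`, decay in the column index from `l`, and the spare decay of `c` makes the inner sum converge. -/
theorem IsRapidMat.sum_mul_bounded_mul {c : (Fin n → ℤ) → (Fin n → ℤ) → ℂ} (hc : IsRapidMat c)
    {G : (Fin n → ℤ) → (Fin n → ℤ) → ℂ} {K : ℝ} (hG : ∀ a b, ‖G a b‖ ≤ K)
    {l : (Fin n → ℤ) → ℂ} (hl : IsRapidVec l) :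
    IsRapidMat fun a b => (∑' e, c a e * G e b) * l b := by
  intro N
  obtain ⟨C, hC⟩ := hc (N + (n + 1))
  obtain ⟨L, hL⟩ := hl N
  have hs := summable_one_add_norm_pow_inv n
  have hK : 0 ≤ K := (norm_nonneg _).trans (hG 0 0)
  refine ⟨(C * K * ∑' e : Fin n → ℤ, ((1 + ‖e‖) ^ (n + 1))⁻¹) * L, fun a b => ?_⟩
  have h1 : ∀ e, ‖c a e * G e b‖ ≤ ((1 + ‖a‖) ^ N)⁻¹ * (C * K) * ((1 + ‖e‖) ^ (n + 1))⁻¹ := by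
    intro e
    have h2 : (1 + ‖a‖) ^ N * (1 + ‖e‖) ^ (n + 1) * ‖c a e‖ ≤ C := by
      refine le_trans ?_ (hC a e)
      have h3 : (1 + ‖a‖) ^ N ≤ (1 + ‖a‖) ^ (N + (n + 1)) :=
        pow_le_pow_right₀ (by linarith [norm_nonneg a]) (by omega)
      have h4 : (1 + ‖e‖) ^ (n + 1) ≤ (1 + ‖e‖) ^ (N + (n + 1)) :=
        pow_le_pow_right₀ (by linarith [norm_nonneg e]) (by omega)
      gcongr
    calc ‖c a e * G e b‖ ≤ ‖c a e‖ * K := by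
          rw [norm_mul]; gcongr; exact hG e b
      _ = ((1 + ‖a‖) ^ N)⁻¹ * ((1 + ‖a‖) ^ N * (1 + ‖e‖) ^ (n + 1) * ‖c a e‖ * K) *
          ((1 + ‖e‖) ^ (n + 1))⁻¹ := by
          field_simp
      _ ≤ _ := by gcongr
  have h3 : ‖∑' e, c a e * G e b‖ ≤
      ((1 + ‖a‖) ^ N)⁻¹ * (C * K) * ∑' e : Fin n → ℤ, ((1 + ‖e‖) ^ (n + 1))⁻¹ := by
    rw [← tsum_mul_left]
    exact tsum_of_norm_bounded (hs.mul_left _).hasSum h1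
  calc (1 + ‖a‖) ^ N * (1 + ‖b‖) ^ N * ‖(∑' e, c a e * G e b) * l b‖
      = ((1 + ‖a‖) ^ N * ‖∑' e, c a e * G e b‖) * ((1 + ‖b‖) ^ N * ‖l b‖) := by
        rw [norm_mul]; ring
    _ ≤ ((1 + ‖a‖) ^ N * (((1 + ‖a‖) ^ N)⁻¹ * (C * K) *
          ∑' e : Fin n → ℤ, ((1 + ‖e‖) ^ (n + 1))⁻¹)) * L := by
        gcongr
        · refine mul_nonneg (by positivity) ((norm_nonneg _).trans h3)
        · exact hL b
    _ = _ := by field_simp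

/-- A tracial functional is determined on localized smoothing operators. -/
theorem map_op_eq
    (hW : ∀ a b, inner ℂ (W'.covec ν b) (W.vec ν a) = if a = b then 1 else 0)
    {t : smoothOps n ν →ₗ[ℂ] ℂ} (ht : IsTracial t) (D D' : LocalMap n M) (c : rapidMatrices n) :
    t (opLinear ν D D' c) = t (opLinear ν W W' ⟨_, isRapidMat_unitMatrix⟩) *
      ∑' p : (Fin n → ℤ) × (Fin n → ℤ), c.1 p.1 p.2 * inner ℂ (D'.covec ν p.2) (D.vec ν p.1) := by
  obtain ⟨l, e, hl, he, hle⟩ := IsRapidMat.exists_diag_mul c.2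
  obtain ⟨K, h1, h2, -, -⟩ := LocalMap.exists_norm_le ν D D' D D'
  have hG : ∀ a b, ‖inner ℂ (D'.covec ν a) (D.vec ν b)‖ ≤ K * K := fun a b =>
    (norm_inner_le_norm _ _).trans (mul_le_mul (h2 a) (h1 b) (norm_nonneg _)
      ((norm_nonneg _).trans (h1 a)))
  have hd := he.sum_mul_bounded_mul hG hl
  -- With `c = l e`, the operator factors through the biorthogonal pair as `(D, W', diag l)` times
  -- `(W, D', e)`. The opposite product lives on `(W, W')` with matrix `e G l`, where `G` is the
  -- Gram matrix of `D'` and `D`, so its diagonal sum is the asserted series.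
  have h := ht (opLinear ν D W' ⟨_, hl.diagonal⟩) (opLinear ν W D' ⟨e, he⟩) (opLinear ν D D' c)
    (opLinear ν W W' ⟨_, hd⟩) ?_ ?_
  · rw [h, map_op_of_biorthogonal hW ht]
    congr 1
    have hs : Summable fun p : (Fin n → ℤ) × (Fin n → ℤ) =>
        c.1 p.1 p.2 * inner ℂ (D'.covec ν p.2) (D.vec ν p.1) := by
      refine Summable.of_norm_bounded ((IsRapidMat.summable_norm c.2).mul_right (K * K))
        fun p => ?_
      rw [norm_mul]
      gcongr
      exact hG _ _
    rw [hs.tsum_prod]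
    congr 1
    ext a
    simp only [hle]
    rw [← tsum_mul_right]
    congr 1
    ext b
    ring
  · change D.op ν D' c.1 = (D.op ν W' _).comp (W.op ν D' e)
    rw [op_comp_op _ _ _ _ hl.diagonal he]
    congr 1
    ext a b
    simp only [hW]
    rw [tsum_prod_kronecker (fun q => if a = q then l a else 0) fun q => e q b,
      tsum_ite_mul, hle]
  · change W.op ν W' _ = (W.op ν D' e).comp (D.op ν W' _)
    rw [op_comp_op _ _ _ _ he hl.diagonal]
    congr 1
    ext a b
    have hs : Summable fun q : (Fin n → ℤ) × (Fin n → ℤ) =>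
        e a q.1 * inner ℂ (D'.covec ν q.1) (D.vec ν q.2) * (if q.2 = b then l q.2 else 0) := by
      have s1 : Summable fun i => ‖e a i‖ :=
        he.summable_norm.comp_injective (i := fun i => (a, i)) fun i j h => (Prod.ext_iff.1 h).2
      have s2 : Summable fun i : Fin n → ℤ => ‖if i = b then l i else 0‖ :=
        hl.diagonal.summable_norm.comp_injective (i := fun i => (i, b))
          fun i j h => (Prod.ext_iff.1 h).1
      refine Summable.of_norm_bounded
        ((s1.mul_of_nonneg s2 (fun _ => norm_nonneg _) fun _ => norm_nonneg _).mul_left (K * K))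
        fun q => ?_
      rw [norm_mul, norm_mul, mul_comm ‖e a q.1‖, mul_assoc]
      gcongr
      exact hG _ _
    rw [hs.tsum_prod]
    change (∑' q, e a q * inner ℂ (D'.covec ν q) (D.vec ν b)) * l b = _
    rw [← tsum_mul_right]
    congr 1
    ext q
    rw [tsum_mul_ite b l fun r => e a q * inner ℂ (D'.covec ν q) (D.vec ν r)]

theorem hasTrace_op (D D' : LocalMap n M) {c : (Fin n → ℤ) → (Fin n → ℤ) → ℂ}
    (hc : IsRapidMat c) : HasTrace (D.op ν D' c)
      (∑' p : (Fin n → ℤ) × (Fin n → ℤ), c p.1 p.2 * inner ℂ (D'.covec ν p.2) (D.vec ν p.1)) := by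
  obtain ⟨K, h1, h2, -, -⟩ := LocalMap.exists_norm_le ν D D' D D'
  exact hasTrace_nuc h1 h2 hc.summable_norm

end Tracial

end ParametricTrace
end

noncomputable section

namespace ParametricTrace

/-! ### Localization of smoothing operators -/

section Charts

variable {n : ℕ} {M : Type*} [TopologicalSpace M] [ChartedSpace (EuclideanSpace ℝ (Fin n)) M]

/-- A partial homeomorphism to `ℝ^n` which is a diffeomorphism. -/
structure IsSmoothChart (Φ : OpenPartialHomeomorph M (EuclideanSpace ℝ (Fin n))) : Prop where
  contMDiffOn : ContMDiffOn (𝓡 n) (𝓡 n) ∞ Φ Φ.source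
  contMDiffOn_symm : ContMDiffOn (𝓡 n) (𝓡 n) ∞ Φ.symm Φ.target

/-- The affine map `a ↦ r (a - a₀) + w`. -/
def affineHomeo {r : ℝ} (hr : r ≠ 0) (a₀ w : EuclideanSpace ℝ (Fin n)) :
    EuclideanSpace ℝ (Fin n) ≃ₜ EuclideanSpace ℝ (Fin n) :=
  (Homeomorph.addRight (-a₀)).trans ((Homeomorph.smulOfNeZero r hr).trans (Homeomorph.addRight w))

theorem affineHomeo_apply {r : ℝ} (hr : r ≠ 0) (a₀ w a : EuclideanSpace ℝ (Fin n)) :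
    affineHomeo hr a₀ w a = r • (a - a₀) + w := by
  simp [affineHomeo, sub_eq_add_neg]

theorem affineHomeo_symm_apply {r : ℝ} (hr : r ≠ 0) (a₀ w a : EuclideanSpace ℝ (Fin n)) :
    (affineHomeo hr a₀ w).symm a = r⁻¹ • (a - w) + a₀ := by
  rw [Homeomorph.symm_apply_eq, affineHomeo_apply]
  simp [smul_smul, hr]

variable [IsManifold (𝓡 n) ∞ M]

theorem isSmoothChart_affine {φ : OpenPartialHomeomorph M (EuclideanSpace ℝ (Fin n))}
    (hφ : φ ∈ atlas (EuclideanSpace ℝ (Fin n)) M) {r : ℝ} (hr : r ≠ 0)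
    (a₀ w : EuclideanSpace ℝ (Fin n)) :
    IsSmoothChart (φ.transHomeomorph (affineHomeo hr a₀ w)) := by
  have hmax := IsManifold.subset_maximalAtlas (I := 𝓡 n) (n := ∞) hφ
  have h1 := contMDiffOn_of_mem_maximalAtlas hmax
  have h2 := contMDiffOn_symm_of_mem_maximalAtlas hmax
  constructor
  · have h3 : ContDiff ℝ ∞ (affineHomeo hr a₀ w) := by
      have : (affineHomeo hr a₀ w : _ → _) = fun a => r • (a - a₀) + w := by
        ext1 a
        exact affineHomeo_apply hr a₀ w a
      rw [this]
      fun_prop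
    exact h3.contMDiff.comp_contMDiffOn h1
  · have h3 : ContDiff ℝ ∞ (affineHomeo hr a₀ w).symm := by
      have : ((affineHomeo hr a₀ w).symm : _ → _) = fun a => r⁻¹ • (a - w) + a₀ := by
        ext1 a
        exact affineHomeo_symm_apply hr a₀ w a
      rw [this]
      fun_prop
    exact h2.comp h3.contMDiff.contMDiffOn fun a ha => ha

/-- The points of a chart domain with coordinates in a cube. -/
def cubeDomain (Φ : OpenPartialHomeomorph M (EuclideanSpace ℝ (Fin n))) : Set M :=
  Φ.source ∩ Φ ⁻¹' {a | ∀ i, a i ∈ Set.Ioo (1 / 4 : ℝ) (3 / 4)}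

omit [ChartedSpace (EuclideanSpace ℝ (Fin n)) M] [IsManifold (𝓡 n) ∞ M] in
theorem isOpen_cubeDomain (Φ : OpenPartialHomeomorph M (EuclideanSpace ℝ (Fin n))) :
    IsOpen (cubeDomain Φ) := by
  refine Φ.isOpen_inter_preimage ?_
  simp only [Set.ofPred_forall]
  exact isOpen_iInter_of_finite fun i => isOpen_Ioo.preimage (PiLp.continuous_apply 2 _ i)

theorem exists_chart_mem_cubeDomain (x : M) :
    ∃ Φ : OpenPartialHomeomorph M (EuclideanSpace ℝ (Fin n)), IsSmoothChart Φ ∧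
      x ∈ cubeDomain Φ := by
  let φ := chartAt (EuclideanSpace ℝ (Fin n)) x
  -- A translation puts `x` at the centre of the unit cube.
  refine ⟨_, isSmoothChart_affine (chart_mem_atlas _ x) one_ne_zero (φ x)
    (WithLp.toLp 2 fun _ => 1 / 2), mem_chart_source _ x, ?_⟩
  intro i
  rw [OpenPartialHomeomorph.transHomeomorph_apply, Function.comp_apply, affineHomeo_apply]
  simp [φ]
  norm_num

variable [CompactSpace M] [T2Space M]

/-- A cut-off function around a closed subset of a chart domain. -/
theorem exists_localMap {Φ : OpenPartialHomeomorph M (EuclideanSpace ℝ (Fin n))}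
    (hΦ : IsSmoothChart Φ) {U K : Set M} (hU : IsOpen U) (hUΦ : U ⊆ Φ.source) (hK : IsClosed K)
    (hKU : K ⊆ U) : ∃ D : LocalMap n M, D.map = Φ ∧ tsupport D.cut ⊆ U ∧ ∀ x ∈ K, D.cut x = 1 := by
  have : SigmaCompactSpace M := inferInstance
  obtain ⟨f, hf0, hf1, -⟩ := exists_contMDiffMap_zero_one_nhds_of_isClosed (n := ⊤) (𝓡 n)
    hU.isClosed_compl hK (Set.disjoint_left.2 fun x hx hxK => hx (hKU hxK))
  have hsupp : tsupport (fun x => (f x : ℂ)) ⊆ U := by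
    intro x hx
    by_contra hxU
    rw [eventually_nhdsSet_iff_forall] at hf0
    refine notMem_tsupport_iff_eventuallyEq.2 ?_ hx
    filter_upwards [hf0 x hxU] with y hy
    simp [hy]
  exact ⟨⟨fun x => (f x : ℂ), Φ, Complex.ofRealCLM.contDiff.contMDiff.comp f.contMDiff,
    fun x hx => hΦ.contMDiffOn.contMDiffAt (Φ.open_source.mem_nhds (hUΦ (hsupp hx)))⟩, rfl,
    hsupp, fun x hx => by
      have := (eventually_nhdsSet_iff_forall.1 hf1 x hx).self_of_nhds
      simp [this]⟩

omit [IsManifold (𝓡 n) ∞ M] [T2Space M] in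
/-- A localized smooth kernel in local coordinates. -/
theorem exists_contDiff_localized {Φ Φ' : OpenPartialHomeomorph M (EuclideanSpace ℝ (Fin n))}
    (hΦ : IsSmoothChart Φ) (hΦ' : IsSmoothChart Φ') {χ χ' : M → ℂ}
    (hχ : ContMDiff (𝓡 n) 𝓘(ℝ, ℂ) ∞ χ) (hχ' : ContMDiff (𝓡 n) 𝓘(ℝ, ℂ) ∞ χ')
    (hs : tsupport χ ⊆ cubeDomain Φ) (hs' : tsupport χ' ⊆ cubeDomain Φ')
    {k : M → M → ℂ} (hk : IsSmoothKernel n k) :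
    ∃ F : EuclideanSpace ℝ (Fin n) × EuclideanSpace ℝ (Fin n) → ℂ, ContDiff ℝ ∞ F ∧
      (∀ z, F z ≠ 0 → (∀ i, z.1 i ∈ Set.Icc (1 / 4 : ℝ) (1 - 1 / 4)) ∧
        ∀ i, z.2 i ∈ Set.Icc (1 / 4 : ℝ) (1 - 1 / 4)) ∧
      ∀ x ∈ Φ.source, ∀ y ∈ Φ'.source, F (Φ x, Φ' y) = χ x * χ' y * k x y := by
  classical
  let F₀ : EuclideanSpace ℝ (Fin n) × EuclideanSpace ℝ (Fin n) → ℂ := fun z =>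
    χ (Φ.symm z.1) * χ' (Φ'.symm z.2) * k (Φ.symm z.1) (Φ'.symm z.2)
  let F : EuclideanSpace ℝ (Fin n) × EuclideanSpace ℝ (Fin n) → ℂ :=
    (Φ.target ×ˢ Φ'.target).indicator F₀
  have hopen : IsOpen (Φ.target ×ˢ Φ'.target) := Φ.open_target.prod Φ'.open_target
  let S := (Φ '' tsupport χ) ×ˢ (Φ' '' tsupport χ')
  -- The supports are compact subsets of the chart domains, so their images are closed in all of
  -- `ℝ^n` and the extension by zero is smooth.
  have hS : IsClosed S := by
    refine IsCompact.isClosed (IsCompact.prod ?_ ?_)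
    · exact (isClosed_tsupport χ).isCompact.image_of_continuousOn
        (Φ.continuousOn.mono fun x hx => (hs hx).1)
    · exact (isClosed_tsupport χ').isCompact.image_of_continuousOn
        (Φ'.continuousOn.mono fun x hx => (hs' hx).1)
  have hF0 : ∀ z ∉ S, F z = 0 := by
    intro z hz
    by_cases hzt : z ∈ Φ.target ×ˢ Φ'.target
    · change (Φ.target ×ˢ Φ'.target).indicator F₀ z = 0
      rw [Set.indicator_of_mem hzt]
      rcases not_and_or.1 hz with h | h
      · have : χ (Φ.symm z.1) = 0 := image_eq_zero_of_notMem_tsupport fun h' =>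
          h ⟨_, h', Φ.right_inv hzt.1⟩
        simp [F₀, this]
      · have : χ' (Φ'.symm z.2) = 0 := image_eq_zero_of_notMem_tsupport fun h' =>
          h ⟨_, h', Φ'.right_inv hzt.2⟩
        simp [F₀, this]
    · exact Set.indicator_of_notMem hzt _
  have hF₀ : ContMDiffOn ((𝓡 n).prod (𝓡 n)) 𝓘(ℝ, ℂ) ∞ F₀ (Φ.target ×ˢ Φ'.target) := by
    have hg : IsSmoothKernel n fun x y => χ x * χ' y * k x y :=
      contMDiff_mul_complex (contMDiff_mul_complex (hχ.comp contMDiff_fst)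
        (hχ'.comp contMDiff_snd)) hk
    exact ContMDiff.comp_contMDiffOn (I' := (𝓡 n).prod (𝓡 n)) hg
      (hΦ.contMDiffOn_symm.prodMap hΦ'.contMDiffOn_symm)
  refine ⟨F, ?_, fun z hz => ?_, fun x hx y hy => ?_⟩
  · rw [← contMDiff_iff_contDiff]
    refine contMDiff_of_closed_support hopen hS ?_ ?_ hF0
    · rintro z ⟨⟨x, hx, hx'⟩, ⟨y, hy, hy'⟩⟩
      exact ⟨hx' ▸ Φ.map_source (hs hx).1, hy' ▸ Φ'.map_source (hs' hy).1⟩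
    · rw [modelWithCornersSelf_prod, ← chartedSpaceSelf_prod]
      exact hF₀.congr fun z hz => Set.indicator_of_mem hz _
  · by_contra hcon
    apply hz
    apply hF0
    rintro ⟨⟨x, hx, hx'⟩, ⟨y, hy, hy'⟩⟩
    apply hcon
    rw [← hx', ← hy']
    have h1 := (hs hx).2
    have h2 := (hs' hy).2
    exact ⟨fun i => ⟨(h1 i).1.le, by linarith [(h1 i).2]⟩,
      fun i => ⟨(h2 i).1.le, by linarith [(h2 i).2]⟩⟩
  · have : (Φ x, Φ' y) ∈ Φ.target ×ˢ Φ'.target := ⟨Φ.map_source hx, Φ'.map_source hy⟩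
    change (Φ.target ×ˢ Φ'.target).indicator F₀ _ = _
    rw [Set.indicator_of_mem this]
    simp only [F₀, Φ.left_inv hx, Φ'.left_inv hy]

variable [MeasurableSpace M] [BorelSpace M] (ν : Measure M) [IsFiniteMeasure ν]

omit [ChartedSpace (EuclideanSpace ℝ (Fin n)) M] [IsManifold (𝓡 n) ∞ M] [T2Space M] in
theorem hasKernel_sum {ι : Type*} (s : Finset ι) {T : ι → L2 ν →L[ℂ] L2 ν} {k : ι → M → M → ℂ}
    (hk : ∀ i x, Continuous (k i x)) (hT : ∀ i, HasKernel (T i) (k i)) :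
    HasKernel (∑ i ∈ s, T i) fun x y => ∑ i ∈ s, k i x y := by
  intro u
  have h1 : ∀ᵐ x ∂ν, ∀ i ∈ s, (T i u : M → ℂ) x = ∫ y, k i x y * (u : M → ℂ) y ∂ν := by
    rw [Filter.eventually_all_finset]
    exact fun i _ => hT i u
  have h2 : ((∑ i ∈ s, T i) u : M → ℂ) =ᵐ[ν] ∑ i ∈ s, (T i u : M → ℂ) := by
    rw [_root_.sum_apply]
    exact Lp.coeFn_finsetSum _ _
  filter_upwards [h1, h2] with x hx1 hx2
  have h4 := integral_finsetSum s fun i _ => integrable_mul_L2 (ν := ν) ⟨k i x, hk i x⟩ u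
  simp only [ContinuousMap.coe_mk] at h4
  rw [hx2, Finset.sum_apply, Finset.sum_congr rfl hx1]
  simp only [Finset.sum_mul]
  exact h4.symm

/-- Every smoothing operator is a finite sum of localized ones. -/
theorem exists_decomposition : ∃ (ι : Finset M) (D : ι → LocalMap n M),
    ∀ T : smoothOps n ν, ∃ c : ι → ι → rapidMatrices n,
      T = ∑ p : ι × ι, opLinear ν (D p.1) (D p.2) (c p.1 p.2) := by
  choose Φ hΦ hmem using exists_chart_mem_cubeDomain (n := n) (M := M)
  obtain ⟨ι, hι⟩ := isCompact_univ.elim_finite_subcover (fun x => cubeDomain (Φ x))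
    (fun x => isOpen_cubeDomain (Φ x)) fun x _ => Set.mem_iUnion.2 ⟨x, hmem x⟩
  obtain ⟨χ, hχ⟩ := SmoothPartitionOfUnity.exists_isSubordinate (𝓡 n) (isClosed_univ (X := M))
    (fun i : ι => cubeDomain (Φ i)) (fun i => isOpen_cubeDomain _) (fun x hx => by
      obtain ⟨i, hi, hxi⟩ := Set.mem_iUnion₂.1 (hι hx)
      exact Set.mem_iUnion.2 ⟨⟨i, hi⟩, hxi⟩)
  let f : ι → M → ℂ := fun i x => (χ i x : ℂ)
  have hf : ∀ i, ContMDiff (𝓡 n) 𝓘(ℝ, ℂ) ∞ (f i) := fun i =>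
    Complex.ofRealCLM.contDiff.contMDiff.comp (χ i).contMDiff
  have hfs : ∀ i, tsupport (f i) ⊆ cubeDomain (Φ i) := fun i =>
    (closure_mono fun x hx => by simpa [f] using hx).trans (hχ i)
  have hf1 : ∀ x, ∑ i, f i x = 1 := fun x => by
    have := χ.sum_eq_one (Set.mem_univ x)
    rw [finsum_eq_sum_of_fintype] at this
    simp only [f]
    exact_mod_cast this
  -- The Fourier sum equals the localized kernel only on the cube and is periodic outside. These
  -- second cut-offs equal one on the supports of the partition functions and are supported where
  -- the coordinates lie in the cube.
  choose D hDmap hDs hD1 using fun i : ι => exists_localMap (hΦ i) (isOpen_cubeDomain (Φ i))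
    Set.inter_subset_left (isClosed_tsupport (f i)) (hfs i)
  refine ⟨ι, D, fun T => ?_⟩
  obtain ⟨k, hk, hT⟩ := T.2
  choose F hFs hFδ hFk using fun (i j : ι) => exists_contDiff_localized (hΦ i) (hΦ j) (hf i) (hf j)
    (hfs i) (hfs j) hk
  choose c hc hcF using fun (i j : ι) => exists_fourierSum_eq (hFs i j) (by norm_num) (hFδ i j)
  refine ⟨fun i j => ⟨c i j, hc i j⟩, Subtype.ext ?_⟩
  have hker : ∀ p : ι × ι, HasKernel ((D p.1).op ν (D p.2) (c p.1 p.2))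
      fun x y => f p.1 x * f p.2 y * k x y := by
    rintro ⟨i, j⟩
    have h := (D i).hasKernel_op ν (D j) (hc i j)
    have heq : (fun x y => (D i).cut x * (D j).cut y *
        fourierSum (c i j) ((D i).map x, (D j).map y)) = fun x y => f i x * f j y * k x y := by
      funext x y
      by_cases hx : x ∈ cubeDomain (Φ i)
      · by_cases hy : y ∈ cubeDomain (Φ j)
        · rw [hDmap, hDmap, hcF i j _
            (fun l => ⟨by linarith [(hx.2 l).1], by linarith [(hx.2 l).2]⟩)
            (fun l => ⟨by linarith [(hy.2 l).1], by linarith [(hy.2 l).2]⟩),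
            hFk i j x hx.1 y hy.1]
          by_cases h1 : x ∈ tsupport (f i)
          · by_cases h2 : y ∈ tsupport (f j)
            · rw [hD1 i x h1, hD1 j y h2]
              ring
            · rw [image_eq_zero_of_notMem_tsupport h2]
              ring
          · rw [image_eq_zero_of_notMem_tsupport h1]
            ring
        · rw [image_eq_zero_of_notMem_tsupport fun h => hy (hfs j h),
            image_eq_zero_of_notMem_tsupport fun h => hy (hDs j h)]
          ring
      · rw [image_eq_zero_of_notMem_tsupport fun h => hx (hfs i h),
          image_eq_zero_of_notMem_tsupport fun h => hx (hDs i h)]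
        ring
    rw [heq] at h
    exact h
  have h := hasKernel_sum ν Finset.univ (fun p x => ?_) hker
  · have h2 : (fun x y => ∑ p : ι × ι, f p.1 x * f p.2 y * k x y) = k := by
      funext x y
      rw [← Finset.sum_mul, Fintype.sum_prod_type]
      simp only [← Finset.mul_sum, hf1, mul_one, one_mul]
    rw [h2] at h
    rw [hT.unique h]
    rw [AddSubmonoidClass.coe_finsetSum]
    rfl
  · have hkx : Continuous (k x) := hk.continuous.comp (Continuous.prodMk_right x)
    exact (continuous_const.mul (hf _).continuous).mul hkx

end Charts

end ParametricTrace
end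

noncomputable section

namespace ParametricTrace

/-! ### A biorthogonal system of localized exponentials -/

section Biorthogonal

variable {n : ℕ} {M : Type*} [TopologicalSpace M] [ChartedSpace (EuclideanSpace ℝ (Fin n)) M]
  [MeasurableSpace M] [BorelSpace M] {ν : Measure M}

omit [ChartedSpace (EuclideanSpace ℝ (Fin n)) M] in
-- By the density hypothesis, `ν` on the chart domain is the image under `φ.symm` of the measure `r
-- da` on the target; the rest is integration against an image measure.
theorem integral_eq_setIntegral_target {φ : OpenPartialHomeomorph M (EuclideanSpace ℝ (Fin n))}
    {r : EuclideanSpace ℝ (Fin n) → ℝ} (hr : ContinuousOn r φ.target)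
    (hpos : ∀ a ∈ φ.target, 0 < r a)
    (hν : ∀ s : Set M, MeasurableSet s → s ⊆ φ.source →
      ν s = ∫⁻ a in φ '' s, ENNReal.ofReal (r a))
    {f : M → ℂ} (hf : Continuous f) (hf0 : ∀ x ∉ φ.source, f x = 0) :
    ∫ x, f x ∂ν = ∫ a in φ.target, r a • f (φ.symm a) := by
  have hsymm : AEMeasurable φ.symm (volume.restrict φ.target) :=
    φ.continuousOn_symm.aemeasurable φ.open_target.measurableSet
  have hrm : AEMeasurable (fun a => ENNReal.ofReal (r a)) (volume.restrict φ.target) :=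
    (hr.aemeasurable φ.open_target.measurableSet).ennreal_ofReal
  let κ := (volume.restrict φ.target).withDensity fun a => ENNReal.ofReal (r a)
  have hκ : AEMeasurable φ.symm κ := hsymm.mono_ac (withDensity_absolutelyContinuous _ _)
  have hmap : ν.restrict φ.source = κ.map φ.symm := by
    ext s hs
    rw [Measure.restrict_apply hs, Measure.map_apply_of_aemeasurable hκ hs,
      hν _ (hs.inter φ.open_source.measurableSet) Set.inter_subset_right,
      withDensity_apply', Measure.restrict_restrict' φ.open_target.measurableSet]
    have : φ '' (s ∩ φ.source) = φ.symm ⁻¹' s ∩ φ.target := by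
      rw [Set.inter_comm, φ.image_source_inter_eq', Set.inter_comm]
    rw [this]
  rw [← setIntegral_eq_integral_of_forall_compl_eq_zero hf0, hmap,
    integral_map hκ hf.aestronglyMeasurable,
    integral_withDensity_eq_integral_toReal_smul₀ hrm (Filter.Eventually.of_forall fun _ =>
      ENNReal.ofReal_lt_top)]
  refine setIntegral_congr_fun φ.open_target.measurableSet fun a ha => ?_
  simp only [ENNReal.toReal_ofReal (hpos a ha).le]

variable [IsManifold (𝓡 n) ∞ M] [CompactSpace M] [T2Space M] [IsFiniteMeasure ν]

/-- Both systems live in one chart. Its coordinates are dilated until the image contains the support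
of a test function `g` with `∫ expo m * g = δ`. The function `g` becomes the cut-off of `W'`,
corrected by density and Jacobian, and the cut-off of `W` is one on its support. -/
theorem exists_biorthogonal [Nonempty M] (hν : IsSmoothDensity (n := n) ν) :
    ∃ W W' : LocalMap n M, ∀ a b,
      inner ℂ (W'.covec ν b) (W.vec ν a) = if a = b then 1 else 0 := by
  obtain ⟨g, hg, hgc, hgi⟩ := exists_integral_expo_mul_eq_delta n
  let x₀ : M := Classical.arbitrary M
  let φ := chartAt (EuclideanSpace ℝ (Fin n)) x₀
  have hφ : φ ∈ atlas (EuclideanSpace ℝ (Fin n)) M := chart_mem_atlas _ _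
  obtain ⟨r, hr, hrpos, hrν⟩ := hν φ hφ
  obtain ⟨ε, hε, hball⟩ := Metric.isOpen_iff.1 φ.open_target (φ x₀) (mem_chart_target _ x₀)
  obtain ⟨R, hR⟩ := hgc.isCompact.isBounded.subset_closedBall (0 : EuclideanSpace ℝ (Fin n))
  -- The dilation by `κ` maps the ball of radius `ε` in the chart target onto a ball containing the
  -- support of `g`.
  obtain ⟨κ, hκ0, hκ⟩ : ∃ κ : ℝ, 0 < κ ∧ R < κ * ε := by
    refine ⟨(|R| + 1) / ε, by positivity, ?_⟩
    rw [div_mul_cancel₀ _ hε.ne']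
    linarith [le_abs_self R]
  let Φ := φ.transHomeomorph (affineHomeo hκ0.ne' (φ x₀) 0)
  have hΦ : IsSmoothChart Φ := isSmoothChart_affine hφ _ _ _
  have hΦx : ∀ x, Φ x = κ • (φ x - φ x₀) := fun x => by
    change affineHomeo hκ0.ne' (φ x₀) 0 (φ x) = _
    rw [affineHomeo_apply, add_zero]
  have htarget : ∀ a, κ • (a - φ x₀) ∈ tsupport g → a ∈ φ.target := by
    intro a ha
    apply hball
    have h := hR ha
    rw [mem_closedBall_zero_iff, norm_smul, Real.norm_of_nonneg hκ0.le] at h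
    rw [Metric.mem_ball, dist_eq_norm]
    exact lt_of_mul_lt_mul_left (h.trans_lt hκ) hκ0.le
  have htarget' : tsupport g ⊆ Φ.target := by
    intro b hb
    change (affineHomeo hκ0.ne' (φ x₀) 0).symm b ∈ φ.target
    apply htarget
    rw [affineHomeo_symm_apply]
    simpa [smul_smul, hκ0.ne'] using hb
  let K : Set M := Φ.symm '' tsupport g
  have hK : IsClosed K := (hgc.isCompact.image_of_continuousOn
    (Φ.continuousOn_symm.mono htarget')).isClosed
  have hKs : K ⊆ φ.source := by
    rintro _ ⟨b, hb, rfl⟩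
    exact Φ.map_target (htarget' hb)
  obtain ⟨W, hWmap, -, hW1⟩ := exists_localMap hΦ φ.open_source le_rfl hK hKs
  classical
  -- The factor `r⁻¹` cancels the density of `ν`, and `κ ^ n` cancels the Jacobian of the dilation.
  let q : M → ℂ := φ.source.indicator fun x => ((κ ^ n * (r (φ x))⁻¹ : ℝ) : ℂ) * g (Φ x)
  have hq0 : ∀ x ∉ K, q x = 0 := by
    intro x hx
    by_cases hxs : x ∈ φ.source
    · have : g (Φ x) = 0 := image_eq_zero_of_notMem_tsupport fun h =>
        hx ⟨_, h, Φ.left_inv hxs⟩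
      change φ.source.indicator _ x = 0
      rw [Set.indicator_of_mem hxs, this, mul_zero]
    · exact Set.indicator_of_notMem hxs _
  have hq : ContMDiff (𝓡 n) 𝓘(ℝ, ℂ) ∞ q := by
    refine contMDiff_of_closed_support φ.open_source hK hKs ?_ hq0
    have h1 : ContDiffOn ℝ ∞ (fun a => ((κ ^ n * (r a)⁻¹ : ℝ) : ℂ)) φ.target :=
      Complex.ofRealCLM.contDiff.comp_contDiffOn
        (contDiffOn_const.mul (hr.inv fun a ha => (hrpos a ha).ne'))
    have h2 : ContMDiffOn (𝓡 n) (𝓡 n) ∞ φ φ.source := contMDiffOn_chart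
    have h3 : ContMDiffOn (𝓡 n) 𝓘(ℝ, ℂ) ∞ (fun x => ((κ ^ n * (r (φ x))⁻¹ : ℝ) : ℂ)) φ.source :=
      h1.contMDiffOn.comp h2 fun x hx => φ.map_source hx
    have h4 : ContMDiffOn (𝓡 n) 𝓘(ℝ, ℂ) ∞ (fun x => g (Φ x)) φ.source :=
      hg.contMDiff.comp_contMDiffOn hΦ.contMDiffOn
    intro x hx
    have h5 := contMDiffAt_mul_complex (h3.contMDiffAt (φ.open_source.mem_nhds hx))
      (h4.contMDiffAt (φ.open_source.mem_nhds hx))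
    refine (h5.congr_of_eventuallyEq ?_).contMDiffWithinAt
    filter_upwards [φ.open_source.mem_nhds hx] with y hy
    exact Set.indicator_of_mem hy _
  have hqK : tsupport q ⊆ K := closure_minimal (fun x hx => by
    by_contra h
    exact hx (hq0 x h)) hK
  let W' : LocalMap n M := ⟨q, Φ, hq, fun x hx =>
    hΦ.contMDiffOn.contMDiffAt (φ.open_source.mem_nhds (hKs (hqK hx)))⟩
  refine ⟨W, W', fun a b => ?_⟩
  rw [LocalMap.inner_covec_vec]
  have heq : ∀ x, W'.fn (-b) x * W.fn a x = q x * expo (a - b) (Φ x) := by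
    intro x
    change q x * expo (-b) (Φ x) * (W.cut x * expo a (W.map x)) = _
    by_cases hx : x ∈ K
    · rw [hW1 x hx, hWmap, sub_eq_add_neg, expo_add]
      ring
    · rw [hq0 x hx]
      ring
  have hcont : Continuous fun x => q x * expo (a - b) (Φ x) :=
    (show Continuous fun x => W'.fn (-b) x * W.fn a x by fun_prop).congr heq
  rw [integral_congr_ae (Filter.Eventually.of_forall heq),
    integral_eq_setIntegral_target hr.continuousOn hrpos hrν hcont fun x hx => by
      rw [hq0 x fun h => hx (hKs h), zero_mul]]
  let G : EuclideanSpace ℝ (Fin n) → ℂ := fun y => ((κ ^ n : ℝ) : ℂ) * (expo (a - b) y * g y)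
  have h1 : ∫ y in φ.target, r y • (q (φ.symm y) * expo (a - b) (Φ (φ.symm y))) =
      ∫ y in φ.target, G (κ • (y - φ x₀)) := by
    refine setIntegral_congr_fun φ.open_target.measurableSet fun y hy => ?_
    have hs := φ.map_target hy
    have h2 : q (φ.symm y) = ((κ ^ n * (r y)⁻¹ : ℝ) : ℂ) * g (κ • (y - φ x₀)) := by
      change φ.source.indicator _ _ = _
      rw [Set.indicator_of_mem hs, hΦx, φ.right_inv hy]
    simp only [h2, hΦx, φ.right_inv hy, G, Complex.real_smul]
    have hrc : ((r y : ℝ) : ℂ) ≠ 0 := by exact_mod_cast (hrpos y hy).ne'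
    push_cast
    field_simp
  rw [h1, setIntegral_eq_integral_of_forall_compl_eq_zero fun y hy => by
      have : g (κ • (y - φ x₀)) = 0 := image_eq_zero_of_notMem_tsupport fun h => hy (htarget y h)
      simp [G, this],
    integral_sub_right_eq_self (fun y => G (κ • y)) (φ x₀), Measure.integral_comp_smul,
    integral_const_mul, hgi]
  simp only [finrank_euclideanSpace, Fintype.card_fin, sub_eq_zero, abs_inv, abs_pow,
    abs_of_pos hκ0]
  have hκc : ((κ : ℝ) : ℂ) ≠ 0 := by exact_mod_cast hκ0.ne'
  rw [Complex.real_smul]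
  push_cast
  split_ifs
  · field_simp
  · simp

/-- Up to a constant, the trace is the only tracial functional on smoothing operators. -/
theorem exists_trace (hν : IsSmoothDensity (n := n) ν) : ∃ E : smoothOps n ν,
    ∀ T : smoothOps n ν, ∃ s, HasTrace T.1 s ∧
      ∀ t : smoothOps n ν →ₗ[ℂ] ℂ, IsTracial t → t T = t E * s := by
  rcases isEmpty_or_nonempty M with hM | hM
  · refine ⟨0, fun T => ⟨0, fun s b => ?_, fun t _ => ?_⟩⟩
    · have h0 : ∀ u : L2 ν, u = 0 := fun u => Lp.ext (Filter.Eventually.of_forall isEmptyElim)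
      convert hasSum_zero with i
      rw [h0 (T.1 _), inner_zero_right]
    · have : T = 0 := Subtype.ext (ContinuousLinearMap.ext fun u =>
        Lp.ext (Filter.Eventually.of_forall isEmptyElim))
      rw [this, map_zero, mul_zero]
  · obtain ⟨W, W', hW⟩ := exists_biorthogonal hν
    obtain ⟨ι, D, hD⟩ := exists_decomposition (n := n) ν
    -- The reference operator is the matrix unit of the biorthogonal system. The series below is
    -- both the trace of each localized piece (`hasTrace_op`) and the factor in `map_op_eq`.
    refine ⟨opLinear ν W W' ⟨_, isRapidMat_unitMatrix⟩, fun T => ?_⟩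
    obtain ⟨c, hc⟩ := hD T
    refine ⟨∑ p : ι × ι, ∑' q : (Fin n → ℤ) × (Fin n → ℤ), (c p.1 p.2).1 q.1 q.2 *
      inner ℂ ((D p.2).covec ν q.2) ((D p.1).vec ν q.1), fun s b => ?_, fun t ht => ?_⟩
    · have h := hasSum_sum (s := Finset.univ) fun (p : ι × ι) _ =>
        hasTrace_op (ν := ν) (D p.1) (D p.2) (c p.1 p.2).2 s b
      convert h using 2 with i
      rw [← inner_sum, hc, AddSubmonoidClass.coe_finsetSum, _root_.sum_apply]
      rfl
    · rw [hc, map_sum, Finset.mul_sum]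
      exact Finset.sum_congr rfl fun p _ => map_op_eq hW ht _ _ _

end Biorthogonal

end ParametricTrace
end

noncomputable section

namespace ParametricTrace

/-! ### Construction of smoothing kernels with parameters -/

section Calculus

variable {P W : Type*} [NormedAddCommGroup P] [NormedSpace ℝ P] [NormedAddCommGroup W]
  [NormedSpace ℝ W]

theorem norm_iteratedFDeriv_comp_fst_le {f : P → ℂ} (hf : ContDiff ℝ ∞ f) (z : P × W) (i : ℕ) :
    ‖iteratedFDeriv ℝ i (fun z : P × W => f z.1) z‖ ≤ ‖iteratedFDeriv ℝ i f z.1‖ := by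
  have h := (ContinuousLinearMap.fst ℝ P W).iteratedFDeriv_comp_right hf z (i := i)
    (mod_cast le_top)
  change ‖iteratedFDeriv ℝ i (f ∘ ContinuousLinearMap.fst ℝ P W) z‖ ≤ _
  rw [h]
  refine (ContinuousMultilinearMap.norm_compContinuousLinearMap_le _ _).trans ?_
  refine mul_le_of_le_one_right (norm_nonneg _) (Finset.prod_le_one (fun _ _ => norm_nonneg _)
    fun _ _ => ContinuousLinearMap.norm_fst_le ℝ P W)

theorem norm_iteratedFDeriv_mul_fst_le {f : P → ℂ} (hf : ContDiff ℝ ∞ f) {g : P × W → ℂ}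
    {s : Set (P × W)} (hs : IsOpen s) (hg : ContDiffOn ℝ ∞ g s) {z : P × W} (hz : z ∈ s) (l : ℕ) :
    ‖iteratedFDeriv ℝ l (fun z : P × W => f z.1 * g z) z‖ ≤ ∑ i ∈ Finset.range (l + 1),
      (l.choose i : ℝ) * ‖iteratedFDeriv ℝ i f z.1‖ * ‖iteratedFDeriv ℝ (l - i) g z‖ := by
  have h := norm_iteratedFDerivWithin_mul_le (𝕜 := ℝ) (hf.comp contDiff_fst).contDiffOn hg
    hs.uniqueDiffOn hz (n := l) (mod_cast le_top)
  simp only [iteratedFDerivWithin_of_isOpen _ hs hz] at h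
  refine h.trans (Finset.sum_le_sum fun i _ => ?_)
  gcongr
  exact norm_iteratedFDeriv_comp_fst_le hf z i

/-- A kernel without parameter has the same derivatives at every parameter, so bounds at parameter
zero on a compact set of coordinates serve for the whole cone. -/
theorem iteratedFDeriv_eq_of_eq_snd {g : P × W → ℂ} (h : ∀ a b w, g (a, w) = g (b, w)) (l : ℕ)
    (a b : P) (w : W) : iteratedFDeriv ℝ l g (a, w) = iteratedFDeriv ℝ l g (b, w) := by
  have h1 := iteratedFDeriv_comp_add_right (𝕜 := ℝ) (f := g) l (a - b, 0) (b, w)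
  have h2 : (fun z => g (z + (a - b, 0))) = g := by
    funext z
    rw [← Prod.mk.eta (p := z), Prod.mk_add_mk, add_zero]
    exact h _ _ _
  rw [h2] at h1
  rw [h1]
  simp

theorem one_add_pow_mul_exp_le {b r : ℝ} (hb : 0 < b) (hr : 0 ≤ r) (m : ℕ) :
    (1 + r) ^ m * Real.exp (-b * r ^ 2) ≤ m.factorial * (b⁻¹) ^ m * Real.exp (2 * b) := by
  have h := Real.pow_div_factorial_le_exp (b * (1 + r)) (by positivity) m
  have h1 : Real.exp (b * (1 + r)) ≤ Real.exp (2 * b) * Real.exp (b * r ^ 2) := by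
    rw [← Real.exp_add, Real.exp_le_exp]
    nlinarith [mul_nonneg hb.le (sq_nonneg (r - 1 / 2))]
  have h2 : (1 + r) ^ m ≤ m.factorial * (b⁻¹) ^ m * (Real.exp (2 * b) * Real.exp (b * r ^ 2)) := by
    have h3 : (1 + r) ^ m = m.factorial * (b⁻¹) ^ m * ((b * (1 + r)) ^ m / m.factorial) := by
      have : (m.factorial : ℝ) ≠ 0 := by positivity
      rw [mul_pow, inv_pow]
      field_simp
    rw [h3]
    gcongr
    exact h.trans h1
  calc (1 + r) ^ m * Real.exp (-b * r ^ 2)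
      ≤ m.factorial * (b⁻¹) ^ m * (Real.exp (2 * b) * Real.exp (b * r ^ 2)) *
        Real.exp (-b * r ^ 2) := by gcongr
    _ = m.factorial * (b⁻¹) ^ m * Real.exp (2 * b) *
        (Real.exp (b * r ^ 2) * Real.exp (-b * r ^ 2)) := by ring
    _ = _ := by rw [← Real.exp_add]; simp

theorem iteratedDeriv_ofReal_exp (i : ℕ) :
    iteratedDeriv i (fun t : ℝ => (Real.exp t : ℂ)) = fun t : ℝ => (Real.exp t : ℂ) := by
  induction i with
  | zero => simp
  | succ i ih =>
    rw [iteratedDeriv_succ, ih]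
    funext t
    exact (Real.hasDerivAt_exp t).ofReal_comp.deriv

end Calculus

/-! ### Gaussian functions of the parameter -/

section Gaussian

variable {p : ℕ}

/-- The Gaussian function. -/
def gauss (b : ℝ) (ξ : EuclideanSpace ℝ (Fin p)) : ℂ := (Real.exp (-b * ‖ξ‖ ^ 2) : ℂ)

theorem contDiff_gauss (b : ℝ) : ContDiff ℝ ∞ (gauss (p := p) b) :=
  Complex.ofRealCLM.contDiff.comp (Real.contDiff_exp.comp (contDiff_const.mul (contDiff_norm_sq ℝ)))

theorem gauss_ne_zero (b : ℝ) (ξ : EuclideanSpace ℝ (Fin p)) : gauss b ξ ≠ 0 := by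
  simp [gauss, Complex.exp_ne_zero]

/-- Used with `1/2 + 1/2` to split a Gaussian family into a product of two, and with `-1 + 1` to
divide by the Gaussian. -/
theorem gauss_add (a b : ℝ) (ξ : EuclideanSpace ℝ (Fin p)) :
    gauss (a + b) ξ = gauss a ξ * gauss b ξ := by
  simp only [gauss]
  rw [← Complex.ofReal_mul, ← Real.exp_add]
  congr 2
  ring

theorem exists_norm_iteratedFDeriv_gauss_le {b : ℝ} (hb : 0 < b) (l N : ℕ) :
    ∃ c : ℝ, 0 ≤ c ∧ ∀ ξ : EuclideanSpace ℝ (Fin p),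
      (1 + ‖ξ‖) ^ N * ‖iteratedFDeriv ℝ l (gauss b) ξ‖ ≤ c := by
  have htemp : (fun ξ : EuclideanSpace ℝ (Fin p) => -b * ‖ξ‖ ^ 2).HasTemperateGrowth :=
    (Function.HasTemperateGrowth.const (-b)).mul
      (Function.hasTemperateGrowth_norm_sq (EuclideanSpace ℝ (Fin p)))
  obtain ⟨k, C, hC, h⟩ := htemp.norm_iteratedFDeriv_le_uniform l
  refine ⟨l.factorial * (1 + C) ^ l *
    ((N + k * l).factorial * (b⁻¹) ^ (N + k * l) * Real.exp (2 * b)), by positivity, fun ξ => ?_⟩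
  have h1 := norm_iteratedFDeriv_comp_le (𝕜 := ℝ) (N := ∞)
    (g := fun t : ℝ => (Real.exp t : ℂ)) (f := fun ξ => -b * ‖ξ‖ ^ 2) (n := l)
    (Complex.ofRealCLM.contDiff.comp Real.contDiff_exp) htemp.1 (mod_cast le_top) ξ
    (C := Real.exp (-b * ‖ξ‖ ^ 2)) (D := (1 + C) * (1 + ‖ξ‖) ^ k) (fun i _ => by
      rw [norm_iteratedFDeriv_eq_norm_iteratedDeriv, iteratedDeriv_ofReal_exp,
        Complex.norm_real, Real.norm_of_nonneg (Real.exp_pos _).le]) (fun i hi hil => by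
      refine (h i hil ξ).trans ?_
      have h2 : C * (1 + ‖ξ‖) ^ k ≤ (1 + C) * (1 + ‖ξ‖) ^ k := by gcongr; simp
      -- The constant `1 + C` makes the base at least one, so a uniform bound is also a bound by its
      -- `i`-th power.
      refine h2.trans (le_self_pow₀ (one_le_mul_of_one_le_of_one_le (by linarith)
        (one_le_pow₀ (by linarith [norm_nonneg ξ]))) (by omega)))
  calc (1 + ‖ξ‖) ^ N * ‖iteratedFDeriv ℝ l (gauss b) ξ‖
      ≤ (1 + ‖ξ‖) ^ N *
          (l.factorial * Real.exp (-b * ‖ξ‖ ^ 2) * ((1 + C) * (1 + ‖ξ‖) ^ k) ^ l) := by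
        gcongr
        exact h1
    _ = l.factorial * (1 + C) ^ l *
        ((1 + ‖ξ‖) ^ (N + k * l) * Real.exp (-b * ‖ξ‖ ^ 2)) := by
        rw [pow_add, pow_mul, mul_pow]
        ring
    _ ≤ _ := mul_le_mul_of_nonneg_left (one_add_pow_mul_exp_le hb (norm_nonneg ξ) _)
        (by positivity)

end Gaussian

/-! ### Parametric kernels in local coordinates -/

section Kernels

variable {p n : ℕ} {M : Type*} [TopologicalSpace M] [ChartedSpace (EuclideanSpace ℝ (Fin n)) M]

/-- A parametric kernel in local coordinates. -/
def localExpr (K : EuclideanSpace ℝ (Fin p) × M × M → ℂ)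
    (φ ψ : OpenPartialHomeomorph M (EuclideanSpace ℝ (Fin n))) :
    EuclideanSpace ℝ (Fin p) × EuclideanSpace ℝ (Fin n) × EuclideanSpace ℝ (Fin n) → ℂ :=
  fun z => K (z.1, φ.symm z.2.1, ψ.symm z.2.2)

/-- Smoothness of a parametric kernel in local coordinates. -/
def IsLocallySmooth (n : ℕ) {M : Type*} [TopologicalSpace M]
    [ChartedSpace (EuclideanSpace ℝ (Fin n)) M] (U : Set (EuclideanSpace ℝ (Fin p)))
    (K : EuclideanSpace ℝ (Fin p) × M × M → ℂ) : Prop :=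
  ∀ φ ∈ atlas (EuclideanSpace ℝ (Fin n)) M, ∀ ψ ∈ atlas (EuclideanSpace ℝ (Fin n)) M,
    ContDiffOn ℝ ∞ (localExpr K φ ψ) (U ×ˢ φ.target ×ˢ ψ.target)

variable [IsManifold (𝓡 n) ∞ M] {U : Set (EuclideanSpace ℝ (Fin p))}
  {K : EuclideanSpace ℝ (Fin p) × M × M → ℂ}

theorem isLocallySmooth_of_contMDiffOn (hU : IsOpen U)
    (hK : ContMDiffOn (𝓘(ℝ, EuclideanSpace ℝ (Fin p)).prod ((𝓡 n).prod (𝓡 n))) 𝓘(ℝ, ℂ) ∞ K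
      (U ×ˢ Set.univ)) : IsLocallySmooth n U K := by
  intro φ hφ ψ hψ
  rw [contDiffOn_infty]
  intro l z hz
  exact (contDiffAt_local hU hK hφ hψ hz.1 hz.2 l).contDiffWithinAt

omit [ChartedSpace (EuclideanSpace ℝ (Fin n)) M] [IsManifold (𝓡 n) ∞ M] in
theorem isOpen_prod_target (hU : IsOpen U)
    (φ ψ : OpenPartialHomeomorph M (EuclideanSpace ℝ (Fin n))) :
    IsOpen (U ×ˢ φ.target ×ˢ ψ.target) :=
  hU.prod (φ.open_target.prod ψ.open_target)

theorem IsLocallySmooth.contMDiffOn (hU : IsOpen U) (hK : IsLocallySmooth n U K) :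
    ContMDiffOn (𝓘(ℝ, EuclideanSpace ℝ (Fin p)).prod ((𝓡 n).prod (𝓡 n))) 𝓘(ℝ, ℂ) ∞ K
      (U ×ˢ Set.univ) := by
  rintro ⟨μ, x, y⟩ ⟨hμ, -⟩
  let φ := chartAt (EuclideanSpace ℝ (Fin n)) x
  let ψ := chartAt (EuclideanSpace ℝ (Fin n)) y
  have h1 : ContDiffAt ℝ ∞ (localExpr K φ ψ) (μ, φ x, ψ y) :=
    (hK φ (chart_mem_atlas _ x) ψ (chart_mem_atlas _ y)).contDiffAt
      ((isOpen_prod_target hU φ ψ).mem_nhds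
        ⟨hμ, mem_chart_target _ x, mem_chart_target _ y⟩)
  have hx : ContMDiffAt (𝓡 n) (𝓡 n) ∞ φ x := contMDiffAt_of_mem_maximalAtlas
    (IsManifold.subset_maximalAtlas (chart_mem_atlas _ x)) (mem_chart_source _ x)
  have hy : ContMDiffAt (𝓡 n) (𝓡 n) ∞ ψ y := contMDiffAt_of_mem_maximalAtlas
    (IsManifold.subset_maximalAtlas (chart_mem_atlas _ y)) (mem_chart_source _ y)
  have e1 : ContMDiffAt (𝓘(ℝ, EuclideanSpace ℝ (Fin p)).prod ((𝓡 n).prod (𝓡 n)))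
      𝓘(ℝ, EuclideanSpace ℝ (Fin p)) ∞
      (fun z : EuclideanSpace ℝ (Fin p) × M × M => z.1) (μ, x, y) := contMDiffAt_fst
  have e2 : ContMDiffAt (𝓘(ℝ, EuclideanSpace ℝ (Fin p)).prod ((𝓡 n).prod (𝓡 n))) (𝓡 n) ∞
      (fun z : EuclideanSpace ℝ (Fin p) × M × M => z.2.1) (μ, x, y) :=
    (contMDiff_fst.comp contMDiff_snd).contMDiffAt
  have e3 : ContMDiffAt (𝓘(ℝ, EuclideanSpace ℝ (Fin p)).prod ((𝓡 n).prod (𝓡 n))) (𝓡 n) ∞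
      (fun z : EuclideanSpace ℝ (Fin p) × M × M => z.2.2) (μ, x, y) :=
    (contMDiff_snd.comp contMDiff_snd).contMDiffAt
  have hx' := ContMDiffAt.comp (x := (μ, x, y)) (g := φ) hx e2
  have hy' := ContMDiffAt.comp (x := (μ, x, y)) (g := ψ) hy e3
  have h2 := ContMDiffAt.comp (x := (μ, x, y)) (g := localExpr K φ ψ) h1.contMDiffAt
    (e1.prodMk_space (hx'.prodMk_space hy'))
  refine (h2.congr_of_eventuallyEq ?_).contMDiffWithinAt
  have hopen : IsOpen (Set.univ ×ˢ φ.source ×ˢ ψ.source : Set (EuclideanSpace ℝ (Fin p) × M × M)) :=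
    isOpen_univ.prod (φ.open_source.prod ψ.open_source)
  filter_upwards [hopen.mem_nhds ⟨trivial, mem_chart_source _ x, mem_chart_source _ y⟩] with z hz
  change K z = K (z.1, φ.symm (φ z.2.1), ψ.symm (ψ z.2.2))
  rw [φ.left_inv hz.2.1, ψ.left_inv hz.2.2]

variable {Γ : Set (EuclideanSpace ℝ (Fin p))}

/-- Multiplication by functions of moderate growth. -/
theorem IsSmoothingKernel.mul_temperate {k : Γ → M → M → ℂ} (hk : IsSmoothingKernel (n := n) Γ k)
    {m : EuclideanSpace ℝ (Fin p) → ℂ} (hm : m.HasTemperateGrowth) :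
    IsSmoothingKernel (n := n) Γ fun μ x y => m μ * k μ x y := by
  obtain ⟨U, K, hU, hΓU, hK, hKk, hKb⟩ := hk
  have hloc := isLocallySmooth_of_contMDiffOn hU hK
  refine ⟨U, fun z => m z.1 * K z, hU, hΓU, IsLocallySmooth.contMDiffOn hU fun φ hφ ψ hψ => ?_,
    fun μ x y => by simp only [hKk], fun φ hφ ψ hψ Q hQ hQc L hL hLc l N => ?_⟩
  · exact (hm.1.comp contDiff_fst).contDiffOn.mul (hloc φ hφ ψ hψ)
  · obtain ⟨d, C, hC, hmC⟩ := hm.norm_iteratedFDeriv_le_uniform l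
    choose c hc using fun i => hKb φ hφ ψ hψ Q hQ hQc L hL hLc i (N + d)
    refine ⟨∑ i ∈ Finset.range (l + 1), (l.choose i : ℝ) * C * c (l - i), fun ξ hξ q hq => ?_⟩
    have h := norm_iteratedFDeriv_mul_fst_le hm.1 (isOpen_prod_target hU φ ψ) (hloc φ hφ ψ hψ)
      (z := (ξ, q)) ⟨hΓU hξ.1, hQ hq⟩ l
    refine (mul_le_mul_of_nonneg_left h (by positivity)).trans ?_
    rw [Finset.mul_sum]
    refine Finset.sum_le_sum fun i hi => ?_
    calc (1 + ‖ξ‖) ^ N * ((l.choose i : ℝ) * ‖iteratedFDeriv ℝ i m ξ‖ *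
          ‖iteratedFDeriv ℝ (l - i) (localExpr K φ ψ) (ξ, q)‖)
        ≤ (1 + ‖ξ‖) ^ N * ((l.choose i : ℝ) * (C * (1 + ‖ξ‖) ^ d) *
          ‖iteratedFDeriv ℝ (l - i) (localExpr K φ ψ) (ξ, q)‖) := by
          gcongr
          exact hmC i (by simpa [Nat.lt_succ_iff] using hi) ξ
      _ = (l.choose i : ℝ) * C * ((1 + ‖ξ‖) ^ (N + d) *
          ‖iteratedFDeriv ℝ (l - i) (localExpr K φ ψ) (ξ, q)‖) := by
          rw [pow_add]
          ring
      _ ≤ _ := by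
          gcongr
          exact hc (l - i) ξ hξ q hq

theorem isSmoothingKernel_gauss_mul {k : M → M → ℂ} (hk : IsSmoothKernel n k) {b : ℝ}
    (hb : 0 < b) : IsSmoothingKernel (n := n) Γ fun μ x y => gauss b μ.1 * k x y := by
  let K : EuclideanSpace ℝ (Fin p) × M × M → ℂ := fun z => k z.2.1 z.2.2
  have hK : ContMDiffOn (𝓘(ℝ, EuclideanSpace ℝ (Fin p)).prod ((𝓡 n).prod (𝓡 n))) 𝓘(ℝ, ℂ) ∞ K
      (Set.univ ×ˢ Set.univ) := (ContMDiff.comp hk contMDiff_snd).contMDiffOn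
  have hloc := isLocallySmooth_of_contMDiffOn isOpen_univ hK
  refine ⟨Set.univ, fun z => gauss b z.1 * K z, isOpen_univ, Set.subset_univ _,
    IsLocallySmooth.contMDiffOn isOpen_univ fun φ hφ ψ hψ => ?_, fun _ _ _ => rfl,
    fun φ hφ ψ hψ Q hQ hQc L hL hLc l N => ?_⟩
  · exact ((contDiff_gauss b).comp contDiff_fst).contDiffOn.mul (hloc φ hφ ψ hψ)
  · choose c hc0 hc using fun i => exists_norm_iteratedFDeriv_gauss_le (p := p) hb i N
    have hbd : ∀ i : ℕ, ∃ d : ℝ, ∀ q ∈ Q, ‖iteratedFDeriv ℝ i (localExpr K φ ψ) (0, q)‖ ≤ d := by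
      intro i
      have hcont : ContinuousOn (fun q => iteratedFDeriv ℝ i (localExpr K φ ψ)
          ((0 : EuclideanSpace ℝ (Fin p)), q)) Q := by
        intro q hq
        have h1 : ContDiffAt ℝ ∞ (localExpr K φ ψ) (0, q) := (hloc φ hφ ψ hψ).contDiffAt
          ((isOpen_prod_target isOpen_univ φ ψ).mem_nhds ⟨trivial, hQ hq⟩)
        have h2 := (h1.iteratedFDeriv_right (m := 0) (i := i) (mod_cast le_top)).continuousAt
        exact (ContinuousAt.comp (f := fun q => ((0 : EuclideanSpace ℝ (Fin p)), q)) h2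
          (Continuous.prodMk_right _).continuousAt).continuousWithinAt
      exact hQc.exists_bound_of_continuousOn hcont
    choose d hd using hbd
    refine ⟨∑ i ∈ Finset.range (l + 1), (l.choose i : ℝ) * c i * d (l - i), fun ξ hξ q hq => ?_⟩
    have h := norm_iteratedFDeriv_mul_fst_le (contDiff_gauss b)
      (isOpen_prod_target isOpen_univ φ ψ) (hloc φ hφ ψ hψ) (z := (ξ, q)) ⟨trivial, hQ hq⟩ l
    refine (mul_le_mul_of_nonneg_left h (by positivity)).trans ?_
    rw [Finset.mul_sum]
    refine Finset.sum_le_sum fun i hi => ?_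
    rw [iteratedFDeriv_eq_of_eq_snd (g := localExpr K φ ψ) (fun _ _ _ => rfl) _ ξ 0]
    calc (1 + ‖ξ‖) ^ N * ((l.choose i : ℝ) * ‖iteratedFDeriv ℝ i (gauss b) ξ‖ *
          ‖iteratedFDeriv ℝ (l - i) (localExpr K φ ψ) (0, q)‖)
        = (l.choose i : ℝ) * ((1 + ‖ξ‖) ^ N * ‖iteratedFDeriv ℝ i (gauss b) ξ‖) *
          ‖iteratedFDeriv ℝ (l - i) (localExpr K φ ψ) (0, q)‖ := by ring
      _ ≤ _ := by
          have := hc0 i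
          gcongr
          · exact hc i ξ
          · exact hd _ q hq

/-- Smooth kernels with compact support in the parameter are smoothing kernels. -/
theorem IsLocallySmooth.isSmoothingKernel (hK : IsLocallySmooth n Set.univ K)
    {Z : Set (EuclideanSpace ℝ (Fin p))} (hZ : IsCompact Z) (h0 : ∀ μ ∉ Z, ∀ x y, K (μ, x, y) = 0) :
    IsSmoothingKernel (n := n) Γ fun μ x y => K (μ.1, x, y) := by
  refine ⟨Set.univ, K, isOpen_univ, Set.subset_univ _, hK.contMDiffOn isOpen_univ,
    fun _ _ _ => rfl, fun φ hφ ψ hψ Q hQ hQc L hL hLc l N => ?_⟩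
  have hcont : ContinuousOn (fun z : EuclideanSpace ℝ (Fin p) × EuclideanSpace ℝ (Fin n) ×
      EuclideanSpace ℝ (Fin n) => (1 + ‖z.1‖) ^ N * ‖iteratedFDeriv ℝ l (localExpr K φ ψ) z‖)
      (Z ×ˢ Q) := by
    intro z hz
    have h1 : ContDiffAt ℝ ∞ (localExpr K φ ψ) z := (hK φ hφ ψ hψ).contDiffAt
      ((isOpen_prod_target isOpen_univ φ ψ).mem_nhds ⟨trivial, hQ hz.2⟩)
    have h2 := (h1.iteratedFDeriv_right (m := 0) (i := l) (mod_cast le_top)).continuousAt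
    have h3 : ContinuousAt (fun z : EuclideanSpace ℝ (Fin p) × EuclideanSpace ℝ (Fin n) ×
      EuclideanSpace ℝ (Fin n) => (1 + ‖z.1‖) ^ N) z := by fun_prop
    exact (h3.mul h2.norm).continuousWithinAt
  obtain ⟨c, hc⟩ := (hZ.prod hQc).exists_bound_of_continuousOn hcont
  refine ⟨max c 0, fun ξ hξ q hq => ?_⟩
  change (1 + ‖ξ‖) ^ N * ‖iteratedFDeriv ℝ l (localExpr K φ ψ) (ξ, q)‖ ≤ _
  by_cases hξZ : ξ ∈ Z
  · exact ((le_abs_self _).trans (hc (ξ, q) ⟨hξZ, hq⟩)).trans (le_max_left _ _)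
  · have : localExpr K φ ψ =ᶠ[nhds (ξ, q)] 0 := by
      filter_upwards [continuous_fst.continuousAt.preimage_mem_nhds
        (hZ.isClosed.isOpen_compl.mem_nhds hξZ)] with z hz
      exact h0 _ hz _ _
    rw [this.iteratedFDeriv ℝ l |>.eq_of_nhds]
    simp [Pi.zero_def]

end Kernels

end ParametricTrace
end

noncomputable section

namespace ParametricTrace

/-! ### Division by coordinate functions -/

section ParametricIntegrals

variable {P W : Type*} [NormedAddCommGroup P] [NormedSpace ℝ P] [NormedAddCommGroup W]
  [NormedSpace ℝ W]

theorem contDiffOn_intervalIntegral {s : Set P} (hs : IsOpen s) {h : P × ℝ → ℂ}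
    (hh : ContDiffOn ℝ ∞ h (s ×ˢ Set.univ)) :
    ContDiffOn ℝ ∞ (fun p => ∫ t in (0 : ℝ)..1, h (p, t)) s := by
  -- The integral over `[0, 1]` is the value at `0` of the convolution of the indicator with `t ↦
  -- ζ(t) h(p, -t)`. The bump `ζ` supplies compact support and equals one on `[-1, 1]`.
  let ζ : ContDiffBump (0 : ℝ) := ⟨1, 2, one_pos, one_lt_two⟩
  let g : P → ℝ → ℂ := fun p t => (ζ t : ℂ) * h (p, -t)
  let f : ℝ → ℂ := (Set.Ioc 0 1).indicator 1
  have hf : LocallyIntegrable f volume :=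
    ((integrable_indicator_iff measurableSet_Ioc).2
      (integrableOn_const (by simp) (by simp))).locallyIntegrable
  have hg : ContDiffOn ℝ ∞ ↿g (s ×ˢ Set.univ) := by
    have h1 : ContDiff ℝ ∞ fun q : P × ℝ => (ζ q.2 : ℂ) :=
      Complex.ofRealCLM.contDiff.comp (ζ.contDiff.comp contDiff_snd)
    have h2 : ContDiff ℝ ∞ fun q : P × ℝ => (q.1, -q.2) := by fun_prop
    exact h1.contDiffOn.mul (hh.comp h2.contDiffOn fun q hq => ⟨hq.1, trivial⟩)
  have h := contDiffOn_convolution_right_with_param_comp (μ := volume) (n := ⊤)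
    (ContinuousLinearMap.mul ℝ ℂ) (v := fun _ : P => (0 : ℝ)) contDiffOn_const hs
    (isCompact_closedBall (0 : ℝ) 2) (g := g) (fun p x _ hx => by
      have : ζ x = 0 := ζ.zero_of_le_dist (le_of_lt (by simpa using hx))
      simp [g, this]) hf hg
  refine h.congr fun p _ => ?_
  rw [convolution_def, intervalIntegral.integral_of_le zero_le_one,
    ← integral_indicator measurableSet_Ioc]
  congr 1
  ext t
  by_cases ht : t ∈ Set.Ioc (0 : ℝ) 1
  · have : ζ (-t) = 1 := ζ.one_of_mem_closedBall (by
      simp only [mem_closedBall_zero_iff, norm_neg, Real.norm_eq_abs, abs_of_pos ht.1]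
      exact ht.2)
    simp [f, g, ht, this]
  · simp [f, ht]

theorem fderiv_comp_prodMk {f : P × W → ℂ} {V : Set W} (hV : IsOpen V)
    (hf : ContDiffOn ℝ ∞ f (Set.univ ×ˢ V)) (a v : P) {w : W} (hw : w ∈ V) :
    fderiv ℝ (fun μ => f (μ, w)) a v = fderiv ℝ f (a, w) (v, 0) := by
  have h1 : DifferentiableAt ℝ f (a, w) :=
    (hf.contDiffAt ((isOpen_univ.prod hV).mem_nhds ⟨trivial, hw⟩)).differentiableAt (by simp)
  have h2 : HasFDerivAt (fun μ : P => (μ, w)) (ContinuousLinearMap.inl ℝ P W) a :=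
    hasFDerivAt_prodMk_left a w
  have h3 : HasFDerivAt (fun μ => f (μ, w)) _ a := h1.hasFDerivAt.comp a h2
  rw [h3.fderiv]
  rfl

theorem contDiffOn_integral_fderiv {f : P × W → ℂ} {V : Set W} (hV : IsOpen V)
    (hf : ContDiffOn ℝ ∞ f (Set.univ ×ˢ V)) (a v : P) :
    ContDiffOn ℝ ∞ (fun z : P × W => ∫ t in (0 : ℝ)..1,
      fderiv ℝ (fun μ => f (μ, z.2)) (a + t • (z.1 - a)) v) (Set.univ ×ˢ V) := by
  have hopen : IsOpen (Set.univ ×ˢ V : Set (P × W)) := isOpen_univ.prod hV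
  have h1 := hf.fderiv_of_isOpen hopen (m := ∞) (by simp)
  have h2 : ContDiff ℝ ∞ fun q : (P × W) × ℝ => (a + q.2 • (q.1.1 - a), q.1.2) := by fun_prop
  have h3 := (h1.comp h2.contDiffOn (s := (Set.univ ×ˢ V) ×ˢ Set.univ)
    fun q hq => ⟨trivial, hq.1.2⟩).clm_apply (contDiffOn_const (c := (v, (0 : W))))
  refine (contDiffOn_intervalIntegral hopen h3).congr fun z hz => ?_
  refine intervalIntegral.integral_congr fun t _ => ?_
  exact fderiv_comp_prodMk hV hf _ _ hz.2

end ParametricIntegrals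

/-! ### Hadamard's lemma and cut-offs of moderate growth -/

section Hadamard

variable {p : ℕ}

theorem sub_eq_sum_integral_fderiv {F : EuclideanSpace ℝ (Fin p) → ℂ} (hF : ContDiff ℝ ∞ F)
    (a μ : EuclideanSpace ℝ (Fin p)) :
    F μ - F a = ∑ j, ((μ j - a j : ℝ) : ℂ) *
      ∫ t in (0 : ℝ)..1, fderiv ℝ F (a + t • (μ - a)) (EuclideanSpace.single j 1) := by
  have hcont : ∀ v, Continuous fun t : ℝ => fderiv ℝ F (a + t • (μ - a)) v := fun v =>
    ((hF.continuous_fderiv (by simp)).comp (by fun_prop)).clm_apply continuous_const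
  have hder : ∀ t ∈ Set.uIcc (0 : ℝ) 1, HasDerivAt (fun t : ℝ => F (a + t • (μ - a)))
      (fderiv ℝ F (a + t • (μ - a)) (μ - a)) t := by
    intro t _
    have h1 : HasDerivAt (fun t : ℝ => a + t • (μ - a)) (μ - a) t := by
      simpa using ((hasDerivAt_id t).smul_const (μ - a)).const_add a
    exact (hF.differentiable (by simp) _).hasFDerivAt.comp_hasDerivAt t h1
  have h := intervalIntegral.integral_eq_sub_of_hasDerivAt hder
    ((hcont (μ - a)).intervalIntegrable _ _)
  have h2 : μ - a = ∑ j, (μ j - a j) • EuclideanSpace.single j (1 : ℝ) := by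
    ext i
    simp [Finset.sum_apply, Pi.single_apply]
  simp only [one_smul, zero_smul, add_zero, add_sub_cancel] at h
  rw [← h]
  have h3 : ∀ t : ℝ, fderiv ℝ F (a + t • (μ - a)) (μ - a) = ∑ j, ((μ j - a j : ℝ) : ℂ) *
      fderiv ℝ F (a + t • (μ - a)) (EuclideanSpace.single j 1) := by
    intro t
    conv_lhs => rw [h2]
    rw [map_sum]
    refine Finset.sum_congr rfl fun j _ => ?_
    rw [map_smul, Complex.real_smul, ← h2]
  simp only [h3]
  have h4 : ∀ j, IntervalIntegrable (fun t : ℝ => ((μ j - a j : ℝ) : ℂ) *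
      fderiv ℝ F (a + t • (μ - a)) (EuclideanSpace.single j 1)) volume 0 1 := fun j =>
    (continuous_const.mul (hcont _)).intervalIntegrable _ _
  rw [intervalIntegral.integral_finsetSum fun j _ => h4 j]
  simp only [intervalIntegral.integral_const_mul]

/-- All derivatives of `s ↦ s⁻¹` are bounded on `(c, ∞)`, so the reciprocal is a composition with a
function of temperate growth there. -/
theorem hasTemperateGrowth_inv {E : Type*} [NormedAddCommGroup E] [NormedSpace ℝ E] {h : E → ℝ}
    (hh : h.HasTemperateGrowth) {c : ℝ} (hc : 0 < c) (hlow : ∀ x, c < h x) :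
    (fun x => (h x)⁻¹).HasTemperateGrowth := by
  refine Function.HasTemperateGrowth.comp' (g := fun s : ℝ => s⁻¹) (t := Set.Ioi c) ?_
    isOpen_Ioi.uniqueDiffOn ?_ ?_ hh
  · rintro _ ⟨x, rfl⟩
    exact hlow x
  · exact contDiffOn_id.inv fun x hx => (hc.trans hx).ne'
  · intro N
    refine ⟨0, ∑ i ∈ Finset.range (N + 1), (i.factorial : ℝ) * (c⁻¹) ^ (i + 1), by positivity,
      fun i hi x hx => ?_⟩
    have hx0 : 0 < x := hc.trans hx
    rw [iteratedFDerivWithin_of_isOpen _ isOpen_Ioi hx, norm_iteratedFDeriv_eq_norm_iteratedDeriv,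
      iteratedDeriv_eq_iterate, pow_zero, mul_one]
    have h1 := iter_deriv_inv (𝕜 := ℝ) i x
    rw [show (fun s : ℝ => s⁻¹) = Inv.inv from rfl, h1]
    have h2 : ‖(-1 : ℝ) ^ i * (i.factorial : ℝ) * x ^ (-1 - i : ℤ)‖ =
        (i.factorial : ℝ) * (x⁻¹) ^ (i + 1) := by
      rw [norm_mul, norm_mul, norm_pow, norm_neg, norm_one, one_pow, one_mul,
        Real.norm_of_nonneg (by positivity), Real.norm_of_nonneg (by positivity), inv_pow,
        show (-1 - i : ℤ) = -((i + 1 : ℕ) : ℤ) by push_cast; ring, zpow_neg, zpow_natCast]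
    rw [h2]
    calc (i.factorial : ℝ) * (x⁻¹) ^ (i + 1) ≤ (i.factorial : ℝ) * (c⁻¹) ^ (i + 1) := by
          have : x⁻¹ ≤ c⁻¹ := inv_anti₀ hc (le_of_lt hx)
          gcongr
      _ ≤ _ := Finset.single_le_sum (f := fun i : ℕ => (i.factorial : ℝ) * (c⁻¹) ^ (i + 1))
          (fun _ _ => by positivity) (Finset.mem_range.2 (by omega))

/-- A cut-off function `f` and a function `m` of moderate growth with
`1 - f = |ξ - a|² m`. -/
theorem exists_cutoff (a : EuclideanSpace ℝ (Fin p)) {r : ℝ} (hr : 0 < r) :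
    ∃ (f g : ContDiffBump a) (m : EuclideanSpace ℝ (Fin p) → ℝ), f.rOut < r ∧
      (∀ ξ, f ξ ≠ 0 → g ξ = 1) ∧ m.HasTemperateGrowth ∧ ∀ ξ, 1 - f ξ = ‖ξ - a‖ ^ 2 * m ξ := by
  let g : ContDiffBump a := ⟨r / 2, 3 * r / 4, by positivity, by linarith⟩
  let f : ContDiffBump a := ⟨r / 4, r / 2, by positivity, by linarith⟩
  -- The denominator of `m` is `|ξ - a|² + f₀`. The bump `f₀` keeps it away from zero at `a` and
  -- vanishes wherever `1 - f` does not, so the identity for `1 - f` is unaffected.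
  let f₀ : ContDiffBump a := ⟨r / 16, r / 8, by positivity, by linarith⟩
  have htemp : ∀ f : ContDiffBump a, (fun ξ => f ξ).HasTemperateGrowth := fun f =>
    f.hasCompactSupport.hasTemperateGrowth f.contDiff
  have hsq : (fun ξ : EuclideanSpace ℝ (Fin p) => ‖ξ - a‖ ^ 2).HasTemperateGrowth :=
    (Function.hasTemperateGrowth_norm_sq (EuclideanSpace ℝ (Fin p))).comp
      (Function.HasTemperateGrowth.id.sub (Function.HasTemperateGrowth.const a))
  have hh := hsq.add (htemp f₀)
  have hinv := hasTemperateGrowth_inv hh (c := min (1 / 2) ((r / 32) ^ 2)) (by positivity)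
    (fun ξ => by
      by_cases hξ : ξ ∈ Metric.closedBall a (r / 16)
      · have : f₀ ξ = 1 := f₀.one_of_mem_closedBall hξ
        refine (min_le_left _ _).trans_lt ?_
        simp only [Pi.add_apply, this]
        nlinarith [sq_nonneg ‖ξ - a‖]
      · refine (min_le_right _ _).trans_lt ?_
        rw [Metric.mem_closedBall, not_le, dist_eq_norm] at hξ
        simp only [Pi.add_apply]
        have := f₀.nonneg (x := ξ)
        nlinarith [hξ])
  refine ⟨f, g, fun ξ => (1 - f ξ) * (‖ξ - a‖ ^ 2 + f₀ ξ)⁻¹, ?_, fun ξ hξ => ?_,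
    ((Function.HasTemperateGrowth.const 1).sub (htemp f)).mul hinv, fun ξ => ?_⟩
  · change r / 2 < r
    linarith
  · refine g.one_of_mem_closedBall ?_
    have : ξ ∈ Function.support f := hξ
    rw [f.support_eq] at this
    exact Metric.ball_subset_closedBall this
  · by_cases hξ : ξ ∈ Metric.closedBall a (r / 4)
    · have : f ξ = 1 := f.one_of_mem_closedBall hξ
      simp [this]
    · rw [Metric.mem_closedBall, not_le] at hξ
      have h0 : f₀ ξ = 0 := f₀.zero_of_le_dist (by change r / 8 ≤ _; linarith)
      rw [dist_eq_norm] at hξ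
      have : ‖ξ - a‖ ≠ 0 := (lt_trans (by positivity) hξ).ne'
      simp only [h0, add_zero]
      field_simp

end Hadamard

end ParametricTrace
end

noncomputable section

namespace ParametricTrace

/-! ### Families of smoothing operators -/

section LocallySmooth

variable {p n : ℕ} {M : Type*} [TopologicalSpace M] [ChartedSpace (EuclideanSpace ℝ (Fin n)) M]

variable {Γ : Set (EuclideanSpace ℝ (Fin p))}

theorem IsSmoothingKernel.add [IsManifold (𝓡 n) ∞ M] {k k' : Γ → M → M → ℂ}
    (hk : IsSmoothingKernel (n := n) Γ k) (hk' : IsSmoothingKernel (n := n) Γ k') :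
    IsSmoothingKernel (n := n) Γ fun μ x y => k μ x y + k' μ x y := by
  obtain ⟨U, K, hU, hΓU, hK, hKk, hKb⟩ := hk
  obtain ⟨V, K', hV, hΓV, hK', hKk', hKb'⟩ := hk'
  refine ⟨U ∩ V, fun z => K z + K' z, hU.inter hV, Set.subset_inter hΓU hΓV,
    (hK.mono (Set.prod_mono Set.inter_subset_left le_rfl)).add
      (hK'.mono (Set.prod_mono Set.inter_subset_right le_rfl)),
    fun μ x y => by simp only [hKk, hKk'], fun φ hφ ψ hψ Q hQ hQc L hL hLc l N => ?_⟩
  obtain ⟨c, hc⟩ := hKb φ hφ ψ hψ Q hQ hQc L hL hLc l N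
  obtain ⟨d, hd⟩ := hKb' φ hφ ψ hψ Q hQ hQc L hL hLc l N
  refine ⟨c + d, fun ξ hξ q hq => ?_⟩
  have h := congrArg norm (iteratedFDeriv_add_apply
    (contDiffAt_local hU hK hφ hψ (hΓU hξ.1) (hQ hq) l)
    (contDiffAt_local hV hK' hφ hψ (hΓV hξ.1) (hQ hq) l))
  refine le_trans (le_of_eq (congrArg ((1 + ‖ξ‖) ^ N * ·) h)) ?_
  refine le_trans (mul_le_mul_of_nonneg_left (norm_add_le _ _) (by positivity)) ?_
  rw [mul_add]
  exact add_le_add (hc ξ hξ q hq) (hd ξ hξ q hq)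

theorem IsLocallySmooth.contDiff {K : EuclideanSpace ℝ (Fin p) × M × M → ℂ}
    (hK : IsLocallySmooth n Set.univ K) (x y : M) : ContDiff ℝ ∞ fun μ => K (μ, x, y) := by
  let φ := chartAt (EuclideanSpace ℝ (Fin n)) x
  let ψ := chartAt (EuclideanSpace ℝ (Fin n)) y
  have h1 := hK φ (chart_mem_atlas _ x) ψ (chart_mem_atlas _ y)
  have h2 : ContDiff ℝ ∞ fun μ : EuclideanSpace ℝ (Fin p) => (μ, φ x, ψ y) := by fun_prop
  have h3 := h1.comp_contDiff h2 fun μ =>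
    ⟨trivial, mem_chart_target _ x, mem_chart_target _ y⟩
  have h4 : (fun μ => K (μ, x, y)) = localExpr K φ ψ ∘ fun μ => (μ, φ x, ψ y) := by
    funext μ
    change _ = K (μ, φ.symm (φ x), ψ.symm (ψ y))
    rw [φ.left_inv (mem_chart_source _ x), ψ.left_inv (mem_chart_source _ y)]
  rw [h4]
  exact h3

theorem IsLocallySmooth.integral_fderiv {K : EuclideanSpace ℝ (Fin p) × M × M → ℂ}
    (hK : IsLocallySmooth n Set.univ K) (a v : EuclideanSpace ℝ (Fin p)) :
    IsLocallySmooth n Set.univ fun z : EuclideanSpace ℝ (Fin p) × M × M =>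
      ∫ t in (0 : ℝ)..1, fderiv ℝ (fun μ => K (μ, z.2)) (a + t • (z.1 - a)) v :=
  fun φ hφ ψ hψ => contDiffOn_integral_fderiv (φ.open_target.prod ψ.open_target)
    (hK φ hφ ψ hψ) a v

theorem IsLocallySmooth.fst_mul {U : Set (EuclideanSpace ℝ (Fin p))}
    {K : EuclideanSpace ℝ (Fin p) × M × M → ℂ} (hK : IsLocallySmooth n U K)
    {f : EuclideanSpace ℝ (Fin p) → ℂ} (hf : ContDiff ℝ ∞ f) :
    IsLocallySmooth n U fun z => f z.1 * K z :=
  fun φ hφ ψ hψ => (hf.comp contDiff_fst).contDiffOn.mul (hK φ hφ ψ hψ)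

theorem IsLocallySmooth.fst_mul_of_support {U : Set (EuclideanSpace ℝ (Fin p))} (hU : IsOpen U)
    {K : EuclideanSpace ℝ (Fin p) × M × M → ℂ} (hK : IsLocallySmooth n U K)
    {f : EuclideanSpace ℝ (Fin p) → ℂ} (hf : ContDiff ℝ ∞ f) (hfU : tsupport f ⊆ U) :
    IsLocallySmooth n Set.univ fun z => f z.1 * K z := by
  intro φ hφ ψ hψ z hz
  by_cases hzf : z.1 ∈ tsupport f
  · exact ((hK.fst_mul hf φ hφ ψ hψ).contDiffAt
      ((isOpen_prod_target hU φ ψ).mem_nhds ⟨hfU hzf, hz.2⟩)).contDiffWithinAt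
  · have : localExpr (fun z : EuclideanSpace ℝ (Fin p) × M × M => f z.1 * K z) φ ψ =ᶠ[nhds z]
        fun _ => 0 := by
      filter_upwards [continuous_fst.continuousAt.preimage_mem_nhds
        ((isClosed_tsupport f).isOpen_compl.mem_nhds hzf)] with w hw
      change f w.1 * _ = 0
      rw [image_eq_zero_of_notMem_tsupport hw, zero_mul]
    exact (contDiffAt_const.congr_of_eventuallyEq this).contDiffWithinAt

theorem IsLocallySmooth.isSmoothKernel [IsManifold (𝓡 n) ∞ M]
    {U : Set (EuclideanSpace ℝ (Fin p))} (hU : IsOpen U)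
    {K : EuclideanSpace ℝ (Fin p) × M × M → ℂ} (hK : IsLocallySmooth n U K)
    {μ : EuclideanSpace ℝ (Fin p)} (hμ : μ ∈ U) : IsSmoothKernel n fun x y => K (μ, x, y) := by
  have h := (hK.contMDiffOn hU).comp (t := U ×ˢ Set.univ) (s := Set.univ)
    (f := fun z : M × M => (μ, z)) (contMDiff_const.prodMk contMDiff_id).contMDiffOn
    fun z _ => ⟨hμ, trivial⟩
  exact contMDiffOn_univ.1 h

end LocallySmooth

section Families

variable {p n : ℕ} {Γ : Set (EuclideanSpace ℝ (Fin p))} {M : Type*} [TopologicalSpace M]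
  [CompactSpace M] [ChartedSpace (EuclideanSpace ℝ (Fin n)) M] [IsManifold (𝓡 n) ∞ M]
  [MeasurableSpace M] [BorelSpace M] {ν : Measure M} [IsFiniteMeasure ν]

omit [TopologicalSpace M] [CompactSpace M] [ChartedSpace (EuclideanSpace ℝ (Fin n)) M]
  [IsManifold (𝓡 n) ∞ M] [BorelSpace M] [IsFiniteMeasure ν] in
theorem HasKernel.const_smul {T : L2 ν →L[ℂ] L2 ν} {k : M → M → ℂ} (h : HasKernel T k) (a : ℂ) :
    HasKernel (a • T) fun x y => a * k x y := by
  intro u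
  filter_upwards [h u, Lp.coeFn_smul a (T u)] with x h1 h3
  change ((a • T u : L2 ν) : M → ℂ) x = _
  rw [h3, Pi.smul_apply, h1, smul_eq_mul, ← integral_const_mul]
  simp only [mul_assoc]

theorem smul_mem_smoothingFamilies {m : EuclideanSpace ℝ (Fin p) → ℂ} (hm : m.HasTemperateGrowth)
    (A : smoothingFamilies n Γ ν) :
    (fun μ : Γ => m μ • A.1 μ) ∈ smoothingFamilies n Γ ν := by
  obtain ⟨k, hk, hA⟩ := A.2
  exact ⟨_, hk.mul_temperate hm, fun μ => (hA μ).const_smul _⟩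

variable (Γ) in
/-- The families `G(μ) T` with a Gaussian function `G`. -/
def gaussFamily {b : ℝ} (hb : 0 < b) : smoothOps n ν →ₗ[ℂ] smoothingFamilies n Γ ν where
  toFun T := ⟨fun μ => gauss b μ.1 • T.1, by
    obtain ⟨k, hk, hT⟩ := T.2
    exact ⟨_, isSmoothingKernel_gauss_mul hk hb, fun μ => hT.const_smul _⟩⟩
  map_add' S T := Subtype.ext (funext fun μ => smul_add (gauss b μ.1) S.1 T.1)
  map_smul' r T := Subtype.ext (funext fun μ => smul_comm (gauss b μ.1) r T.1)

theorem apply_mem_smoothOps (A : smoothingFamilies n Γ ν) (μ : Γ) : A.1 μ ∈ smoothOps n ν := by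
  obtain ⟨k, ⟨U, K, hU, hΓU, hK, hKk, -⟩, hA⟩ := A.2
  refine ⟨k μ, ?_, hA μ⟩
  have h := (isLocallySmooth_of_contMDiffOn hU hK).isSmoothKernel hU (hΓU μ.2)
  simp only [hKk] at h
  exact h

/-- Hadamard's lemma in the parameter, uniformly in the kernel variables. The factor `g` makes the
quotients compactly supported in the parameter, hence smoothing. -/
theorem IsLocallySmooth.exists_hasKernel_sum {S : EuclideanSpace ℝ (Fin p) × M × M → ℂ}
    (hS : IsLocallySmooth n Set.univ S) {g : EuclideanSpace ℝ (Fin p) → ℂ} (hg : ContDiff ℝ ∞ g)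
    (hgc : HasCompactSupport g) (a : EuclideanSpace ℝ (Fin p)) :
    ∃ B : Fin p → smoothingFamilies n Γ ν, ∀ μ : Γ,
      HasKernel (∑ j, ((μ.1 j - a j : ℝ) : ℂ) • (B j).1 μ)
        fun x y => g μ * (S (μ.1, x, y) - S (a, x, y)) := by
  obtain ⟨H, hH, hHS⟩ : ∃ H : Fin p → EuclideanSpace ℝ (Fin p) × M × M → ℂ,
      (∀ j, IsLocallySmooth n Set.univ (H j)) ∧ ∀ j μ z, H j (μ, z) = g μ * ∫ t in (0 : ℝ)..1,
        fderiv ℝ (fun μ => S (μ, z)) (a + t • (μ - a)) (EuclideanSpace.single j 1) :=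
    ⟨_, fun j => (hS.integral_fderiv a (EuclideanSpace.single j 1)).fst_mul hg, fun _ _ _ => rfl⟩
  have hHk : ∀ j, IsSmoothingKernel (n := n) Γ fun μ x y => H j (μ.1, x, y) := fun j =>
    (hH j).isSmoothingKernel hgc.isCompact fun μ hμ x y => by
      rw [hHS, image_eq_zero_of_notMem_tsupport hμ, zero_mul]
  have hHc : ∀ j (μ : Γ), Continuous fun z : M × M => H j (μ.1, z.1, z.2) := fun j μ =>
    ((hH j).isSmoothKernel isOpen_univ (μ := μ.1) trivial).continuous
  choose T hT using fun j (μ : Γ) => exists_hasKernel (ν := ν) (k := fun x y => H j (μ.1, x, y))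
    (hHc j μ)
  refine ⟨fun j => ⟨T j, _, hHk j, hT j⟩, fun μ => ?_⟩
  have hc : ∀ j x, Continuous fun y => ((μ.1 j - a j : ℝ) : ℂ) * H j (μ.1, x, y) := fun j x =>
    continuous_const.mul (Continuous.comp (g := fun z : M × M => H j (μ.1, z.1, z.2)) (hHc j μ)
      (Continuous.prodMk_right x))
  have h := hasKernel_sum ν Finset.univ hc fun j => (hT j μ).const_smul _
  convert h using 3 with x y
  rw [sub_eq_sum_integral_fderiv (hS.contDiff x y) a μ.1, Finset.mul_sum]
  refine Finset.sum_congr rfl fun j _ => ?_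
  rw [hHS]
  ring

/-- A family that vanishes at `a` is a combination of the functions `μ j - a j`. -/
theorem exists_eq_sum_smul (A : smoothingFamilies n Γ ν) {k : Γ → M → M → ℂ}
    (hk : IsSmoothingKernel (n := n) Γ k) (hA : ∀ μ, HasKernel (A.1 μ) (k μ)) (a : Γ)
    (ha : ∀ x y, k a x y = 0) : ∃ B : Fin p → smoothingFamilies n Γ ν,
      ∀ μ : Γ, A.1 μ = ∑ j, ((μ.1 j - a.1 j : ℝ) : ℂ) • (B j).1 μ := by
  obtain ⟨U, K, hU, hΓU, hK, hKk, -⟩ := hk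
  have hloc := isLocallySmooth_of_contMDiffOn hU hK
  obtain ⟨r, hr, hball⟩ := Metric.isOpen_iff.1 hU a.1 (hΓU a.2)
  obtain ⟨f, g, m, hfr, hfg, hm, hfm⟩ := exists_cutoff a.1 hr
  have hofReal : ∀ h : ContDiffBump a.1,
      ContDiff ℝ ∞ fun ξ => (h ξ : ℂ) := fun h => Complex.ofRealCLM.contDiff.comp h.contDiff
  -- The segments from `a` in Hadamard's lemma may leave `U`, so the kernel is first cut off near
  -- `a` and extended by zero.
  have hS : IsLocallySmooth n Set.univ fun z : EuclideanSpace ℝ (Fin p) × M × M =>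
      (f z.1 : ℂ) * K z := by
    refine hloc.fst_mul_of_support hU (hofReal f) ?_
    have h1 : tsupport (fun ξ => (f ξ : ℂ)) ⊆ tsupport f :=
      closure_mono fun x hx => by simpa using hx
    refine h1.trans (f.tsupport_eq.subset.trans ((Metric.closedBall_subset_ball hfr).trans hball))
  obtain ⟨near, hnear⟩ := hS.exists_hasKernel_sum (Γ := Γ) (ν := ν) (hofReal g)
    (g.hasCompactSupport.comp_left Complex.ofReal_zero) a.1
  have hmj : ∀ j : Fin p, (fun ξ : EuclideanSpace ℝ (Fin p) =>
      ((m ξ * (ξ j - a.1 j) : ℝ) : ℂ)).HasTemperateGrowth := fun j =>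
    Complex.ofRealCLM.hasTemperateGrowth.comp (hm.mul
      ((EuclideanSpace.proj (𝕜 := ℝ) j).hasTemperateGrowth.sub
        (Function.HasTemperateGrowth.const (a.1 j))))
  let far : Fin p → smoothingFamilies n Γ ν := fun j => ⟨_, smul_mem_smoothingFamilies (hmj j) A⟩
  refine ⟨fun j => near j + far j, fun μ => ?_⟩
  have hnear' : (f μ.1 : ℂ) • A.1 μ = ∑ j, ((μ.1 j - a.1 j : ℝ) : ℂ) • (near j).1 μ := by
    refine ((hA μ).const_smul _).unique ?_
    convert hnear μ using 3 with x y
    rw [hKk, hKk, ha, mul_zero, sub_zero]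
    by_cases hf : f μ.1 = 0
    · simp [hf]
    · simp [hfg _ hf]
  -- Here `1 - f = ∑ (μ_j - a_j)² m`: one factor `μ_j - a_j` is kept, the other goes into the family
  -- together with `m`.
  have hfar : ((1 - f μ.1 : ℝ) : ℂ) • A.1 μ = ∑ j, ((μ.1 j - a.1 j : ℝ) : ℂ) • (far j).1 μ := by
    have h1 : ‖μ.1 - a.1‖ ^ 2 = ∑ j, (μ.1 j - a.1 j) ^ 2 := by
      rw [EuclideanSpace.norm_sq_eq]
      simp
    simp only [far, smul_smul]
    rw [← Finset.sum_smul, hfm, h1]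
    congr 1
    push_cast
    rw [Finset.sum_mul]
    refine Finset.sum_congr rfl fun j _ => ?_
    ring
  have h5 : A.1 μ = (f μ.1 : ℂ) • A.1 μ + ((1 - f μ.1 : ℝ) : ℂ) • A.1 μ := by
    rw [← add_smul]
    push_cast
    rw [add_sub_cancel, one_smul]
  rw [h5, hnear', hfar, ← Finset.sum_add_distrib]
  refine Finset.sum_congr rfl fun j _ => ?_
  rw [← smul_add]
  rfl

end Families

end ParametricTrace
end

noncomputable section

namespace ParametricTrace

/-! ### Functions on cones with vanishing derivative -/

section Cones

variable {p : ℕ} {Γ : Set (EuclideanSpace ℝ (Fin p))}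

/-- For an open cone this is connectedness. For a closure the interior may fall into several
components, and they are linked by the apex: along each ray in `C` the function is constant, so it
has the value `h 0`, and `C` is dense. -/
theorem IsCone.exists_eq_const (hΓ : IsCone Γ) (hΓc : IsConnected Γ)
    {h : EuclideanSpace ℝ (Fin p) → ℂ} (hcont : ContinuousOn h Γ)
    (hder : ∀ ξ ∈ interior Γ, HasFDerivAt h (0 : EuclideanSpace ℝ (Fin p) →L[ℝ] ℂ) ξ) :
    ∃ c, ∀ ξ ∈ Γ, h ξ = c := by
  obtain ⟨⟨C, hC, -, hCt, hΓC⟩, hne⟩ := hΓ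
  rcases hΓC with rfl | rfl
  · obtain ⟨a, ha⟩ := hΓc.nonempty
    rw [hC.interior_eq] at hder
    exact ⟨h a, fun ξ hξ => hC.is_const_of_fderiv_eq_zero hΓc.isPreconnected
      (fun ζ hζ => (hder ζ hζ).differentiableAt.differentiableWithinAt)
      (fun ζ hζ => (hder ζ hζ).fderiv) hξ ha⟩
  · have hCi : C ⊆ interior (closure C) := hC.subset_interior_closure
    have hlim : ∀ ξ : EuclideanSpace ℝ (Fin p), Filter.Tendsto (fun t : ℝ => t • ξ)
        (nhdsWithin 0 (Set.Ioi 0)) (nhds 0) := fun ξ => by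
      have : Filter.Tendsto (fun t : ℝ => t • ξ) (nhds 0) (nhds ((0 : ℝ) • ξ)) :=
        (continuous_id.smul continuous_const).continuousAt
      rw [zero_smul] at this
      exact this.mono_left nhdsWithin_le_nhds
    have h0 : ∀ ξ ∈ C, (0 : EuclideanSpace ℝ (Fin p)) ∈ closure C ∧ h ξ = h 0 := by
      intro ξ hξ
      have hmem : ∀ᶠ t : ℝ in nhdsWithin 0 (Set.Ioi 0), t • ξ ∈ C := by
        filter_upwards [self_mem_nhdsWithin] with t ht using hCt t ht ξ hξ
      have h1 := mem_closure_of_tendsto (hlim ξ) hmem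
      refine ⟨h1, ?_⟩
      have h2 : Filter.Tendsto (fun t : ℝ => h (t • ξ)) (nhdsWithin 0 (Set.Ioi 0))
          (nhds (h 0)) :=
        (hcont 0 h1).tendsto.comp (tendsto_nhdsWithin_iff.2
          ⟨hlim ξ, hmem.mono fun t ht => subset_closure ht⟩)
      have h3 : ∀ᶠ t : ℝ in nhdsWithin 0 (Set.Ioi 0), h (t • ξ) = h ξ := by
        filter_upwards [Ioo_mem_nhdsGT (zero_lt_one' ℝ)] with s hs
        have hd : ∀ t ∈ Set.Icc s 1, HasDerivAt (fun t : ℝ => h (t • ξ)) 0 t := by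
          intro t ht
          have h4 : HasDerivAt (fun t : ℝ => t • ξ) ξ t := by
            simpa using (hasDerivAt_id t).smul_const ξ
          exact (hder _ (hCi (hCt t (hs.1.trans_le ht.1) ξ hξ))).comp_hasDerivAt t h4
        have h5 := constant_of_has_deriv_right_zero
          (fun t ht => (hd t ht).continuousAt.continuousWithinAt)
          (fun t ht => (hd t (Set.Ico_subset_Icc_self ht)).hasDerivWithinAt) 1
          (Set.right_mem_Icc.2 hs.2.le)
        simpa using h5.symm
      exact tendsto_nhds_unique (tendsto_const_nhds.congr' (h3.mono fun _ => Eq.symm)) h2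
    refine ⟨h 0, fun ξ hξ => ?_⟩
    exact Set.EqOn.of_subset_closure (f := h) (g := fun _ => h 0) (fun ζ hζ => (h0 ζ hζ).2) hcont
      continuousOn_const subset_closure le_rfl hξ

end Cones

/-! ### Tracial functionals on parametric smoothing operators -/

section Functionals

variable {p n : ℕ} {Γ : Set (EuclideanSpace ℝ (Fin p))} {M : Type*} [TopologicalSpace M]
  [CompactSpace M] [ChartedSpace (EuclideanSpace ℝ (Fin n)) M] [IsManifold (𝓡 n) ∞ M]
  [MeasurableSpace M] [BorelSpace M] {ν : Measure M} [IsFiniteMeasure ν]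

theorem hasTemperateGrowth_coord (j : Fin p) :
    (fun ξ : EuclideanSpace ℝ (Fin p) => ((ξ j : ℝ) : ℂ)).HasTemperateGrowth :=
  Complex.ofRealCLM.hasTemperateGrowth.comp (EuclideanSpace.proj (𝕜 := ℝ) j).hasTemperateGrowth

/-- Multiplication of a family by a coordinate function. -/
def coordMul (j : Fin p) (A : smoothingFamilies n Γ ν) : smoothingFamilies n Γ ν :=
  ⟨_, smul_mem_smoothingFamilies (hasTemperateGrowth_coord j) A⟩

/-- `τ (μ_j A) = μ_j τ A`. -/
def CommutesWithCoord (τ : smoothingFamilies n Γ ν →ₗ[ℂ] rapidSymbols Γ) : Prop :=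
  ∀ (j : Fin p) (A : smoothingFamilies n Γ ν) (μ : Γ),
    (τ (coordMul j A)).1 μ = ((μ.1 j : ℝ) : ℂ) * (τ A).1 μ

variable {τ : smoothingFamilies n Γ ν →ₗ[ℂ] rapidSymbols Γ}

/-- Each term maps to `(μ_j - a_j) τ(B_j)`, which vanishes at `a`. -/
theorem CommutesWithCoord.apply_eq_zero (hτ : CommutesWithCoord τ) (a : Γ)
    (A : smoothingFamilies n Γ ν) (B : Fin p → smoothingFamilies n Γ ν)
    (h : ∀ μ : Γ, A.1 μ = ∑ j, ((μ.1 j - a.1 j : ℝ) : ℂ) • (B j).1 μ) : (τ A).1 a = 0 := by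
  have hA : A = ∑ j, (coordMul j (B j) - ((a.1 j : ℝ) : ℂ) • B j) := by
    refine Subtype.ext (funext fun μ => ?_)
    rw [AddSubmonoidClass.coe_finsetSum, Finset.sum_apply, h]
    refine Finset.sum_congr rfl fun j _ => ?_
    rw [Complex.ofReal_sub, sub_smul]
    rfl
  rw [hA, map_sum, AddSubmonoidClass.coe_finsetSum, Finset.sum_apply]
  refine Finset.sum_eq_zero fun j _ => ?_
  rw [map_sub, map_smul]
  change (τ (coordMul j (B j))).1 a - ((a.1 j : ℝ) : ℂ) * (τ (B j)).1 a = 0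
  rw [hτ, sub_self]

/-- The value of `τ A` at `a` depends on the operator `A a` only. -/
theorem CommutesWithCoord.gauss_mul_apply (hτ : CommutesWithCoord τ) (a : Γ)
    (A : smoothingFamilies n Γ ν) : gauss 1 a.1 * (τ A).1 a =
      (τ (gaussFamily Γ one_pos ⟨_, apply_mem_smoothOps A a⟩)).1 a := by
  obtain ⟨k, hk, hA⟩ := A.2
  have hka : IsSmoothKernel n (k a) := by
    obtain ⟨U, K, hU, hΓU, hK, hKk, -⟩ := hk
    have h := (isLocallySmooth_of_contMDiffOn hU hK).isSmoothKernel hU (hΓU a.2)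
    simp only [hKk] at h
    exact h
  have h1 : IsSmoothingKernel (n := n) Γ fun μ x y =>
      gauss 1 a.1 * k μ x y + gauss 1 μ.1 * (-1 * k a x y) :=
    (hk.mul_temperate (Function.HasTemperateGrowth.const (gauss 1 a.1))).add
      (isSmoothingKernel_gauss_mul (k := fun x y => -1 * k a x y)
        (contMDiff_mul_complex (f := fun _ : M × M => -1)
        (g := fun z : M × M => k a z.1 z.2) contMDiff_const hka) one_pos)
  let T : smoothOps n ν := ⟨_, apply_mem_smoothOps A a⟩
  -- The family `G(a) A - G A(a)` vanishes at `a`; the Gaussian replaces the inadmissible constant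
  -- family `A(a)`.
  let R : smoothingFamilies n Γ ν := gauss 1 a.1 • A - gaussFamily Γ one_pos T
  have hc : ∀ (μ : Γ) x, Continuous (k μ x) := by
    intro μ x
    obtain ⟨U, K, hU, hΓU, hK, hKk, -⟩ := hk
    have h := (isLocallySmooth_of_contMDiffOn hU hK).isSmoothKernel hU (hΓU μ.2)
    simp only [hKk] at h
    exact h.continuous.comp (Continuous.prodMk_right x)
  have hR : ∀ μ, HasKernel (R.1 μ) fun x y =>
      gauss 1 a.1 * k μ x y + gauss 1 μ.1 * (-1 * k a x y) := by
    intro μ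
    have h2 := hasKernel_sum ν Finset.univ
      (T := ![gauss 1 a.1 • A.1 μ, gauss 1 μ.1 • (-1 : ℂ) • A.1 a])
      (k := ![fun x y => gauss 1 a.1 * k μ x y, fun x y => gauss 1 μ.1 * (-1 * k a x y)])
      (fun i x => by
        fin_cases i
        · exact continuous_const.mul (hc μ x)
        · exact continuous_const.mul (continuous_const.mul (hc a x)))
      (fun i => by
        fin_cases i
        · exact (hA μ).const_smul _
        · exact ((hA a).const_smul _).const_smul _)
    simp only [Fin.sum_univ_two, Matrix.cons_val_zero, Matrix.cons_val_one] at h2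
    convert h2 using 1
    rw [neg_one_smul, smul_neg, ← sub_eq_add_neg]
    rfl
  obtain ⟨B, hB⟩ := exists_eq_sum_smul R h1 hR a fun x y => by ring
  have h3 := hτ.apply_eq_zero a R B hB
  have h4 : τ R = gauss 1 a.1 • τ A - τ (gaussFamily Γ one_pos T) := by
    rw [map_sub, map_smul]
  rw [h4] at h3
  exact sub_eq_zero.1 h3

theorem hasLineDerivAt_gauss (b : ℝ) (ξ : EuclideanSpace ℝ (Fin p)) (j : Fin p) :
    HasLineDerivAt ℝ (gauss b) (((-2 * b * ξ j : ℝ) : ℂ) * gauss b ξ) ξ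
      (EuclideanSpace.single j 1) := by
  have h1 : HasFDerivAt (fun ξ : EuclideanSpace ℝ (Fin p) => ‖ξ‖ ^ 2) _ ξ :=
    (hasStrictFDerivAt_norm_sq ξ).hasFDerivAt
  have h2 : HasDerivAt (fun t : ℝ => ‖ξ + t • EuclideanSpace.single j (1 : ℝ)‖ ^ 2)
      (2 * ξ j) 0 := by
    have h := h1.hasLineDerivAt (EuclideanSpace.single j (1 : ℝ))
    simpa [HasLineDerivAt, EuclideanSpace.inner_single_right] using h
  have h3 := ((h2.const_mul (-b)).exp).ofReal_comp
  refine HasDerivAt.congr_deriv h3 ?_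
  simp only [gauss]
  rw [zero_smul, add_zero]
  push_cast
  ring

/-- Differentiating the Gaussian is multiplication by `-2 μ_j`, so the axioms on `∂_j` and `μ_j`
combine into a differential equation for `τ (G T)`. -/
theorem isPartialDeriv_gaussFamily (j : Fin p) (T : smoothOps n ν) :
    IsPartialDeriv j (gaussFamily Γ one_pos T).1
      ((-2 : ℂ) • coordMul j (gaussFamily Γ one_pos T)).1 := by
  intro μ hμ
  have h1 : HasLineDerivAt ℝ (fun ξ => gauss 1 ξ • T.1)
      ((((-2 * 1 * μ.1 j : ℝ) : ℂ) * gauss 1 μ.1) • T.1) μ.1 (EuclideanSpace.single j 1) :=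
    (hasLineDerivAt_gauss 1 μ.1 j).smul_const T.1
  have h2 : Function.extend Subtype.val (gaussFamily Γ one_pos T).1 0 =ᶠ[nhds μ.1]
      fun ξ => gauss 1 ξ • T.1 := by
    filter_upwards [isOpen_interior.mem_nhds hμ] with ξ hξ
    exact Subtype.val_injective.extend_apply (gaussFamily Γ one_pos T).1 0
      (⟨ξ, interior_subset hξ⟩ : Γ)
  have h3 := h1.congr_of_eventuallyEq h2
  refine HasDerivAt.congr_deriv h3 ?_
  change _ = (-2 : ℂ) • ((μ.1 j : ℝ) : ℂ) • gauss 1 μ.1 • T.1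
  rw [smul_smul, smul_smul]
  push_cast
  congr 1
  ring

/-- The function `τ (G T) / G` is constant for Gaussian `G`. -/
theorem CommutesWithCoord.exists_eq_const_mul_gauss (hτ : CommutesWithCoord τ)
    (hΓ : IsCone Γ) (hΓc : IsConnected Γ)
    (hd : ∀ (j : Fin p) (A dA : smoothingFamilies n Γ ν),
      IsPartialDeriv j A.1 dA.1 → IsPartialDeriv j (τ A).1 (τ dA).1)
    (T : smoothOps n ν) :
    ∃ c, ∀ μ : Γ, (τ (gaussFamily Γ one_pos T)).1 μ = c * gauss 1 μ.1 := by
  obtain ⟨U, F, hU, hΓU, hF, hFτ, -⟩ := (τ (gaussFamily Γ one_pos T)).2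
  have hline : ∀ ξ ∈ interior Γ, ∀ j, HasLineDerivAt ℝ F (((-2 * ξ j : ℝ) : ℂ) * F ξ) ξ
      (EuclideanSpace.single j 1) := by
    intro ξ hξ j
    have h1 := hd j _ _ (isPartialDeriv_gaussFamily j T) ⟨ξ, interior_subset hξ⟩ hξ
    have h2 : F =ᶠ[nhds ξ] Function.extend Subtype.val (τ (gaussFamily Γ one_pos T)).1 0 := by
      filter_upwards [isOpen_interior.mem_nhds hξ] with ζ hζ
      rw [hFτ ⟨ζ, interior_subset hζ⟩]
      exact (Subtype.val_injective.extend_apply (τ (gaussFamily Γ one_pos T)).1 0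
        (⟨ζ, interior_subset hζ⟩ : Γ)).symm
    have h3 := h1.congr_of_eventuallyEq h2
    refine HasDerivAt.congr_deriv h3 ?_
    rw [map_smul]
    change (-2 : ℂ) * (τ (coordMul j (gaussFamily Γ one_pos T))).1 ⟨ξ, interior_subset hξ⟩ = _
    rw [hτ, ← hFτ]
    push_cast
    ring
  -- Since `F` and the Gaussian solve the same equation `∂_j F = -2 ξ_j F`, the quotient `h` has
  -- vanishing partial derivatives.
  let h : EuclideanSpace ℝ (Fin p) → ℂ := fun ξ => F ξ * gauss (-1) ξ
  have hsmooth : ContDiffOn ℝ ∞ h U := hF.mul (contDiff_gauss (-1)).contDiffOn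
  obtain ⟨c, hc⟩ := hΓ.exists_eq_const hΓc (h := h) (hsmooth.continuousOn.mono hΓU) (by
    intro ξ hξ
    have hdiff : DifferentiableAt ℝ h ξ :=
      (hsmooth.contDiffAt (hU.mem_nhds (hΓU (interior_subset hξ)))).differentiableAt (by simp)
    have hzero : fderiv ℝ h ξ = 0 := by
      ext v
      have hv : v = ∑ j, v j • EuclideanSpace.single j (1 : ℝ) := by
        ext i
        simp [Finset.sum_apply, Pi.single_apply]
      rw [hv, map_sum, _root_.zero_apply]
      refine Finset.sum_eq_zero fun j _ => ?_
      have h1 : HasLineDerivAt ℝ h 0 ξ (EuclideanSpace.single j 1) := by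
        have h2 := HasDerivAt.mul (hline ξ hξ j) (hasLineDerivAt_gauss (-1) ξ j)
        refine HasDerivAt.congr_deriv h2 ?_
        rw [zero_smul, add_zero]
        push_cast
        ring
      rw [map_smul, (hdiff.hasFDerivAt.hasLineDerivAt _).unique h1, smul_zero]
    rw [← hzero]
    exact hdiff.hasFDerivAt)
  refine ⟨c, fun μ => ?_⟩
  rw [← hc μ.1 μ.2, ← hFτ]
  simp only [h]
  rw [mul_assoc, ← gauss_add, neg_add_cancel]
  simp [gauss]

end Functionals

end ParametricTrace
end

/-! ### Assembly of the three ingredients -/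

theorem proposition3p9 (p n : ℕ) (Γ : Set (EuclideanSpace ℝ (Fin p)))
    (hΓ : ParametricTrace.IsCone Γ) (hΓ_conn : IsConnected Γ)
    {M : Type*} [TopologicalSpace M] [T2Space M] [CompactSpace M]
    [ChartedSpace (EuclideanSpace ℝ (Fin n)) M] [IsManifold (𝓡 n) ∞ M]
    [MeasurableSpace M] [BorelSpace M] (ν : Measure M) [IsFiniteMeasure ν]
    (hν : ParametricTrace.IsSmoothDensity (n := n) ν)
    (τ : ParametricTrace.smoothingFamilies n Γ ν →ₗ[ℂ] ParametricTrace.rapidSymbols Γ)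
    -- `τ (A B) = τ (B A)`
    (h_trace : ∀ A B AB BA : ParametricTrace.smoothingFamilies n Γ ν,
      (∀ μ : Γ, AB.1 μ = (A.1 μ).comp (B.1 μ)) → (∀ μ : Γ, BA.1 μ = (B.1 μ).comp (A.1 μ)) →
        τ AB = τ BA)
    -- `τ (∂_j A) = ∂_j (τ A)`
    (h_deriv : ∀ (j : Fin p) (A dA : ParametricTrace.smoothingFamilies n Γ ν),
      ParametricTrace.IsPartialDeriv j A.1 dA.1 →
        ParametricTrace.IsPartialDeriv j (τ A).1 (τ dA).1)
    -- `τ (μ_j A) = μ_j (τ A)`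
    (h_mul : ∀ (j : Fin p) (A mA : ParametricTrace.smoothingFamilies n Γ ν),
      (∀ μ : Γ, mA.1 μ = ((μ.1 j : ℝ) : ℂ) • A.1 μ) →
        ∀ μ : Γ, (τ mA).1 μ = ((μ.1 j : ℝ) : ℂ) * (τ A).1 μ) :
    ∃ c : ℂ, ∀ (A : ParametricTrace.smoothingFamilies n Γ ν) (μ : Γ),
      ∃ t : ℂ, ParametricTrace.HasTrace (A.1 μ) t ∧ (τ A).1 μ = c * t := by
  obtain ⟨E, hE⟩ := ParametricTrace.exists_trace (n := n) hν
  have hτ : ParametricTrace.CommutesWithCoord τ := fun j A μ =>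
    h_mul j A _ (fun _ => rfl) μ
  obtain ⟨c, hc⟩ := hτ.exists_eq_const_mul_gauss hΓ hΓ_conn h_deriv E
  refine ⟨c, fun A μ => ?_⟩
  obtain ⟨s, hs, hst⟩ := hE ⟨_, ParametricTrace.apply_mem_smoothOps A μ⟩
  refine ⟨s, hs, ?_⟩
  -- At the fixed parameter `μ`, this is the functional `T ↦ τ(G T)(μ)`.
  let t : ParametricTrace.smoothOps n ν →ₗ[ℂ] ℂ :=
    (LinearMap.proj μ).comp ((ParametricTrace.rapidSymbols Γ).subtype.comp
      (τ.comp (ParametricTrace.gaussFamily Γ one_pos)))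
  have ht : ParametricTrace.IsTracial t := by
    intro S T ST TS h1 h2
    -- Two Gaussians of half the exponent write `G X Y` as a product of smoothing families, so that
    -- the trace axiom applies.
    have hcomp : ∀ (X Y Z : ParametricTrace.smoothOps n ν), Z.1 = X.1.comp Y.1 → ∀ ξ : Γ,
        (ParametricTrace.gaussFamily Γ one_pos Z).1 ξ =
          ((ParametricTrace.gaussFamily Γ (half_pos one_pos) X).1 ξ).comp
            ((ParametricTrace.gaussFamily Γ (half_pos one_pos) Y).1 ξ) := by
      intro X Y Z hZ ξ
      change ParametricTrace.gauss 1 ξ.1 • Z.1 = (ParametricTrace.gauss (1 / 2) ξ.1 • X.1).comp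
        (ParametricTrace.gauss (1 / 2) ξ.1 • Y.1)
      rw [hZ, ContinuousLinearMap.smul_comp, ContinuousLinearMap.comp_smul, smul_smul,
        ← ParametricTrace.gauss_add, add_halves]
    exact congrArg (fun f : ParametricTrace.rapidSymbols Γ => f.1 μ)
      (h_trace _ _ _ _ (hcomp S T ST h1) (hcomp T S TS h2))
  -- Locality and uniqueness give `G(μ) τ(A)(μ) = t(E) s`, and `t(E) = c G(μ)`; the Gaussian
  -- cancels.
  have h3 := (hτ.gauss_mul_apply μ A).trans (hst t ht)
  have h4 : t E = c * ParametricTrace.gauss 1 μ.1 := hc μ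
  rw [h4] at h3
  exact mul_left_cancel₀ (ParametricTrace.gauss_ne_zero 1 μ.1) (by rw [h3]; ring)
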